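/- **Proposition 3.3 (pointwise energy decay).** Let $n\ge 1$ and let $a,b,c\in C^\infty(\mathbb R^n)$ satisfy, with positive constants $a_i,b_i,c_i$, $$a_0(1+|x|)^{-\alpha}\le a(x)\le a_1(1+|x|)^{-\alpha},\quad b_0(1+|x|)^{\beta}\le b(x)\le b_1(1+|x|)^{\beta},\quad c_0(1+|x|)^{-\gamma}\le c(x)\le c_1(1+|x|)^{-\gamma},$$ where the real exponents satisfy $\beta+\gamma<2$ and $2\alpha+\beta-\gamma<2$. Let $q\in C^1([0,\infty))$ satisfy $0<q'(|x|)\le\sqrt{c(x)/b(x)}$ for all $x\in\mathbb R^n$ and $q(r)\ge q_0r^{1-(\beta+\gamma)/2}$ for all $r\ge 0$ with some $q_0>0$. Let $R>0$, let $k\ge 0$ be an integer, let $\theta>0$, and let $\nu=\theta+\omega$ with $\max\{0,\tfrac{2(\alpha-\gamma)}{2-\beta-\gamma}\}<\omega<1$. Consider $h\in C^\infty(\mathbb R^n\times[0,\infty))$ with $h(x,t)=0$ for $q(|x|)>t+q(R)$, data $u_0\in H^1(\mathbb R^n)$ and $u_1\in L^2(\mathbb R^n)$ vanishing (a.e.)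 for $|x|>R$, and a weak solution $u\in C^k([0,\infty);H^1(\mathbb R^n))\cap C^{k+1}([0,\infty);L^2(\mathbb R^n))$ of $$c(x)u_{tt}-\operatorname{div}(b(x)\nabla u)+a(x)u_t=h(x,t)\quad\text{in }\mathbb R^n\times(0,\infty),\qquad u|_{t=0}=u_0,\quad u_t|_{t=0}=u_1 .$$ Write $E(t;v)=\frac12\int_{\mathbb R^n}(c\,v_t^2+b|\nabla v|^2)\,dx$. Consider the estimate $$E(T;\partial_t^ku)\le C(1+T)^{-\theta-2k-1}\Big[(1+T_0)^{\nu}\sum_{i=0}^kE(T_0;\partial_t^iu)+\int_{T_0}^T(1+t)^{\theta}E(t;u)\,dt+\int_{T_0}^T\!\!\int_{\mathbb R^n}(1+t)^{\theta+1}\sum_{i=0}^k\frac{(1+t)^{2i}(\partial_t^ih(x,t))^2}{a(x)}\,dx\,dt\Big].\tag{$*$}$$ 1. For every $T_0\ge 0$ there is a constant $C>0$, independent of $h,u_0,u_1,u$ and $T$, such that $(*)$ holds for all $T\ge T_0$. 2. There is a constant $C>0$, independent of $h,u_0,u_1,u,T_0$ and $T$, such that $(*)$ holds for all $T_0\ge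 0$ and $T\ge 2T_0$. -/

import Mathlib

open Set MeasureTheory
open scoped ContDiff

noncomputable section

namespace DampedWave

/-- Euclidean space `ℝⁿ`. -/
abbrev Rn (n : ℕ) : Type := EuclideanSpace ℝ (Fin n)

/-- The real Hilbert space `L²(ℝⁿ)`. -/
abbrev L2 (n : ℕ) : Type := Lp ℝ 2 (volume : Measure (Rn n))

/-- The space `L²(ℝⁿ; ℝⁿ)` of square integrable vector fields. -/
abbrev L2Vec (n : ℕ) : Type := Lp (Rn n) 2 (volume : Measure (Rn n))

/-- `g` is the weak gradient of `f`: `∫ f ∂_v φ = - ∫ (g · v) φ` for every test function `φ` and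
every direction `v`. -/
def IsWeakGradient {n : ℕ} (f : L2 n) (g : L2Vec n) : Prop :=
  ∀ φ : Rn n → ℝ, ContDiff ℝ ∞ φ → HasCompactSupport φ → ∀ v : Rn n,
    ∫ x, f x * fderiv ℝ φ x v = -∫ x, inner ℝ (g x) v * φ x

theorem integrable_mul_test {n : ℕ} (f : L2 n) {ψ : Rn n → ℝ} (hψ : Continuous ψ)
    (hc : HasCompactSupport ψ) : Integrable (fun x => f x * ψ x) := by
  have h1 : LocallyIntegrable (f : Rn n → ℝ) volume :=
    (Lp.memLp f).locallyIntegrable (by norm_num)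
  exact h1.integrable_smul_right_of_hasCompactSupport hψ hc

theorem integrable_inner_mul_test {n : ℕ} (g : L2Vec n) (v : Rn n) {ψ : Rn n → ℝ}
    (hψ : Continuous ψ) (hc : HasCompactSupport ψ) :
    Integrable (fun x => inner ℝ (g x) v * ψ x) := by
  have h1 : LocallyIntegrable (fun x => inner ℝ (g x) v) volume :=
    ((Lp.memLp g).inner_const v).locallyIntegrable (by norm_num)
  exact h1.integrable_smul_right_of_hasCompactSupport hψ hc

theorem integrable_mul_fderiv_test {n : ℕ} (f : L2 n) {φ : Rn n → ℝ} (hφ : ContDiff ℝ ∞ φ)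
    (hc : HasCompactSupport φ) (v : Rn n) : Integrable (fun x => f x * fderiv ℝ φ x v) :=
  integrable_mul_test f ((hφ.continuous_fderiv (by simp)).clm_apply continuous_const)
    (hc.fderiv_apply ℝ v)

/-- The Sobolev space `H¹(ℝⁿ)`, realised as the space of pairs `(f, ∇f)` with `f ∈ L²` whose weak
gradient `∇f` is in `L²`.  Its norm `max ‖f‖ ‖∇f‖` is equivalent to the usual one. -/
def H1 (n : ℕ) : Submodule ℝ (L2 n × L2Vec n) where
  carrier := {p | IsWeakGradient p.1 p.2}
  zero_mem' := by
    intro φ _ _ v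
    have h1 : ∀ᵐ x : Rn n, ((0 : L2 n × L2Vec n).1 : Rn n → ℝ) x * fderiv ℝ φ x v = 0 := by
      filter_upwards [Lp.coeFn_zero ℝ 2 (volume : Measure (Rn n))] with x hx
      rw [Prod.fst_zero, hx, Pi.zero_apply, zero_mul]
    have h2 : ∀ᵐ x : Rn n, inner ℝ (((0 : L2 n × L2Vec n).2 : Rn n → Rn n) x) v * φ x = 0 := by
      filter_upwards [Lp.coeFn_zero (Rn n) 2 (volume : Measure (Rn n))] with x hx
      rw [Prod.snd_zero, hx, Pi.zero_apply, inner_zero_left, zero_mul]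
    rw [integral_eq_zero_of_ae h1, integral_eq_zero_of_ae h2, neg_zero]
  add_mem' := by
    intro p r hp hr φ hφ hc v
    have h1 : ∀ᵐ x : Rn n, ((p + r).1 : Rn n → ℝ) x * fderiv ℝ φ x v
        = p.1 x * fderiv ℝ φ x v + r.1 x * fderiv ℝ φ x v := by
      filter_upwards [Lp.coeFn_add p.1 r.1] with x hx
      rw [Prod.fst_add, hx, Pi.add_apply, add_mul]
    have h2 : ∀ᵐ x : Rn n, inner ℝ (((p + r).2 : Rn n → Rn n) x) v * φ x
        = inner ℝ (p.2 x) v * φ x + inner ℝ (r.2 x) v * φ x := by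
      filter_upwards [Lp.coeFn_add p.2 r.2] with x hx
      rw [Prod.snd_add, hx, Pi.add_apply, inner_add_left, add_mul]
    rw [integral_congr_ae h1, integral_congr_ae h2,
      integral_add (integrable_mul_fderiv_test _ hφ hc v) (integrable_mul_fderiv_test _ hφ hc v),
      integral_add (integrable_inner_mul_test _ v hφ.continuous hc)
        (integrable_inner_mul_test _ v hφ.continuous hc), hp φ hφ hc v, hr φ hφ hc v]
    ring
  smul_mem' := by
    intro s p hp φ hφ hc v
    have h1 : ∀ᵐ x : Rn n, ((s • p).1 : Rn n → ℝ) x * fderiv ℝ φ x v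
        = s * (p.1 x * fderiv ℝ φ x v) := by
      filter_upwards [Lp.coeFn_smul s p.1] with x hx
      rw [Prod.smul_fst, hx, Pi.smul_apply, smul_eq_mul, mul_assoc]
    have h2 : ∀ᵐ x : Rn n, inner ℝ (((s • p).2 : Rn n → Rn n) x) v * φ x
        = s * (inner ℝ (p.2 x) v * φ x) := by
      filter_upwards [Lp.coeFn_smul s p.2] with x hx
      rw [Prod.smul_snd, hx, Pi.smul_apply, real_inner_smul_left, mul_assoc]
    rw [integral_congr_ae h1, integral_congr_ae h2, integral_const_mul, integral_const_mul,
      hp φ hφ hc v]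
    ring

/-- The inclusion `H¹(ℝⁿ) → L²(ℝⁿ)`. -/
def H1.toL2 {n : ℕ} : H1 n →L[ℝ] L2 n :=
  (ContinuousLinearMap.fst ℝ (L2 n) (L2Vec n)).comp (H1 n).subtypeL

/-- The weak gradient `H¹(ℝⁿ) → L²(ℝⁿ; ℝⁿ)`. -/
def H1.grad {n : ℕ} : H1 n →L[ℝ] L2Vec n :=
  (ContinuousLinearMap.snd ℝ (L2 n) (L2Vec n)).comp (H1 n).subtypeL

/-- `f` is bounded above and below by positive multiples of `(1 + |x|) ^ s`. -/
def HasPowerGrowth {n : ℕ} (f : Rn n → ℝ) (s : ℝ) : Prop :=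
  ∃ m M : ℝ, 0 < m ∧ 0 < M ∧
    ∀ x : Rn n, m * (1 + ‖x‖) ^ s ≤ f x ∧ f x ≤ M * (1 + ‖x‖) ^ s

/-- The velocity `v_t(t) ∈ L²` of a curve `v : [0, ∞) → H¹`: the derivative of `v` in `L²`
(one-sided at `t = 0`). -/
def velocity {n : ℕ} (v : ℝ → H1 n) (t : ℝ) : L2 n :=
  derivWithin (fun s => H1.toL2 (v s)) (Ici 0) t

/-- The curve `∂_t^k u : [0, ∞) → H¹`, derivatives being taken in `H¹`. -/
def timeDeriv {n : ℕ} (k : ℕ) (u : ℝ → H1 n) : ℝ → H1 n :=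
  iteratedDerivWithin k u (Ici 0)

/-- The energy `E(t; v) = ½ ∫ (c v_t² + b |∇v|²) dx`. -/
def energy {n : ℕ} (b c : Rn n → ℝ) (v : ℝ → H1 n) (t : ℝ) : ℝ :=
  (1 / 2) * ∫ x, (c x * (velocity v t x) ^ 2 + b x * ‖H1.grad (v t) x‖ ^ 2)

/-- The time derivative `∂_t^i h(x, t)` of a source on `ℝⁿ × [0, ∞)`
(the time variable is written first in Lean). -/
def sourceDeriv {n : ℕ} (i : ℕ) (h : ℝ → Rn n → ℝ) (t : ℝ) (x : Rn n) : ℝ :=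
  iteratedDerivWithin i (fun s => h s x) (Ici 0) t

/-- `u` is a weak solution of `c u_tt - div (b ∇u) + a u_t = h` in `ℝⁿ × (0, ∞)` with data
`u(0) = u₀`, `u_t(0) = u₁`, in the class `C^k([0, ∞); H¹) ∩ C^(k+1)([0, ∞); L²)`.
For `k = 0` this is the class of finite energy solutions; for general `k` it is the class in which
`∂_t^i u` is a finite energy solution for each `i ≤ k`. -/
structure IsSolution {n : ℕ} (a b c : Rn n → ℝ) (h : ℝ → Rn n → ℝ) (k : ℕ)
    (u₀ : H1 n) (u₁ : L2 n) (u : ℝ → H1 n) : Prop where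
  contDiffOn_H1 : ContDiffOn ℝ k u (Ici 0)
  contDiffOn_L2 : ContDiffOn ℝ (k + 1) (fun t => H1.toL2 (u t)) (Ici 0)
  initial : u 0 = u₀
  initial_velocity : velocity u 0 = u₁
  equation : ∀ φ : Rn n → ℝ, ContDiff ℝ ∞ φ → HasCompactSupport φ → ∀ t : ℝ, 0 < t →
    HasDerivAt (fun s => ∫ x, c x * velocity u s x * φ x)
      ((∫ x, h t x * φ x) - (∫ x, b x * fderiv ℝ φ x (H1.grad (u t) x))
        - ∫ x, a x * velocity u t x * φ x) t

/-- The radial profile `q` controlling the speed of propagation: `q` is `C¹` on `[0, ∞)`,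
`0 < q'(|x|) ≤ √(c(x)/b(x))`, and `q(r) ≥ q₀ r ^ (1 - σ / 2)` for some `q₀ > 0`
(with `σ = β + γ` in the application). -/
structure IsSpeedProfile {n : ℕ} (b c : Rn n → ℝ) (σ : ℝ) (q : ℝ → ℝ) : Prop where
  contDiffOn : ContDiffOn ℝ 1 q (Ici 0)
  deriv_pos : ∀ x : Rn n, 0 < derivWithin q (Ici 0) ‖x‖
  deriv_le : ∀ x : Rn n, derivWithin q (Ici 0) ‖x‖ ≤ √(c x / b x)
  growth : ∃ q₀ : ℝ, 0 < q₀ ∧ ∀ r : ℝ, 0 ≤ r → q₀ * r ^ (1 - σ / 2) ≤ q r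

/-- A smooth source on `ℝⁿ × [0, ∞)` with `h(x, t) = 0` for `q(|x|) > t + q(R)`. -/
structure IsSource {n : ℕ} (q : ℝ → ℝ) (R : ℝ) (h : ℝ → Rn n → ℝ) : Prop where
  smooth : ContDiffOn ℝ ∞ (fun p : ℝ × Rn n => h p.1 p.2) (Ici 0 ×ˢ univ)
  support : ∀ t : ℝ, 0 ≤ t → ∀ x : Rn n, t + q R < q ‖x‖ → h t x = 0

/-- The bracket on the right-hand side of the weighted energy estimate:
`(1+T₀)^ν ∑_{i ≤ k} E(T₀; ∂_t^i u) + ∫_{T₀}^T (1+t)^θ E(t; u) dt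
  + ∫_{T₀}^T ∫ (1+t)^(θ+1) ∑_{i ≤ k} (1+t)^(2i) (∂_t^i h)² / a dx dt`. -/
def energyBound {n : ℕ} (a b c : Rn n → ℝ) (h : ℝ → Rn n → ℝ) (k : ℕ) (θ ν : ℝ)
    (u : ℝ → H1 n) (T₀ T : ℝ) : ℝ :=
  (1 + T₀) ^ ν * ∑ i ∈ Finset.range (k + 1), energy b c (timeDeriv i u) T₀
    + (∫ t in T₀..T, (1 + t) ^ θ * energy b c u t)
    + ∫ t in T₀..T, ∫ x, (1 + t) ^ (θ + 1) *
        ∑ i ∈ Finset.range (k + 1), (1 + t) ^ (2 * i) * (sourceDeriv i h t x) ^ 2 / a x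

end DampedWave

end

/-! The proof combines finite speed of propagation, two differential inequalities for each time
derivative of the solution, and an induction that couples consecutive time derivatives.

Propagation. The bound on `q'` makes `q(|x|) - t` a subsolution of the eikonal equation, so
weighting the energy by `exp (l (ψ - t))`, with `ψ` a truncation of `q(|x|) - q(R)`, gives a bound
uniform in `l`; letting `l` grow forces `u(t)` to vanish where `q(|x|) > t + q(R)`
(`IsSolution.vanishesOn`). There `1 + |x|` is at most a multiple of `(1 + t) ^ (2 / (2 - β - γ))`,
so on the support `c ≤ C (1 + t) ^ δ a` with `δ = ω₀ < 1`, and `a ≤ C (1 + t) ^ μ c` for some `μ`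
(`IsSpeedProfile.exists_le_mul_rpow_mul`).

One level. For `v = ∂_t^j u` let `E` be the energy, `D = ∫ a v_t²`, `P = ∫ c v_t²`, `V = ∫ a v²`, `X
= ∫ c v_t v`, `G = ∫ (∂_t^j h)² / a`. The multiplier `v_t` gives `E' ≤ -D/2 + G/2`; the multiplier
`v` gives `(X + V/2)' = 2P - 2E + ∫ (∂_t^j h) v` (`IsEnergySol.energyLevel`). For weak solutions the
first identity is proved for Steklov averages in time, whose velocity is an admissible `H¹` test
function, and then passed to the limit.

Induction. The levels are linked by `V (j + 1) = D j`. With the weights `(1 + t) ^ (θ - N) (κ + t) ^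
i`, the energy inequality bounds the weighted `E j` and `∫ D j` at power `i = N + 2j + 1` by `∫ E j`
at one power less. For `j = 0` the latter is controlled by the hypothesis on `∫ (1 + t) ^ θ E`; for
`j + 1` the virial inequality bounds it by the weighted `∫ D j` already estimated, plus terms
absorbed because `κ + t ≥ A (1 + t) ^ δ` with `A` large (`EnergyTower.exists_weighted_bound`).

The shift `κ` satisfies `κ + T₀ = K (1 + T₀) ^ δ`. Hence at `T₀` the weight is smaller than the pure
power of `1 + T₀` by a factor that improves with `N`, and only `(1 + T₀) ^ (θ + δ)` multiplies the
initial energies. At `T` it is comparable to `(1 + T) ^ (θ + 2k + 1)` as soon as `1 + T ≤ Λ (1 + T -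
T₀)` (`EnergyTower.exists_decay`). The two assertions are the choices `Λ = 1 + T₀` and `Λ = 2`. -/

noncomputable section

namespace DampedWave

open Filter Topology

/-! ### Bilinear forms on `L²` with bounded kernels -/

section KernelForm

theorem integrable_norm_mul_norm {n : ℕ} {E F : Type*} [NormedAddCommGroup E]
    [NormedAddCommGroup F] (f : Lp E 2 (volume : Measure (Rn n)))
    (g : Lp F 2 (volume : Measure (Rn n))) : Integrable (fun x => ‖f x‖ * ‖g x‖) :=
  (Lp.memLp f).norm.integrable_mul (Lp.memLp g).norm

theorem integral_norm_mul_norm_le {n : ℕ} {E F : Type*} [NormedAddCommGroup E]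
    [NormedAddCommGroup F] (f : Lp E 2 (volume : Measure (Rn n)))
    (g : Lp F 2 (volume : Measure (Rn n))) : ∫ x, ‖f x‖ * ‖g x‖ ≤ ‖f‖ * ‖g‖ := by
  have hf := (Lp.memLp f).norm
  have hg := (Lp.memLp g).norm
  have h1 : ∫ x, ‖f x‖ * ‖g x‖ = inner ℝ (hf.toLp _) (hg.toLp _) := by
    rw [L2.inner_def]
    refine integral_congr_ae ?_
    filter_upwards [hf.coeFn_toLp, hg.coeFn_toLp] with x h1 h2
    rw [h1, h2]
    simp [mul_comm]
  rw [h1]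
  refine (real_inner_le_norm _ _).trans (le_of_eq ?_)
  rw [Lp.norm_toLp, Lp.norm_toLp, eLpNorm_norm, eLpNorm_norm, Lp.norm_def, Lp.norm_def]

variable {n : ℕ} {E F : Type*} [NormedAddCommGroup E] [NormedSpace ℝ E]
  [NormedAddCommGroup F] [NormedSpace ℝ F]

/-- A measurable, uniformly bounded family of bilinear forms. -/
structure IsKernel (K : Rn n → E → F → ℝ) : Prop where
  add_left : ∀ x e e' f, K x (e + e') f = K x e f + K x e' f
  smul_left : ∀ x (s : ℝ) e f, K x (s • e) f = s * K x e f
  add_right : ∀ x e f f', K x e (f + f') = K x e f + K x e f'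
  smul_right : ∀ x (s : ℝ) e f, K x e (s • f) = s * K x e f
  bound : ∃ C : ℝ, ∀ x e f, |K x e f| ≤ C * (‖e‖ * ‖f‖)
  measurable : ∀ (f : Rn n → E) (g : Rn n → F), AEStronglyMeasurable f volume →
    AEStronglyMeasurable g volume → AEStronglyMeasurable (fun x => K x (f x) (g x)) volume

theorem IsKernel.integrable {K : Rn n → E → F → ℝ} (hK : IsKernel K)
    (f : Lp E 2 (volume : Measure (Rn n))) (g : Lp F 2 (volume : Measure (Rn n))) :
    Integrable (fun x => K x (f x) (g x)) := by
  obtain ⟨C, hC⟩ := hK.bound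
  exact ((integrable_norm_mul_norm f g).const_mul C).mono'
    (hK.measurable _ _ (Lp.memLp f).1 (Lp.memLp g).1)
    (Eventually.of_forall fun x => hC x _ _)

/-- The bounded bilinear form `(f, g) ↦ ∫ K(x)(f x, g x) dx`. -/
def kernelForm (K : Rn n → E → F → ℝ) (hK : IsKernel K) :
    Lp E 2 (volume : Measure (Rn n)) →L[ℝ] Lp F 2 (volume : Measure (Rn n)) →L[ℝ] ℝ :=
  (LinearMap.mk₂ ℝ (fun f g => ∫ x, K x (f x) (g x))
      (fun f f' g => by
        rw [← integral_add (hK.integrable f g) (hK.integrable f' g)]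
        refine integral_congr_ae ?_
        filter_upwards [Lp.coeFn_add f f'] with x hx
        rw [hx, Pi.add_apply, hK.add_left])
      (fun s f g => by
        rw [smul_eq_mul, ← integral_const_mul]
        refine integral_congr_ae ?_
        filter_upwards [Lp.coeFn_smul s f] with x hx
        rw [hx, Pi.smul_apply, hK.smul_left])
      (fun f g g' => by
        rw [← integral_add (hK.integrable f g) (hK.integrable f g')]
        refine integral_congr_ae ?_
        filter_upwards [Lp.coeFn_add g g'] with x hx
        rw [hx, Pi.add_apply, hK.add_right])
      (fun s f g => by
        rw [smul_eq_mul, ← integral_const_mul]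
        refine integral_congr_ae ?_
        filter_upwards [Lp.coeFn_smul s g] with x hx
        rw [hx, Pi.smul_apply, hK.smul_right])).mkContinuous₂ (max hK.bound.choose 0)
      (fun f g => by
        have hC := hK.bound.choose_spec
        set C := hK.bound.choose
        rw [LinearMap.mk₂_apply]
        calc ‖∫ x, K x (f x) (g x)‖ ≤ ∫ x, ‖K x (f x) (g x)‖ := norm_integral_le_integral_norm _
          -- The kernel bound comes without a sign for `C`; a nonnegative constant is needed for the
          -- Cauchy–Schwarz step that follows.
          _ ≤ ∫ x, max C 0 * (‖f x‖ * ‖g x‖) := by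
            refine integral_mono (hK.integrable f g).norm
              ((integrable_norm_mul_norm f g).const_mul _) fun x => ?_
            refine (hC x _ _).trans ?_
            gcongr
            exact le_max_left _ _
          _ ≤ max C 0 * (‖f‖ * ‖g‖) := by
            rw [integral_const_mul]
            gcongr
            exact integral_norm_mul_norm_le f g
          _ = max C 0 * ‖f‖ * ‖g‖ := by ring)

theorem kernelForm_apply {K : Rn n → E → F → ℝ} (hK : IsKernel K)
    (f : Lp E 2 (volume : Measure (Rn n))) (g : Lp F 2 (volume : Measure (Rn n))) :
    kernelForm K hK f g = ∫ x, K x (f x) (g x) := rfl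

end KernelForm

/-! ### Forms with continuous compactly supported weights -/

section WeightedForm

variable {n : ℕ} {E : Type*} [NormedAddCommGroup E] [InnerProductSpace ℝ E]

/-- A continuous compactly supported function on `ℝⁿ`. -/
structure IsCc {E : Type*} [NormedAddCommGroup E] (m : Rn n → E) : Prop where
  continuous : Continuous m
  hasCompactSupport : HasCompactSupport m

theorem IsCc.exists_bound {E : Type*} [NormedAddCommGroup E] {m : Rn n → E} (hm : IsCc m) :
    ∃ C, ∀ x, ‖m x‖ ≤ C :=
  hm.2.exists_bound_of_continuous hm.1

theorem isKernel_weight {m : Rn n → ℝ} (hm : IsCc m) :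
    IsKernel fun x (e f : E) => m x * inner ℝ e f where
  add_left x e e' f := by rw [inner_add_left, mul_add]
  smul_left x s e f := by rw [real_inner_smul_left]; ring
  add_right x e f f' := by rw [inner_add_right, mul_add]
  smul_right x s e f := by rw [real_inner_smul_right]; ring
  bound := by
    obtain ⟨C, hC⟩ := hm.exists_bound
    refine ⟨C, fun x e f => ?_⟩
    rw [abs_mul]
    gcongr
    · exact (abs_nonneg _).trans (hC x)
    · exact hC x
    · exact abs_real_inner_le_norm e f
  measurable f g hf hg := hm.1.aestronglyMeasurable.mul (hf.inner hg)

theorem isKernel_vector {V : Rn n → Rn n} (hV : IsCc V) :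
    IsKernel fun x (e : ℝ) (f : Rn n) => e * inner ℝ (V x) f where
  add_left x e e' f := by ring
  smul_left x s e f := by rw [smul_eq_mul]; ring
  add_right x e f f' := by rw [inner_add_right, mul_add]
  smul_right x s e f := by rw [real_inner_smul_right]; ring
  bound := by
    obtain ⟨C, hC⟩ := hV.exists_bound
    refine ⟨C, fun x e f => ?_⟩
    rw [abs_mul]
    calc |e| * |inner ℝ (V x) f| ≤ |e| * (‖V x‖ * ‖f‖) := by
          gcongr; exact abs_real_inner_le_norm _ f
      _ ≤ |e| * (C * ‖f‖) := by gcongr; exact hC x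
      _ = _ := by rw [Real.norm_eq_abs]; ring
  measurable f g hf hg := hf.mul (hV.1.aestronglyMeasurable.inner hg)

open Classical in
/-- The form `∫ m ⟪f, g⟫` with a continuous compactly supported weight `m`. -/
def wForm (m : Rn n → ℝ) :
    Lp E 2 (volume : Measure (Rn n)) →L[ℝ] Lp E 2 (volume : Measure (Rn n)) →L[ℝ] ℝ :=
  -- With the default `0` this is a bounded form for every `m`, so the continuity lemmas below need
  -- no hypothesis on the weight.
  if hm : IsCc m then kernelForm _ (isKernel_weight hm) else 0

open Classical in
/-- The form `∫ f ⟪V, g⟫` with a continuous compactly supported vector field `V`. -/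
def vForm (V : Rn n → Rn n) : L2 n →L[ℝ] L2Vec n →L[ℝ] ℝ :=
  if hV : IsCc V then kernelForm _ (isKernel_vector hV) else 0

theorem integrable_wForm {m : Rn n → ℝ} (hm : IsCc m)
    (f g : Lp E 2 (volume : Measure (Rn n))) :
    Integrable (fun x => m x * inner ℝ (f x) (g x)) :=
  (isKernel_weight hm).integrable f g

theorem wForm_apply {m : Rn n → ℝ} (hm : IsCc m)
    (f g : Lp E 2 (volume : Measure (Rn n))) :
    wForm m f g = ∫ x, m x * inner ℝ (f x) (g x) := by
  rw [wForm, dif_pos hm, kernelForm_apply]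

theorem integrable_wForm_real {m : Rn n → ℝ} (hm : IsCc m) (f g : L2 n) :
    Integrable (fun x => m x * (f x * g x)) := by
  refine (integrable_wForm hm f g).congr (Eventually.of_forall fun x => ?_)
  simp [mul_comm]

theorem wForm_apply_real {m : Rn n → ℝ} (hm : IsCc m) (f g : L2 n) :
    wForm m f g = ∫ x, m x * (f x * g x) := by
  rw [wForm_apply hm]
  refine integral_congr_ae (Eventually.of_forall fun x => ?_)
  simp [mul_comm]

theorem wForm_comm {m : Rn n → ℝ} (hm : IsCc m)
    (f g : Lp E 2 (volume : Measure (Rn n))) : wForm m f g = wForm m g f := by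
  simp only [wForm_apply hm, real_inner_comm]

theorem integrable_vForm {V : Rn n → Rn n} (hV : IsCc V)
    (f : L2 n) (g : L2Vec n) : Integrable (fun x => f x * inner ℝ (V x) (g x)) :=
  (isKernel_vector hV).integrable f g

theorem vForm_apply {V : Rn n → Rn n} (hV : IsCc V)
    (f : L2 n) (g : L2Vec n) : vForm V f g = ∫ x, f x * inner ℝ (V x) (g x) := by
  rw [vForm, dif_pos hV, kernelForm_apply]

theorem IsCc.memLp {E : Type*} [NormedAddCommGroup E] {m : Rn n → E} (hm : IsCc m) :
    MemLp m 2 (volume : Measure (Rn n)) :=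
  hm.1.memLp_of_hasCompactSupport hm.2

theorem IsCc.mul_left {m b : Rn n → ℝ} (hm : IsCc m) (hb : Continuous b) :
    IsCc fun x => b x * m x :=
  ⟨hb.mul hm.1, hm.2.mul_left⟩

theorem IsCc.smul_left {b : Rn n → ℝ} {V : Rn n → Rn n} (hV : IsCc V) (hb : Continuous b) :
    IsCc fun x => b x • V x :=
  ⟨hb.smul hV.1, hV.2.mono fun x hx h => hx (by
    change b x • V x = 0
    rw [h, smul_zero])⟩

end WeightedForm

/-! ### Translation and mollification in `L²` -/

section Mollify

open scoped Convolution Gradient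
open ContinuousLinearMap

variable {n : ℕ} {E : Type*} [NormedAddCommGroup E] [InnerProductSpace ℝ E] [CompleteSpace E]

/-- Translation by `z` on `L²`. -/
def translate (z : Rn n) (f : Lp E 2 (volume : Measure (Rn n))) :
    Lp E 2 (volume : Measure (Rn n)) :=
  Lp.compMeasurePreserving (fun x => x - z) (measurePreserving_sub_right volume z) f

omit [InnerProductSpace ℝ E] [CompleteSpace E] in
theorem coeFn_translate (z : Rn n) (f : Lp E 2 (volume : Measure (Rn n))) :
    translate z f =ᵐ[volume] fun x => f (x - z) :=
  Lp.coeFn_compMeasurePreserving f (measurePreserving_sub_right volume z)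

omit [InnerProductSpace ℝ E] [CompleteSpace E] in
theorem continuous_translate (f : Lp E 2 (volume : Measure (Rn n))) :
    Continuous fun z => translate z f := by
  let G : C(Rn n, C(Rn n, Rn n)) :=
    (ContinuousMap.mk (fun p : Rn n × Rn n => p.2 - p.1) (by fun_prop)).curry
  exact (continuous_const (y := f)).compMeasurePreservingLp G.continuous
    (fun z => measurePreserving_sub_right volume z) (by norm_num)

omit [InnerProductSpace ℝ E] [CompleteSpace E] in
theorem translate_zero (f : Lp E 2 (volume : Measure (Rn n))) : translate 0 f = f := by
  refine Lp.ext ?_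
  filter_upwards [coeFn_translate 0 f] with x hx
  rw [hx, sub_zero]

omit [InnerProductSpace ℝ E] [CompleteSpace E] in
theorem norm_translate (z : Rn n) (f : Lp E 2 (volume : Measure (Rn n))) :
    ‖translate z f‖ = ‖f‖ :=
  Lp.norm_compMeasurePreserving f (measurePreserving_sub_right volume z)

omit [InnerProductSpace ℝ E] [CompleteSpace E] in
theorem locallyIntegrable_coeFn (f : Lp E 2 (volume : Measure (Rn n))) :
    LocallyIntegrable (f : Rn n → E) volume :=
  (Lp.memLp f).locallyIntegrable (by norm_num)

/-- Fubini. Joint integrability follows from Cauchy–Schwarz in `x` at fixed `z`: translations are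
isometries, so what remains is a multiple of the integrable function `‖η z‖`. -/
theorem integral_inner_mollify {η : Rn n → ℝ} (hη : IsCc η)
    (Φ f : Lp E 2 (volume : Measure (Rn n))) :
    ∫ x, inner ℝ (Φ x) ((η ⋆[lsmul ℝ ℝ, volume] f) x)
      = ∫ z, η z * inner ℝ Φ (translate z f) := by
  have hconv : ConvolutionExists η f (lsmul ℝ ℝ) volume :=
    hη.2.convolutionExists_left _ hη.1 (locallyIntegrable_coeFn f)
  have h1 : ∀ x, inner ℝ (Φ x) ((η ⋆[lsmul ℝ ℝ, volume] f) x)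
      = ∫ z, η z * inner ℝ (Φ x) (f (x - z)) := fun x => by
    have h2 : Integrable (fun z => η z • f (x - z)) volume := hconv x
    rw [convolution_def]
    have h3 := integral_inner (𝕜 := ℝ) h2 (Φ x)
    simp only [lsmul_apply]
    rw [← h3]
    simp only [real_inner_smul_right]
  simp_rw [h1]
  have hmeas : AEStronglyMeasurable
      (fun p : Rn n × Rn n => η p.2 * inner ℝ (Φ p.1) (f (p.1 - p.2)))
      ((volume : Measure (Rn n)).prod volume) := by
    refine hη.1.aestronglyMeasurable.comp_snd.mul
      (AEStronglyMeasurable.inner (𝕜 := ℝ) (Lp.memLp Φ).1.comp_fst ?_)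
    exact (Lp.memLp f).1.comp_quasiMeasurePreserving
      (quasiMeasurePreserving_sub_of_right_invariant volume volume)
  have hsec : ∀ z, (fun x => η z * inner ℝ (Φ x) (f (x - z)))
      =ᵐ[volume] fun x => η z * inner ℝ (Φ x) (translate z f x) := fun z => by
    filter_upwards [coeFn_translate z f] with x hx
    rw [hx]
  rw [integral_integral_swap]
  · refine integral_congr_ae (Eventually.of_forall fun z => ?_)
    dsimp only
    rw [integral_congr_ae (hsec z), integral_const_mul, L2.inner_def]
  · change Integrable
      (fun p : Rn n × Rn n => η p.2 * inner ℝ (Φ p.1) (f (p.1 - p.2))) _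
    rw [integrable_prod_iff' hmeas]
    constructor
    · refine Eventually.of_forall fun z => ?_
      exact ((L2.integrable_inner Φ (translate z f)).const_mul (η z)).congr (hsec z).symm
    · have hint : Integrable (fun z => ‖η z‖ * (‖Φ‖ * ‖f‖)) volume :=
        (hη.1.integrable_of_hasCompactSupport hη.2).norm.mul_const _
      refine hint.mono' hmeas.norm.prod_swap.integral_prod_right' ?_
      refine Eventually.of_forall fun z => ?_
      rw [Real.norm_of_nonneg (integral_nonneg fun x => norm_nonneg _)]
      have h4 : ∫ x, ‖η z * inner ℝ (Φ x) (f (x - z))‖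
          = ∫ x, ‖η z‖ * ‖(inner ℝ (Φ x) (translate z f x) : ℝ)‖ := by
        refine integral_congr_ae ?_
        filter_upwards [hsec z] with x hx
        rw [hx, norm_mul]
      change ∫ x, ‖η z * inner ℝ (Φ x) (f (x - z))‖ ≤ _
      rw [h4, integral_const_mul]
      gcongr
      calc ∫ x, ‖(inner ℝ (Φ x) (translate z f x) : ℝ)‖
          ≤ ∫ x, ‖Φ x‖ * ‖translate z f x‖ :=
            integral_mono (L2.integrable_inner Φ (translate z f)).norm
              (integrable_norm_mul_norm _ _) fun x => norm_inner_le_norm _ _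
        _ ≤ ‖Φ‖ * ‖translate z f‖ := integral_norm_mul_norm_le _ _
        _ = ‖Φ‖ * ‖f‖ := by rw [norm_translate]

/-- The derivative of the convolution falls on `η`, and for fixed `x` the function `y ↦ η (x - y)`
is a test function; the definition of the weak gradient then moves the derivative onto `f`. -/
theorem gradient_mollify {η : Rn n → ℝ} (hη : ContDiff ℝ ∞ η) (hc : HasCompactSupport η)
    {f : L2 n} {g : L2Vec n} (hfg : IsWeakGradient f g) (x : Rn n) :
    ∇ (η ⋆[lsmul ℝ ℝ, volume] f) x = (η ⋆[lsmul ℝ ℝ, volume] g) x := by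
  have hd : HasFDerivAt (η ⋆[lsmul ℝ ℝ, volume] f)
      ((f ⋆[(lsmul ℝ ℝ).flip.precompR (Rn n), volume] fderiv ℝ η) x) x := by
    rw [← convolution_flip]
    exact hc.hasFDerivAt_convolution_right _ (locallyIntegrable_coeFn f) (hη.of_le (by simp)) x
  refine ext_inner_right ℝ fun v => ?_
  rw [inner_gradient_left, hd.fderiv, convolution_precompR_apply _ (locallyIntegrable_coeFn f)
    (hc.fderiv ℝ) (hη.continuous_fderiv (by simp)), convolution_def]
  have hg : Integrable (fun z => η z • g (x - z)) volume :=
    hc.convolutionExists_left (lsmul ℝ ℝ) hη.continuous (locallyIntegrable_coeFn g) x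
  rw [convolution_def]
  simp only [lsmul_apply, flip_apply]
  rw [real_inner_comm, ← integral_inner hg]
  simp only [real_inner_smul_right]
  have h2 := integral_sub_left_eq_self (fun z => η z * inner ℝ v (g (x - z))) volume x
  simp only [sub_sub_cancel] at h2
  simp only [smul_eq_mul]
  rw [← h2]
  have hψ : ContDiff ℝ ∞ fun y => η (x - y) := hη.comp (contDiff_const.sub contDiff_id)
  have hψc : HasCompactSupport fun y => η (x - y) :=
    hc.comp_homeomorph (Homeomorph.subLeft x)
  have h3 := hfg _ hψ hψc v
  have h4 : ∀ y, fderiv ℝ (fun y => η (x - y)) y v = - fderiv ℝ η (x - y) v := fun y => by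
    have h5 : HasFDerivAt (fun y => η (x - y))
        ((fderiv ℝ η (x - y)).comp (-ContinuousLinearMap.id ℝ (Rn n))) y :=
      HasFDerivAt.comp y ((hη.differentiable (by simp)) (x - y)).hasFDerivAt
        ((hasFDerivAt_id y).const_sub x)
    rw [h5.fderiv]
    simp
  simp only [h4, mul_neg, integral_neg, neg_inj] at h3
  calc _ = ∫ y, f y * fderiv ℝ η (x - y) v := by simp only [mul_comm]
    _ = _ := h3
    _ = _ := by simp only [mul_comm, real_inner_comm]

end Mollify

/-! ### Density of test functions, in dual form -/

section Density

open scoped Convolution Gradient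
open ContinuousLinearMap

variable {n : ℕ}

theorem isCc_gradient {φ : Rn n → ℝ} (hφ : ContDiff ℝ 1 φ) (hc : HasCompactSupport φ) :
    IsCc (∇ φ) := by
  refine ⟨?_, ?_⟩
  · exact (InnerProductSpace.toDual ℝ (Rn n)).symm.continuous.comp
      (hφ.continuous_fderiv (by simp))
  · exact (hc.fderiv ℝ).comp_left (map_zero (InnerProductSpace.toDual ℝ (Rn n)).symm)

/-- A continuous compactly supported function as an element of `L²`. -/
def IsCc.toLp {E : Type*} [NormedAddCommGroup E] {m : Rn n → E} (hm : IsCc m) :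
    Lp E 2 (volume : Measure (Rn n)) :=
  hm.memLp.toLp m

theorem IsCc.coeFn_toLp {E : Type*} [NormedAddCommGroup E] {m : Rn n → E} (hm : IsCc m) :
    hm.toLp =ᵐ[volume] m :=
  hm.memLp.coeFn_toLp

theorem isCc_of_contDiff {φ : Rn n → ℝ} (hφ : ContDiff ℝ 1 φ) (hc : HasCompactSupport φ) :
    IsCc φ := ⟨hφ.continuous, hc⟩

/-- The function `z ↦ l (translate z f, translate z g)` is continuous, and its integral against a
test function `η` is `l` applied to `η ⋆ f` and its gradient, which vanishes by hypothesis. A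
continuous function orthogonal to all test functions is zero; the claim is its value at `z = 0`.
Compact support of `f` is what makes `η ⋆ f` a test function. -/
theorem eq_zero_of_test {l : L2 n × L2Vec n →L[ℝ] ℝ}
    (hl : ∀ φ : Rn n → ℝ, ∀ (hφ : ContDiff ℝ ∞ φ) (hc : HasCompactSupport φ),
      l ((isCc_of_contDiff (hφ.of_le (by simp)) hc).toLp,
        (isCc_gradient (hφ.of_le (by simp)) hc).toLp) = 0)
    {f : L2 n} {g : L2Vec n} (hfg : IsWeakGradient f g) {r : ℝ}
    (hr : ∀ᵐ x, r < ‖x‖ → f x = 0) : l (f, g) = 0 := by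
  set Φ : L2 n := (InnerProductSpace.toDual ℝ (L2 n)).symm (l.comp (.inl ℝ _ _)) with hΦ
  set F : L2Vec n := (InnerProductSpace.toDual ℝ (L2Vec n)).symm (l.comp (.inr ℝ _ _)) with hF
  have hlr : ∀ p q, l (p, q) = inner ℝ Φ p + inner ℝ F q := fun p q => by
    rw [hΦ, hF, InnerProductSpace.toDual_symm_apply, InnerProductSpace.toDual_symm_apply]
    simp only [ContinuousLinearMap.comp_apply, ContinuousLinearMap.inl_apply,
      ContinuousLinearMap.inr_apply]
    rw [← map_add, Prod.mk_add_mk, add_zero, zero_add]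
  have hcont : Continuous fun z => l (translate z f, translate z g) :=
    l.continuous.comp ((continuous_translate f).prodMk (continuous_translate g))
  have hzero : ∀ η : Rn n → ℝ, ContDiff ℝ ∞ η → HasCompactSupport η →
      ∫ z, η z * l (translate z f, translate z g) = 0 := fun η hη hc => by
    have hcc : IsCc η := ⟨hη.continuous, hc⟩
    set φ : Rn n → ℝ := η ⋆[lsmul ℝ ℝ, volume] f with hφdef
    have hφ : ContDiff ℝ ∞ φ := hc.contDiff_convolution_left _ hη (locallyIntegrable_coeFn f)
    have hφc : HasCompactSupport φ := by
      -- The representative of `f` vanishes outside the ball only almost everywhere, so it is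
      -- truncated to get a genuinely compact support.
      have h1 : φ = η ⋆[lsmul ℝ ℝ, volume] ((Metric.closedBall 0 r).indicator f) := by
        refine convolution_congr _ (EventuallyEq.refl _ _) ?_
        filter_upwards [hr] with x hx
        by_cases h : x ∈ Metric.closedBall (0 : Rn n) r
        · rw [indicator_of_mem h]
        · rw [indicator_of_notMem h, hx (by simpa using h)]
      rw [h1]
      refine hc.convolution _ ?_
      exact HasCompactSupport.intro (isCompact_closedBall (0 : Rn n) r)
        fun x hx => indicator_of_notMem hx _
    have h0 := hl φ hφ hφc
    rw [hlr, L2.inner_def, L2.inner_def] at h0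
    have e1 : ∫ x, inner ℝ (Φ x) ((isCc_of_contDiff (hφ.of_le (by simp)) hφc).toLp x)
        = ∫ z, η z * inner ℝ Φ (translate z f) := by
      rw [← integral_inner_mollify hcc]
      refine integral_congr_ae ?_
      filter_upwards [(isCc_of_contDiff (hφ.of_le (by simp)) hφc).coeFn_toLp] with x hx
      rw [hx]
    have e2 : ∫ x, inner ℝ (F x) ((isCc_gradient (hφ.of_le (by simp)) hφc).toLp x)
        = ∫ z, η z * inner ℝ F (translate z g) := by
      rw [← integral_inner_mollify hcc]
      refine integral_congr_ae ?_
      filter_upwards [(isCc_gradient (hφ.of_le (by simp)) hφc).coeFn_toLp] with x hx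
      rw [hx, hφdef, gradient_mollify hη hc hfg]
    rw [e1, e2, ← integral_add] at h0
    · rw [← h0]
      refine integral_congr_ae (Eventually.of_forall fun z => ?_)
      dsimp only
      rw [hlr, mul_add]
    · exact ((hη.continuous.mul (continuous_const.inner (continuous_translate f)))
        |>.integrable_of_hasCompactSupport hc.mul_right)
    · exact ((hη.continuous.mul (continuous_const.inner (continuous_translate g)))
        |>.integrable_of_hasCompactSupport hc.mul_right)
  have h0 := ae_eq_zero_of_integral_contDiff_smul_eq_zero
    (μ := (volume : Measure (Rn n))) hcont.locallyIntegrable hzero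
  have h1 : (fun z => l (translate z f, translate z g)) = fun _ => 0 :=
    (hcont.ae_eq_iff_eq volume continuous_const).1 h0
  have h2 := congrFun h1 0
  simpa only [translate_zero] using h2

end Density

/-! ### Weak gradients: `C¹` test functions and products -/

section ProductRule

open scoped Gradient

variable {n : ℕ}

theorem inner_gradient_eq {φ : Rn n → ℝ} (x v : Rn n) :
    (inner ℝ (∇ φ x) v : ℝ) = fderiv ℝ φ x v :=
  inner_gradient_left

theorem isWeakGradient_of_contDiff {φ : Rn n → ℝ} (hφ : ContDiff ℝ 1 φ)
    (hc : HasCompactSupport φ) :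
    IsWeakGradient (isCc_of_contDiff hφ hc).toLp (isCc_gradient hφ hc).toLp := by
  intro ψ hψ hψc v
  have hφd : Continuous fun x => fderiv ℝ φ x v :=
    (hφ.continuous_fderiv (by simp)).clm_apply continuous_const
  have hψd : Continuous fun x => fderiv ℝ ψ x v :=
    (hψ.continuous_fderiv (by simp)).clm_apply continuous_const
  have h := integral_mul_fderiv_eq_neg_fderiv_mul_of_integrable (μ := (volume : Measure (Rn n)))
    (f := φ) (g := ψ) (v := v)
    ((hφd.mul hψ.continuous).integrable_of_hasCompactSupport hψc.mul_left)
    ((hφ.continuous.mul hψd).integrable_of_hasCompactSupport hc.mul_right)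
    ((hφ.continuous.mul hψ.continuous).integrable_of_hasCompactSupport hψc.mul_left)
    (fun x _ => hφ.differentiable (by simp) x) (fun x _ => hψ.differentiable (by simp) x)
  calc _ = ∫ x, φ x * fderiv ℝ ψ x v := by
        refine integral_congr_ae ?_
        filter_upwards [(isCc_of_contDiff hφ hc).coeFn_toLp] with x hx
        rw [hx]
    _ = _ := h
    _ = _ := by
        congr 1
        refine integral_congr_ae ?_
        filter_upwards [(isCc_gradient hφ hc).coeFn_toLp] with x hx
        rw [hx, inner_gradient_eq]

/-- The profile `q`, hence the weights built from it, is only `C¹`, so smooth test functions do not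
suffice. The difference of the two sides is a continuous functional of `(φ, ∇φ)` in `L²` that
vanishes for smooth `φ`; since `∇φ` is the weak gradient of the compactly supported `φ`,
`eq_zero_of_test` applies to this pair. -/
theorem IsWeakGradient.integral_mul_fderiv {f : L2 n} {g : L2Vec n} (hfg : IsWeakGradient f g)
    {φ : Rn n → ℝ} (hφ : ContDiff ℝ 1 φ) (hc : HasCompactSupport φ) (v : Rn n) :
    ∫ x, f x * fderiv ℝ φ x v = -∫ x, inner ℝ (g x) v * φ x := by
  set F : L2Vec n := (ContinuousLinearMap.toSpanSingleton ℝ v).compLp f with hF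
  set Φ : L2 n := (innerSL ℝ v).compLp g with hΦ
  have hFx : ∀ᵐ x, F x = f x • v := by
    filter_upwards [ContinuousLinearMap.coeFn_compLp (ContinuousLinearMap.toSpanSingleton ℝ v) f]
      with x hx
    rw [hF, hx, ContinuousLinearMap.toSpanSingleton_apply]
  have hΦx : ∀ᵐ x, Φ x = inner ℝ (g x) v := by
    filter_upwards [ContinuousLinearMap.coeFn_compLp (innerSL ℝ v) g] with x hx
    rw [hΦ, hx, innerSL_apply_apply, real_inner_comm]
  set l : L2 n × L2Vec n →L[ℝ] ℝ :=
    (innerSL ℝ F).comp (ContinuousLinearMap.snd ℝ _ _)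
      + (innerSL ℝ Φ).comp (ContinuousLinearMap.fst ℝ _ _) with hl
  have hlφ : ∀ ψ : Rn n → ℝ, ∀ (hψ : ContDiff ℝ 1 ψ) (hψc : HasCompactSupport ψ),
      l ((isCc_of_contDiff hψ hψc).toLp, (isCc_gradient hψ hψc).toLp)
        = (∫ x, f x * fderiv ℝ ψ x v) + ∫ x, inner ℝ (g x) v * ψ x := by
    intro ψ hψ hψc
    have e1 : (inner ℝ F (isCc_gradient hψ hψc).toLp : ℝ) = ∫ x, f x * fderiv ℝ ψ x v := by
      rw [L2.inner_def]
      refine integral_congr_ae ?_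
      filter_upwards [hFx, (isCc_gradient hψ hψc).coeFn_toLp] with x h1 h2
      rw [h1, h2, real_inner_smul_left, real_inner_comm, inner_gradient_eq]
    have e2 : (inner ℝ Φ (isCc_of_contDiff hψ hψc).toLp : ℝ) = ∫ x, inner ℝ (g x) v * ψ x := by
      rw [L2.inner_def]
      refine integral_congr_ae ?_
      filter_upwards [hΦx, (isCc_of_contDiff hψ hψc).coeFn_toLp] with x h1 h2
      rw [h1, h2]
      simp [mul_comm]
    rw [← e1, ← e2]
    rfl
  have hsupp : ∃ r : ℝ, ∀ᵐ x, r < ‖x‖ → (isCc_of_contDiff hφ hc).toLp x = 0 := by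
    obtain ⟨r, hr⟩ := hc.isCompact.isBounded.subset_closedBall (0 : Rn n)
    refine ⟨r, ?_⟩
    filter_upwards [(isCc_of_contDiff hφ hc).coeFn_toLp] with x hx hxr
    rw [hx]
    by_contra h
    have := hr (subset_tsupport _ h)
    rw [mem_closedBall_zero_iff] at this
    linarith
  obtain ⟨r, hr⟩ := hsupp
  have h0 := eq_zero_of_test (l := l) (fun ψ hψ hψc => by
    rw [hlφ ψ (hψ.of_le (by simp)) hψc, hfg ψ hψ hψc v, neg_add_cancel])
    (isWeakGradient_of_contDiff hφ hc) hr
  rw [hlφ φ hφ hc] at h0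
  linarith

section

variable {E : Type*} [NormedAddCommGroup E] [NormedSpace ℝ E]

theorem IsCc.memLp_smul {m : Rn n → ℝ} (hm : IsCc m)
    (f : Lp E 2 (volume : Measure (Rn n))) :
    MemLp (fun x => m x • f x) 2 (volume : Measure (Rn n)) := by
  obtain ⟨C, hC⟩ := hm.exists_bound
  refine (Lp.memLp f).of_le_mul (c := C) (hm.1.aestronglyMeasurable.smul (Lp.memLp f).1)
    (Eventually.of_forall fun x => ?_)
  rw [norm_smul]
  gcongr
  exact hC x

theorem IsCc.memLp_smul_vector {V : Rn n → Rn n} (hV : IsCc V) (f : L2 n) :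
    MemLp (fun x => f x • V x) 2 (volume : Measure (Rn n)) := by
  obtain ⟨C, hC⟩ := hV.exists_bound
  refine (Lp.memLp f).of_le_mul (c := C) ((Lp.memLp f).1.smul hV.1.aestronglyMeasurable)
    (Eventually.of_forall fun x => ?_)
  rw [norm_smul, mul_comm]
  gcongr
  exact hC x

/-- The product of a weight with an `L²` function. -/
def IsCc.smulLp {m : Rn n → ℝ} (hm : IsCc m) (f : Lp E 2 (volume : Measure (Rn n))) :
    Lp E 2 (volume : Measure (Rn n)) := (hm.memLp_smul f).toLp _

theorem IsCc.coeFn_smulLp {m : Rn n → ℝ} (hm : IsCc m)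
    (f : Lp E 2 (volume : Measure (Rn n))) :
    hm.smulLp f =ᵐ[volume] fun x => m x • f x := (hm.memLp_smul f).coeFn_toLp

end

/-- The weak gradient `m ∇f + f ∇m` of a product. -/
def productGradient {m : Rn n → ℝ} (hm : ContDiff ℝ 1 m) (hc : HasCompactSupport m) (f : L2 n)
    (g : L2Vec n) : L2Vec n :=
  (isCc_of_contDiff hm hc).smulLp g + ((isCc_gradient hm hc).memLp_smul_vector f).toLp _

theorem coeFn_productGradient {m : Rn n → ℝ} (hm : ContDiff ℝ 1 m) (hc : HasCompactSupport m)
    (f : L2 n) (g : L2Vec n) :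
    ∀ᵐ x, productGradient hm hc f g x = m x • g x + f x • ∇ m x := by
  filter_upwards [Lp.coeFn_add ((isCc_of_contDiff hm hc).smulLp g)
    (((isCc_gradient hm hc).memLp_smul_vector f).toLp _),
    (isCc_of_contDiff hm hc).coeFn_smulLp g,
    ((isCc_gradient hm hc).memLp_smul_vector f).coeFn_toLp] with x h1 h2 h3
  rw [productGradient, h1, Pi.add_apply, h2, h3]

/-- Leibniz' rule for `m φ`, which is a `C¹` test function for `f`. -/
theorem IsWeakGradient.mul {f : L2 n} {g : L2Vec n} (hfg : IsWeakGradient f g)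
    {m : Rn n → ℝ} (hm : ContDiff ℝ 1 m) (hc : HasCompactSupport m) :
    IsWeakGradient ((isCc_of_contDiff hm hc).smulLp f) (productGradient hm hc f g) := by
  intro φ hφ hφc v
  have hφ1 : ContDiff ℝ 1 φ := hφ.of_le (by simp)
  have h := hfg.integral_mul_fderiv (hm.mul hφ1) (hc.mul_right) v
  have hd : ∀ x, fderiv ℝ (fun y => m y * φ y) x v
      = m x * fderiv ℝ φ x v + φ x * fderiv ℝ m x v := fun x => by
    rw [fderiv_fun_mul (hm.differentiable (by simp) x) (hφ1.differentiable (by simp) x)]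
    simp
  have hφd : Continuous fun x => fderiv ℝ φ x v :=
    (hφ1.continuous_fderiv (by simp)).clm_apply continuous_const
  have hmd : Continuous fun x => fderiv ℝ m x v :=
    (hm.continuous_fderiv (by simp)).clm_apply continuous_const
  have i1 : Integrable fun x => f x * (m x * fderiv ℝ φ x v) :=
    integrable_mul_test f (hm.continuous.mul hφd) hc.mul_right
  have i2 : Integrable fun x => f x * (φ x * fderiv ℝ m x v) :=
    integrable_mul_test f (hφ.continuous.mul hmd) hφc.mul_right
  have i3 : Integrable fun x => inner ℝ (g x) v * (m x * φ x) :=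
    integrable_inner_mul_test g v (hm.continuous.mul hφ.continuous) hc.mul_right
  have e1 : ∫ x, f x * fderiv ℝ (fun y => m y * φ y) x v
      = (∫ x, f x * (m x * fderiv ℝ φ x v)) + ∫ x, f x * (φ x * fderiv ℝ m x v) := by
    rw [← integral_add i1 i2]
    exact integral_congr_ae (Eventually.of_forall fun x => by dsimp only; rw [hd]; ring)
  have e2 : ∫ x, (isCc_of_contDiff hm hc).smulLp f x * fderiv ℝ φ x v
      = ∫ x, f x * (m x * fderiv ℝ φ x v) := by
    refine integral_congr_ae ?_
    filter_upwards [(isCc_of_contDiff hm hc).coeFn_smulLp f] with x hx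
    rw [hx, smul_eq_mul]
    ring
  have e3 : ∫ x, inner ℝ (productGradient hm hc f g x) v * φ x
      = (∫ x, inner ℝ (g x) v * (m x * φ x)) + ∫ x, f x * (φ x * fderiv ℝ m x v) := by
    rw [← integral_add i3 i2]
    refine integral_congr_ae ?_
    filter_upwards [coeFn_productGradient hm hc f g] with x hx
    rw [hx, inner_add_left, real_inner_smul_left, real_inner_smul_left, inner_gradient_eq]
    ring
  rw [e2, e3]
  change ∫ x, f x * fderiv ℝ (fun y => m y * φ y) x v
    = -∫ x, inner ℝ (g x) v * (m x * φ x) at h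
  rw [e1] at h
  linarith

end ProductRule

/-! ### Testing the equation with products `m w`, `w ∈ H¹` -/

section TestExtension

open scoped Gradient

variable {n : ℕ}

theorem exists_cutoff (r : ℝ) : ∃ χ : Rn n → ℝ, ContDiff ℝ ∞ χ ∧ HasCompactSupport χ ∧
    (∀ x, 0 ≤ χ x) ∧ (∀ x, χ x ≤ 1) ∧ (∀ x, ‖x‖ ≤ r → χ x = 1) ∧
    ∀ x, ‖x‖ ≤ r → ∇ χ x = 0 := by
  -- The inner radius exceeds `r` strictly, so that `χ` is constant near every point of the closed
  -- ball and its gradient vanishes there; `|r|` allows negative `r`.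
  let B : ContDiffBump (0 : Rn n) := ⟨|r| + 1, |r| + 2, by positivity, by linarith⟩
  have h1 : ∀ x : Rn n, ‖x‖ ≤ r → x ∈ Metric.ball (0 : Rn n) (|r| + 1) := fun x hx => by
    rw [mem_ball_zero_iff]
    linarith [le_abs_self r]
  refine ⟨B, B.contDiff, B.hasCompactSupport, fun x => B.nonneg, fun x => B.le_one,
    fun x hx => B.one_of_mem_closedBall (Metric.ball_subset_closedBall (h1 x hx)),
    fun x hx => ?_⟩
  have h2 : (B : Rn n → ℝ) =ᶠ[𝓝 x] fun _ => 1 := by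
    filter_upwards [Metric.isOpen_ball.mem_nhds (h1 x hx)] with y hy
    exact B.one_of_mem_closedBall (Metric.ball_subset_closedBall hy)
  rw [gradient, h2.fderiv_eq]
  simp

theorem exists_norm_le_of_hasCompactSupport {m : Rn n → ℝ} (hc : HasCompactSupport m) :
    ∃ r : ℝ, ∀ x, r < ‖x‖ → m x = 0 := by
  obtain ⟨r, hr⟩ := hc.isCompact.isBounded.subset_closedBall (0 : Rn n)
  refine ⟨r, fun x hx => ?_⟩
  by_contra h
  have := hr (subset_tsupport _ h)
  rw [mem_closedBall_zero_iff] at this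
  linarith

set_option maxHeartbeats 1000000 in
-- The coefficients may be unbounded, so the equation is first localised by a cutoff `χ` equal to
-- one on the support of `m`: testing with `χ φ` gives a bounded functional on `L² × L²` that
-- vanishes on all `(φ, ∇φ)`. By `eq_zero_of_test` it vanishes on `m w` and its weak gradient `m ∇w
-- + w ∇m`. The cutoff then disappears, because `χ m = m`, `χ ∇m = ∇m` and `m ∇χ = 0`.
theorem weak_equation_extend {a b c : Rn n → ℝ} (ha : Continuous a) (hb : Continuous b)
    (hc : Continuous c) {X Y Z : L2 n} {G : L2Vec n}
    (h : ∀ φ : Rn n → ℝ, ContDiff ℝ ∞ φ → HasCompactSupport φ →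
      (∫ x, c x * X x * φ x) + (∫ x, a x * Y x * φ x) + (∫ x, Z x * φ x)
        + ∫ x, b x * fderiv ℝ φ x (G x) = 0)
    {m : Rn n → ℝ} (hm : ContDiff ℝ 1 m) (hmc : HasCompactSupport m) (w : H1 n) :
    wForm (fun x => c x * m x) X (H1.toL2 w) + wForm (fun x => a x * m x) Y (H1.toL2 w)
      + wForm m Z (H1.toL2 w) + wForm (fun x => b x * m x) G (H1.grad w)
      + vForm (fun x => b x • ∇ m x) (H1.toL2 w) G = 0 := by
  obtain ⟨r, hr⟩ := exists_norm_le_of_hasCompactSupport hmc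
  obtain ⟨χ, hχ, hχc, -, -, hχ1, hχ2⟩ := exists_cutoff (n := n) r
  have hχ' : ContDiff ℝ 1 χ := hχ.of_le (by simp)
  have iχ : IsCc χ := ⟨hχ.continuous, hχc⟩
  have im : IsCc m := ⟨hm.continuous, hmc⟩
  have iV : IsCc fun x => b x • ∇ χ x := (isCc_gradient hχ' hχc).smul_left hb
  have iVm : IsCc fun x => b x • ∇ m x := (isCc_gradient hm hmc).smul_left hb
  set l1 : L2 n →L[ℝ] ℝ := wForm (fun x => c x * χ x) X + wForm (fun x => a x * χ x) Y
    + wForm χ Z + (vForm fun x => b x • ∇ χ x).flip G with hl1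
  set l2 : L2Vec n →L[ℝ] ℝ := wForm (fun x => b x * χ x) G with hl2
  set l : L2 n × L2Vec n →L[ℝ] ℝ := l1.comp (ContinuousLinearMap.fst ℝ _ _)
    + l2.comp (ContinuousLinearMap.snd ℝ _ _) with hl
  have hlpq : ∀ p q, l (p, q) = wForm (fun x => c x * χ x) X p + wForm (fun x => a x * χ x) Y p
    + wForm χ Z p + vForm (fun x => b x • ∇ χ x) p G + wForm (fun x => b x * χ x) G q :=
    fun p q => rfl
  have htest : ∀ φ : Rn n → ℝ, ∀ (hφ : ContDiff ℝ ∞ φ) (hφc : HasCompactSupport φ),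
      l ((isCc_of_contDiff (hφ.of_le (by simp)) hφc).toLp,
        (isCc_gradient (hφ.of_le (by simp)) hφc).toLp) = 0 := by
    intro φ hφ hφc
    have hφ1 : ContDiff ℝ 1 φ := hφ.of_le (by simp)
    have iφ := isCc_of_contDiff hφ1 hφc
    have igφ := isCc_gradient hφ1 hφc
    have hd : ∀ x v, fderiv ℝ (fun y => χ y * φ y) x v
        = χ x * fderiv ℝ φ x v + φ x * fderiv ℝ χ x v := fun x v => by
      rw [fderiv_fun_mul (hχ'.differentiable (by simp) x) (hφ1.differentiable (by simp) x)]
      simp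
    have h0 := h (fun y => χ y * φ y) (hχ.mul hφ) hχc.mul_right
    have hw : ∀ (d : Rn n → ℝ), Continuous d → ∀ S : L2 n,
        wForm (fun x => d x * χ x) S iφ.toLp = ∫ x, d x * S x * (χ x * φ x) := by
      intro d hd S
      rw [wForm_apply_real (iχ.mul_left hd)]
      refine integral_congr_ae ?_
      filter_upwards [iφ.coeFn_toLp] with x hx
      rw [hx]
      ring
    have hwZ : wForm χ Z iφ.toLp = ∫ x, Z x * (χ x * φ x) := by
      rw [wForm_apply_real iχ]
      refine integral_congr_ae ?_
      filter_upwards [iφ.coeFn_toLp] with x hx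
      rw [hx]
      ring
    have hv : vForm (fun x => b x • ∇ χ x) iφ.toLp G + wForm (fun x => b x * χ x) G igφ.toLp
        = ∫ x, b x * fderiv ℝ (fun y => χ y * φ y) x (G x) := by
      rw [vForm_apply iV, wForm_apply (iχ.mul_left hb), ← integral_add (integrable_vForm iV _ _)
        (integrable_wForm (iχ.mul_left hb) _ _)]
      refine integral_congr_ae ?_
      filter_upwards [iφ.coeFn_toLp, igφ.coeFn_toLp] with x h1 h2
      rw [h1, h2, hd, real_inner_smul_left, real_inner_comm (∇ φ x), inner_gradient_eq,
        inner_gradient_eq]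
      ring
    rw [hlpq, hw c hc, hw a ha, hwZ, add_assoc, hv]
    exact h0
  have him : IsWeakGradient (im.smulLp (H1.toL2 w))
      (productGradient hm hmc (H1.toL2 w) (H1.grad w)) :=
    IsWeakGradient.mul (f := H1.toL2 w) (g := H1.grad w) w.2 hm hmc
  have hsupp : ∀ᵐ x, r < ‖x‖ → im.smulLp (H1.toL2 w) x = 0 := by
    filter_upwards [im.coeFn_smulLp (H1.toL2 w)] with x hx hxr
    rw [hx, hr x hxr, zero_smul]
  have h0 := eq_zero_of_test htest him hsupp
  have hχm : ∀ x, χ x * m x = m x := fun x => by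
    by_cases hx : ‖x‖ ≤ r
    · rw [hχ1 x hx, one_mul]
    · rw [hr x (not_le.1 hx), mul_zero]
  have hgm : ∀ x, r < ‖x‖ → ∇ m x = 0 := fun x hx => by
    have h2 : m =ᶠ[𝓝 x] fun _ => 0 := by
      filter_upwards [(isOpen_lt continuous_const continuous_norm).mem_nhds hx] with y hy
      exact hr y hy
    rw [gradient, h2.fderiv_eq]
    simp
  have hχgm : ∀ x, χ x • ∇ m x = ∇ m x := fun x => by
    by_cases hx : ‖x‖ ≤ r
    · rw [hχ1 x hx, one_smul]
    · rw [hgm x (not_le.1 hx), smul_zero]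
  have hgχm : ∀ x, m x • ∇ χ x = 0 := fun x => by
    by_cases hx : ‖x‖ ≤ r
    · rw [hχ2 x hx, smul_zero]
    · rw [hr x (not_le.1 hx), zero_smul]
  have hw : ∀ (d : Rn n → ℝ), Continuous d → ∀ S : L2 n,
      wForm (fun x => d x * χ x) S (im.smulLp (H1.toL2 w))
        = wForm (fun x => d x * m x) S (H1.toL2 w) := by
    intro d hd S
    rw [wForm_apply_real (iχ.mul_left hd), wForm_apply_real (im.mul_left hd)]
    refine integral_congr_ae ?_
    filter_upwards [im.coeFn_smulLp (H1.toL2 w)] with x hx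
    rw [hx, smul_eq_mul]
    linear_combination d x * S x * (H1.toL2 w) x * hχm x
  have hwZ : wForm χ Z (im.smulLp (H1.toL2 w)) = wForm m Z (H1.toL2 w) := by
    rw [wForm_apply_real iχ, wForm_apply_real im]
    refine integral_congr_ae ?_
    filter_upwards [im.coeFn_smulLp (H1.toL2 w)] with x hx
    rw [hx, smul_eq_mul]
    linear_combination Z x * (H1.toL2 w) x * hχm x
  have hv0 : vForm (fun x => b x • ∇ χ x) (im.smulLp (H1.toL2 w)) G = 0 := by
    rw [vForm_apply iV]
    refine integral_eq_zero_of_ae ?_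
    filter_upwards [im.coeFn_smulLp (H1.toL2 w)] with x hx
    have h3 : m x * inner ℝ (∇ χ x) (G x) = 0 := by
      rw [← real_inner_smul_left, hgχm, inner_zero_left]
    rw [hx, smul_eq_mul, real_inner_smul_left, Pi.zero_apply]
    linear_combination (H1.toL2 w) x * b x * h3
  have hv : wForm (fun x => b x * χ x) G (productGradient hm hmc (H1.toL2 w) (H1.grad w))
      = wForm (fun x => b x * m x) G (H1.grad w)
        + vForm (fun x => b x • ∇ m x) (H1.toL2 w) G := by
    rw [vForm_apply iVm, wForm_apply (iχ.mul_left hb), wForm_apply (im.mul_left hb),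
      ← integral_add (integrable_wForm (im.mul_left hb) _ _) (integrable_vForm iVm _ _)]
    refine integral_congr_ae ?_
    filter_upwards [coeFn_productGradient hm hmc (H1.toL2 w) (H1.grad w)] with x hx
    have h3 : χ x * inner ℝ (∇ m x) (G x) = inner ℝ (∇ m x) (G x) := by
      rw [← real_inner_smul_left, hχgm]
    rw [hx, inner_add_right, real_inner_smul_right, real_inner_smul_right, real_inner_smul_left,
      real_inner_comm (∇ m x)]
    linear_combination b x * inner ℝ (G x) (H1.grad w x) * hχm x + b x * (H1.toL2 w) x * h3
  rw [hlpq, hw c hc, hw a ha, hwZ, hv0, hv] at h0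
  linarith

end TestExtension

/-! ### Steklov averages in time -/

section Average

variable {E : Type*} [NormedAddCommGroup E] [NormedSpace ℝ E]

/-- The average of `f` over `[t, t + ε]`, with the value `f t` for `ε = 0`. -/
def timeAverage (f : ℝ → E) (ε t : ℝ) : E := ∫ θ in (0 : ℝ)..1, f (t + ε * θ)

/-- Integration over the fixed interval `[0, 1]` removes the singularity at `ε = 0`, so letting `ε →
0` is later a matter of continuity. -/
theorem continuous_timeAverage {f : ℝ → E} (hf : Continuous f) :
    Continuous fun q : ℝ × ℝ => timeAverage f q.1 q.2 :=
  intervalIntegral.continuous_parametric_intervalIntegral_of_continuous'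
    (f := fun (q : ℝ × ℝ) θ => f (q.2 + q.1 * θ)) (by fun_prop) 0 1

theorem timeAverage_eq (f : ℝ → E) {ε : ℝ} (hε : ε ≠ 0) (t : ℝ) :
    timeAverage f ε t = ε⁻¹ • ∫ s in t..(t + ε), f s := by
  rw [timeAverage, intervalIntegral.integral_comp_add_mul f hε t]
  simp

theorem timeAverage_zero [CompleteSpace E] (f : ℝ → E) (t : ℝ) : timeAverage f 0 t = f t := by
  simp [timeAverage]

/-- Averaging gains a derivative: the average is a difference of two values of a primitive of `f`.
-/
theorem hasDerivAt_timeAverage [CompleteSpace E] {f : ℝ → E} (hf : Continuous f) {ε : ℝ}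
    (hε : ε ≠ 0) (t : ℝ) : HasDerivAt (timeAverage f ε) (ε⁻¹ • (f (t + ε) - f t)) t := by
  have h1 : timeAverage f ε = fun r => ε⁻¹ • ((∫ s in (0 : ℝ)..(r + ε), f s)
      - ∫ s in (0 : ℝ)..r, f s) := by
    funext r
    rw [timeAverage_eq f hε, intervalIntegral.integral_interval_sub_left
      (hf.intervalIntegrable _ _) (hf.intervalIntegrable _ _)]
  rw [h1]
  have h2 : ∀ r, HasDerivAt (fun y => ∫ s in (0 : ℝ)..y, f s) (f r) r := fun r =>
    intervalIntegral.integral_hasDerivAt_right (hf.intervalIntegrable _ _)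
      (hf.stronglyMeasurableAtFilter _ _) hf.continuousAt
  exact (((h2 (t + ε)).comp_add_const t ε).sub (h2 t)).const_smul ε⁻¹

end Average

/-! ### Calculus of bounded bilinear forms along curves -/

section Bilinear

variable {E F : Type*} [NormedAddCommGroup E] [NormedSpace ℝ E] [NormedAddCommGroup F]
  [NormedSpace ℝ F]

theorem tendsto_bilinear (B : E →L[ℝ] F →L[ℝ] ℝ) {X : Type*} {l : Filter X} {f : X → E}
    {g : X → F} {e : E} {e' : F} (hf : Tendsto f l (𝓝 e)) (hg : Tendsto g l (𝓝 e')) :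
    Tendsto (fun y => B (f y) (g y)) l (𝓝 (B e e')) := by
  have h : Tendsto (fun y => B (f y)) l (𝓝 (B e)) := (B.continuous.tendsto e).comp hf
  have h' : Continuous fun q : (F →L[ℝ] ℝ) × F => q.1 q.2 := continuous_fst.clm_apply continuous_snd
  exact (h'.tendsto (B e, e')).comp (h.prodMk_nhds hg)

theorem continuous_bilinear (B : E →L[ℝ] F →L[ℝ] ℝ) {X : Type*} [TopologicalSpace X] {f : X → E}
    {g : X → F} (hf : Continuous f) (hg : Continuous g) : Continuous fun y => B (f y) (g y) :=
  (B.continuous.comp hf).clm_apply hg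

theorem hasDerivAt_bilinear (B : E →L[ℝ] F →L[ℝ] ℝ) {f : ℝ → E} {g : ℝ → F} {f' : E} {g' : F}
    {t : ℝ} (hf : HasDerivAt f f' t) (hg : HasDerivAt g g' t) :
    HasDerivAt (fun y => B (f y) (g y)) (B f' (g t) + B (f t) g') t :=
  (B.hasFDerivAt.comp_hasDerivAt t hf).clm_apply hg

end Bilinear

/-! ### Weak solutions and the equation integrated in time -/

section Evolution

open scoped Gradient

variable {n : ℕ}

/-- `u` is a finite energy weak solution with velocity `p` and `L²`-valued source `H`; all curves
are extended continuously to negative times. -/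
structure IsEnergySol (a b c : Rn n → ℝ) (u : ℝ → H1 n) (p H : ℝ → L2 n) : Prop where
  cont_u : Continuous u
  cont_p : Continuous p
  cont_H : Continuous H
  hasDerivAt : ∀ t : ℝ, 0 < t → HasDerivAt (fun s => H1.toL2 (u s)) (p t) t
  equation : ∀ φ : Rn n → ℝ, ContDiff ℝ ∞ φ → HasCompactSupport φ → ∀ t : ℝ, 0 < t →
    HasDerivAt (fun s => ∫ x, c x * p s x * φ x)
      ((∫ x, H t x * φ x) - (∫ x, b x * fderiv ℝ φ x (H1.grad (u t) x))
        - ∫ x, a x * p t x * φ x) t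

/-- The local energy `½ ∫ m (c p² + b |∇u|²)`. -/
def localEnergy (b c m : Rn n → ℝ) (p : L2 n) (g : L2Vec n) : ℝ :=
  (1 / 2) * wForm (fun x => c x * m x) p p + (1 / 2) * wForm (fun x => b x * m x) g g

theorem integral_mul_mul_eq_inner {d φ : Rn n → ℝ} (hi : IsCc fun x => d x * φ x) (S : L2 n) :
    ∫ x, d x * S x * φ x = inner ℝ hi.toLp S := by
  rw [L2.inner_def]
  refine integral_congr_ae ?_
  filter_upwards [hi.coeFn_toLp] with x hx
  rw [hx]
  simp only [RCLike.inner_apply, conj_trivial]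
  ring

theorem integral_mul_eq_inner {φ : Rn n → ℝ} (hi : IsCc φ) (S : L2 n) :
    ∫ x, S x * φ x = inner ℝ hi.toLp S := by
  rw [L2.inner_def]
  refine integral_congr_ae ?_
  filter_upwards [hi.coeFn_toLp] with x hx
  rw [hx]
  simp only [RCLike.inner_apply, conj_trivial]

theorem integral_mul_fderiv_eq_inner {b φ : Rn n → ℝ} (hi : IsCc fun x => b x • ∇ φ x)
    (G : L2Vec n) : ∫ x, b x * fderiv ℝ φ x (G x) = inner ℝ hi.toLp G := by
  rw [L2.inner_def]
  refine integral_congr_ae ?_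
  filter_upwards [hi.coeFn_toLp] with x hx
  rw [hx, real_inner_smul_left, inner_gradient_eq]

variable {a b c : Rn n → ℝ} {u : ℝ → H1 n} {p H : ℝ → L2 n}

theorem IsEnergySol.cont_grad (hu : IsEnergySol a b c u p H) :
    Continuous fun t => H1.grad (u t) := H1.grad.continuous.comp hu.cont_u

theorem IsEnergySol.cont_toL2 (hu : IsEnergySol a b c u p H) :
    Continuous fun t => H1.toL2 (u t) := H1.toL2.continuous.comp hu.cont_u

theorem IsEnergySol.toL2_sub (hu : IsEnergySol a b c u p H) {s t : ℝ} (hs : 0 ≤ s)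
    (hst : s ≤ t) : ∫ τ in s..t, p τ = H1.toL2 (u t) - H1.toL2 (u s) :=
  intervalIntegral.integral_eq_sub_of_hasDerivAt_of_le hst hu.cont_toL2.continuousOn
    (fun τ hτ => hu.hasDerivAt τ (hs.trans_lt hτ.1)) (hu.cont_p.intervalIntegrable _ _)

/-- For a fixed test function every term is a bounded functional of a continuous curve in `L²`.
After integration in time these functionals act on Bochner integrals, which puts the equation into
the form required by `weak_equation_extend`. -/
theorem IsEnergySol.integrated_equation (hu : IsEnergySol a b c u p H) (ha : Continuous a)
    (hb : Continuous b) (hc : Continuous c) {m : Rn n → ℝ} (hm : ContDiff ℝ 1 m)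
    (hmc : HasCompactSupport m) (w : H1 n) {s t : ℝ} (hs : 0 ≤ s) (hst : s ≤ t) :
    wForm (fun x => c x * m x) (p t - p s) (H1.toL2 w)
      + wForm (fun x => a x * m x) (∫ τ in s..t, p τ) (H1.toL2 w)
      + wForm m (-∫ τ in s..t, H τ) (H1.toL2 w)
      + wForm (fun x => b x * m x) (∫ τ in s..t, H1.grad (u τ)) (H1.grad w)
      + vForm (fun x => b x • ∇ m x) (H1.toL2 w) (∫ τ in s..t, H1.grad (u τ)) = 0 := by
  refine weak_equation_extend ha hb hc (fun φ hφ hφc => ?_) hm hmc w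
  have hφ1 : ContDiff ℝ 1 φ := hφ.of_le (by simp)
  have iφ := isCc_of_contDiff hφ1 hφc
  have igφ : IsCc fun x => b x • ∇ φ x := (isCc_gradient hφ1 hφc).smul_left hb
  have icφ := iφ.mul_left hc
  have iaφ := iφ.mul_left ha
  have heq := hu.equation φ hφ hφc
  simp only [integral_mul_mul_eq_inner icφ, integral_mul_mul_eq_inner iaφ,
    integral_mul_eq_inner iφ, integral_mul_fderiv_eq_inner igφ] at heq ⊢
  have cH : Continuous fun τ => (inner ℝ iφ.toLp (H τ) : ℝ) := continuous_const.inner hu.cont_H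
  have cg : Continuous fun τ => inner ℝ igφ.toLp (H1.grad (u τ)) :=
    continuous_const.inner hu.cont_grad
  have cp : Continuous fun τ => inner ℝ iaφ.toLp (p τ) := continuous_const.inner hu.cont_p
  have h1 := intervalIntegral.integral_eq_sub_of_hasDerivAt_of_le hst
    (f := fun τ => inner ℝ icφ.toLp (p τ))
    (continuous_const.inner hu.cont_p).continuousOn
    (fun τ hτ => heq τ (hs.trans_lt hτ.1)) (((cH.sub cg).sub cp).intervalIntegrable _ _)
  have cHg : Continuous fun τ =>
      (inner ℝ iφ.toLp (H τ) - inner ℝ igφ.toLp (H1.grad (u τ)) : ℝ) := cH.sub cg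
  rw [intervalIntegral.integral_sub (cHg.intervalIntegrable _ _)
    (cp.intervalIntegrable _ _), intervalIntegral.integral_sub (cH.intervalIntegrable _ _)
    (cg.intervalIntegrable _ _)] at h1
  have e1 := (innerSL ℝ iφ.toLp).intervalIntegral_comp_comm
    (hu.cont_H.intervalIntegrable (μ := volume) s t)
  have e2 := (innerSL ℝ igφ.toLp).intervalIntegral_comp_comm
    (hu.cont_grad.intervalIntegrable (μ := volume) s t)
  have e3 := (innerSL ℝ iaφ.toLp).intervalIntegral_comp_comm
    (hu.cont_p.intervalIntegrable (μ := volume) s t)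
  simp only [innerSL_apply_apply] at e1 e2 e3
  rw [e1, e2, e3] at h1
  rw [inner_sub_right, inner_neg_right]
  linarith

/-! ### The local energy identity -/

section EnergyIdentity

set_option maxHeartbeats 1000000 in
-- The velocity `p` has no gradient in `L²` and cannot be used as a test function, but its average
-- over `[t, t + ε]` is the difference quotient `ε⁻¹ (u (t + ε) - u t)`, which lies in `H¹`. Testing
-- the equation integrated over the same interval with this quotient gives the identity for the
-- averages without error term.
theorem IsEnergySol.hasDerivAt_localEnergy_average (hu : IsEnergySol a b c u p H)
    (ha : Continuous a) (hb : Continuous b) (hc : Continuous c) {m : Rn n → ℝ}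
    (hm : ContDiff ℝ 1 m) (hmc : HasCompactSupport m) {ε t : ℝ} (hε : 0 < ε) (ht : 0 ≤ t) :
    HasDerivAt (fun τ => localEnergy b c m (timeAverage p ε τ)
        (timeAverage (fun r => H1.grad (u r)) ε τ))
      (wForm m (timeAverage H ε t) (timeAverage p ε t)
        - wForm (fun x => a x * m x) (timeAverage p ε t) (timeAverage p ε t)
        - vForm (fun x => b x • ∇ m x) (timeAverage p ε t)
          (timeAverage (fun r => H1.grad (u r)) ε t)) t := by
  have im := isCc_of_contDiff hm hmc
  have icm := im.mul_left hc
  have ibm := im.mul_left hb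
  have dp := hasDerivAt_timeAverage hu.cont_p hε.ne' t
  have dg := hasDerivAt_timeAverage hu.cont_grad hε.ne' t
  have d1 := hasDerivAt_bilinear (wForm fun x => c x * m x) dp dp
  have d2 := hasDerivAt_bilinear (wForm fun x => b x * m x) dg dg
  have d3 := (d1.const_mul (1 / 2)).add (d2.const_mul (1 / 2))
  refine d3.congr_deriv ?_
  have hE := hu.integrated_equation ha hb hc hm hmc (ε⁻¹ • (u (t + ε) - u t)) ht
    (le_add_of_nonneg_right hε.le)
  have hw : H1.toL2 (ε⁻¹ • (u (t + ε) - u t)) = timeAverage p ε t := by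
    rw [timeAverage_eq p hε.ne', hu.toL2_sub ht (le_add_of_nonneg_right hε.le), map_smul, map_sub]
  have hgw : H1.grad (ε⁻¹ • (u (t + ε) - u t))
      = ε⁻¹ • (H1.grad (u (t + ε)) - H1.grad (u t)) := by
    rw [map_smul, map_sub]
  have hP : ∫ τ in t..(t + ε), p τ = ε • timeAverage p ε t := by
    rw [timeAverage_eq p hε.ne', smul_inv_smul₀ hε.ne']
  have hH : ∫ τ in t..(t + ε), H τ = ε • timeAverage H ε t := by
    rw [timeAverage_eq H hε.ne', smul_inv_smul₀ hε.ne']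
  have hG : ∫ τ in t..(t + ε), H1.grad (u τ)
      = ε • timeAverage (fun r => H1.grad (u r)) ε t := by
    rw [timeAverage_eq _ hε.ne', smul_inv_smul₀ hε.ne']
  rw [hw, hgw, hP, hH, hG] at hE
  have hdp : p (t + ε) - p t = ε • (ε⁻¹ • (p (t + ε) - p t)) := by
    rw [smul_inv_smul₀ hε.ne']
  rw [hdp] at hE
  rw [wForm_comm icm (ε⁻¹ • (p (t + ε) - p t)) (timeAverage p ε t),
    wForm_comm ibm (ε⁻¹ • (H1.grad (u (t + ε)) - H1.grad (u t)))]
  rw [wForm_comm icm] at hE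
  set A := timeAverage p ε t
  set G := timeAverage (fun r => H1.grad (u r)) ε t
  set B := ε⁻¹ • (p (t + ε) - p t)
  set D := ε⁻¹ • (H1.grad (u (t + ε)) - H1.grad (u t))
  simp only [map_smul, map_neg, _root_.smul_apply, _root_.neg_apply,
    smul_eq_mul] at hE
  refine mul_left_cancel₀ hε.ne' ?_
  linear_combination hE

theorem continuous_localEnergy {b c m : Rn n → ℝ} {X : Type*} [TopologicalSpace X]
    {P : X → L2 n} {G : X → L2Vec n} (hP : Continuous P) (hG : Continuous G) :
    Continuous fun y => localEnergy b c m (P y) (G y) := by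
  unfold localEnergy
  have h1 : Continuous fun y => wForm (fun x => c x * m x) (P y) (P y) :=
    continuous_bilinear _ hP hP
  have h2 : Continuous fun y => wForm (fun x => b x * m x) (G y) (G y) :=
    continuous_bilinear _ hG hG
  exact (continuous_const.mul h1).add (continuous_const.mul h2)

theorem continuous_energyFlux {a b m : Rn n → ℝ} {V : Rn n → Rn n} {X : Type*}
    [TopologicalSpace X] {P S : X → L2 n} {G : X → L2Vec n} (hP : Continuous P)
    (hS : Continuous S) (hG : Continuous G) :
    Continuous fun y => wForm m (S y) (P y) - wForm (fun x => a x * m x) (P y) (P y)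
      - vForm (fun x => b x • V x) (P y) (G y) := by
  have h1 : Continuous fun y => wForm m (S y) (P y) := continuous_bilinear _ hS hP
  have h2 : Continuous fun y => wForm (fun x => a x * m x) (P y) (P y) :=
    continuous_bilinear _ hP hP
  have h3 : Continuous fun y => vForm (fun x => b x • V x) (P y) (G y) :=
    continuous_bilinear _ hP hG
  exact (h1.sub h2).sub h3

/-- Both sides of the averaged identity, integrated in time, are continuous functions of `ε` on the
whole line; they agree for `ε > 0`, hence at `ε = 0`, where the averages are the original curves. -/
theorem IsEnergySol.localEnergy_sub (hu : IsEnergySol a b c u p H)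
    (ha : Continuous a) (hb : Continuous b) (hc : Continuous c) {m : Rn n → ℝ}
    (hm : ContDiff ℝ 1 m) (hmc : HasCompactSupport m) {s t : ℝ} (hs : 0 ≤ s) (hst : s ≤ t) :
    localEnergy b c m (p t) (H1.grad (u t)) - localEnergy b c m (p s) (H1.grad (u s))
      = ∫ τ in s..t, (wForm m (H τ) (p τ) - wForm (fun x => a x * m x) (p τ) (p τ)
        - vForm (fun x => b x • ∇ m x) (p τ) (H1.grad (u τ))) := by
  set g : ℝ → L2Vec n := fun r => H1.grad (u r) with hg
  have cg : Continuous g := hu.cont_grad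
  have cP := continuous_timeAverage hu.cont_p
  have cH := continuous_timeAverage hu.cont_H
  have cG := continuous_timeAverage cg
  have cE := continuous_localEnergy (b := b) (c := c) (m := m) cP cG
  have cF := continuous_energyFlux (a := a) (b := b) (m := m) (V := ∇ m) cP cH cG
  have cL : Continuous fun ε : ℝ => localEnergy b c m (timeAverage p ε t) (timeAverage g ε t)
      - localEnergy b c m (timeAverage p ε s) (timeAverage g ε s) :=
    (cE.comp (continuous_id.prodMk continuous_const)).sub
      (cE.comp (continuous_id.prodMk continuous_const))
  have cR : Continuous fun ε : ℝ => ∫ τ in s..t,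
      (wForm m (timeAverage H ε τ) (timeAverage p ε τ)
        - wForm (fun x => a x * m x) (timeAverage p ε τ) (timeAverage p ε τ)
        - vForm (fun x => b x • ∇ m x) (timeAverage p ε τ) (timeAverage g ε τ)) :=
    intervalIntegral.continuous_parametric_intervalIntegral_of_continuous' cF s t
  have hpos : ∀ ε ∈ Ioi (0 : ℝ), localEnergy b c m (timeAverage p ε t) (timeAverage g ε t)
      - localEnergy b c m (timeAverage p ε s) (timeAverage g ε s)
      = ∫ τ in s..t, (wForm m (timeAverage H ε τ) (timeAverage p ε τ)
        - wForm (fun x => a x * m x) (timeAverage p ε τ) (timeAverage p ε τ)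
        - vForm (fun x => b x • ∇ m x) (timeAverage p ε τ) (timeAverage g ε τ)) := by
    intro ε hε
    refine (intervalIntegral.integral_eq_sub_of_hasDerivAt_of_le hst
      (f := fun τ => localEnergy b c m (timeAverage p ε τ) (timeAverage g ε τ)) ?_
      (fun τ hτ => hu.hasDerivAt_localEnergy_average ha hb hc hm hmc hε (hs.trans hτ.1.le))
      ?_).symm
    · exact (cE.comp (continuous_const.prodMk continuous_id)).continuousOn
    · exact (cF.comp (continuous_const.prodMk continuous_id)).intervalIntegrable _ _
  have h0 : (0 : ℝ) ∈ closure (Ioi (0 : ℝ)) := by rw [closure_Ioi]; exact self_mem_Ici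
  have := (isClosed_eq cL cR).closure_subset_iff.2 hpos h0
  simpa only [mem_ofPred_eq, timeAverage_zero] using this

theorem IsEnergySol.hasDerivAt_localEnergy (hu : IsEnergySol a b c u p H)
    (ha : Continuous a) (hb : Continuous b) (hc : Continuous c) {m : Rn n → ℝ}
    (hm : ContDiff ℝ 1 m) (hmc : HasCompactSupport m) {t : ℝ} (ht : 0 < t) :
    HasDerivAt (fun τ => localEnergy b c m (p τ) (H1.grad (u τ)))
      (wForm m (H t) (p t) - wForm (fun x => a x * m x) (p t) (p t)
        - vForm (fun x => b x • ∇ m x) (p t) (H1.grad (u t))) t := by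
  have cF := continuous_energyFlux (a := a) (b := b) (m := m) (V := ∇ m) hu.cont_p hu.cont_H
    hu.cont_grad
  have h1 := (intervalIntegral.integral_hasDerivAt_right (cF.intervalIntegrable 0 t)
    (cF.stronglyMeasurableAtFilter _ _) cF.continuousAt).add_const
      (localEnergy b c m (p 0) (H1.grad (u 0)))
  refine h1.congr_of_eventuallyEq ?_
  filter_upwards [Ioi_mem_nhds ht] with τ hτ
  rw [← hu.localEnergy_sub ha hb hc hm hmc le_rfl (le_of_lt hτ)]
  ring

end EnergyIdentity

/-! ### The local virial identity -/

section Multiplier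

/-- `∫ m (c p u + ½ a u²)`. -/
def localVirial (a c m : Rn n → ℝ) (p f : L2 n) : ℝ :=
  wForm (fun x => c x * m x) p f + (1 / 2) * wForm (fun x => a x * m x) f f

theorem IsEnergySol.hasDerivAt_momentum (hu : IsEnergySol a b c u p H)
    (ha : Continuous a) (hb : Continuous b) (hc : Continuous c) {m : Rn n → ℝ}
    (hm : ContDiff ℝ 1 m) (hmc : HasCompactSupport m) (w : H1 n) {t : ℝ} (ht : 0 < t) :
    HasDerivAt (fun τ => wForm (fun x => c x * m x) (p τ) (H1.toL2 w))
      (wForm m (H t) (H1.toL2 w) - wForm (fun x => a x * m x) (p t) (H1.toL2 w)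
        - wForm (fun x => b x * m x) (H1.grad (u t)) (H1.grad w)
        - vForm (fun x => b x • ∇ m x) (H1.toL2 w) (H1.grad (u t))) t := by
  have h1 : ∀ {E : Type _} [NormedAddCommGroup E] [NormedSpace ℝ E] [CompleteSpace E]
      (l : E →L[ℝ] ℝ) (f : ℝ → E), Continuous f →
      HasDerivAt (fun τ => l (∫ r in (0 : ℝ)..τ, f r)) (l (f t)) t := by
    intro E _ _ _ l f hf
    exact l.hasFDerivAt.comp_hasDerivAt t (intervalIntegral.integral_hasDerivAt_right
      (hf.intervalIntegrable 0 t) (hf.stronglyMeasurableAtFilter _ _) hf.continuousAt)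
  have dH := h1 ((wForm m).flip (H1.toL2 w)) H hu.cont_H
  have dp := h1 ((wForm fun x => a x * m x).flip (H1.toL2 w)) p hu.cont_p
  have dg := h1 ((wForm fun x => b x * m x).flip (H1.grad w)) _ hu.cont_grad
  have dv := h1 ((vForm fun x => b x • ∇ m x) (H1.toL2 w)) _ hu.cont_grad
  have d := (((dH.sub dp).sub dg).sub dv).add_const
    (wForm (fun x => c x * m x) (p 0) (H1.toL2 w))
  refine d.congr_of_eventuallyEq ?_
  filter_upwards [Ioi_mem_nhds ht] with τ hτ
  have hE := hu.integrated_equation ha hb hc hm hmc w le_rfl (le_of_lt hτ)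
  simp only [map_sub, map_neg, _root_.sub_apply, _root_.neg_apply] at hE
  simp only [ContinuousLinearMap.flip_apply, Pi.sub_apply]
  linarith

set_option maxHeartbeats 1000000 in
-- No averaging is needed. Write `u τ = u t + (u τ - u t)`: the first summand is a fixed element of
-- `H¹`, covered by `hasDerivAt_momentum`, while the second vanishes at `τ = t`, so its product with
-- `p τ` is differentiable there although `p` is only continuous. The damping term cancels against
-- the derivative of `½ ∫ m a u²`.
theorem IsEnergySol.hasDerivAt_localVirial (hu : IsEnergySol a b c u p H)
    (ha : Continuous a) (hb : Continuous b) (hc : Continuous c) {m : Rn n → ℝ}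
    (hm : ContDiff ℝ 1 m) (hmc : HasCompactSupport m) {t : ℝ} (ht : 0 < t) :
    HasDerivAt (fun τ => localVirial a c m (p τ) (H1.toL2 (u τ)))
      (wForm (fun x => c x * m x) (p t) (p t)
        - wForm (fun x => b x * m x) (H1.grad (u t)) (H1.grad (u t))
        - vForm (fun x => b x • ∇ m x) (H1.toL2 (u t)) (H1.grad (u t))
        + wForm m (H t) (H1.toL2 (u t))) t := by
  have im := isCc_of_contDiff hm hmc
  have d1 := hu.hasDerivAt_momentum ha hb hc hm hmc (u t) ht
  have du := hu.hasDerivAt t ht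
  have d2 : HasDerivAt (fun τ => wForm (fun x => c x * m x) (p τ)
      (H1.toL2 (u τ) - H1.toL2 (u t))) (wForm (fun x => c x * m x) (p t) (p t)) t := by
    rw [hasDerivAt_iff_tendsto_slope] at du ⊢
    have h1 : Tendsto (fun τ => wForm (fun x => c x * m x) (p τ)
        (slope (fun s => H1.toL2 (u s)) t τ)) (𝓝[≠] t)
        (𝓝 (wForm (fun x => c x * m x) (p t) (p t))) :=
      tendsto_bilinear _ (hu.cont_p.continuousAt.tendsto.mono_left nhdsWithin_le_nhds) du
    refine h1.congr fun τ => ?_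
    simp only [slope_def_module, sub_self, map_zero, sub_zero, map_smul]
  have d3 := hasDerivAt_bilinear (wForm fun x => a x * m x) du du
  have d4 := (d1.add d2).add (d3.const_mul (1 / 2))
  refine (d4.congr_of_eventuallyEq (Eventually.of_forall fun τ => ?_)).congr_deriv ?_
  · simp only [localVirial, Pi.add_apply, map_sub]
    ring
  · rw [wForm_comm (im.mul_left ha) (H1.toL2 (u t)) (p t)]
    ring

end Multiplier

end Evolution

/-! ### The speed profile `q` -/

section Profile

variable {n : ℕ}

theorem exists_norm_eq_of_pos_dim (hn : 1 ≤ n) {r : ℝ} (hr : 0 ≤ r) : ∃ x : Rn n, ‖x‖ = r := by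
  refine ⟨EuclideanSpace.single ⟨0, hn⟩ r, ?_⟩
  simp [abs_of_nonneg hr]

variable {b c : Rn n → ℝ} {σ : ℝ} {q : ℝ → ℝ}

theorem IsSpeedProfile.differentiableAt (hq : IsSpeedProfile b c σ q) {r : ℝ} (hr : 0 < r) :
    HasDerivAt q (derivWithin q (Ici 0) r) r :=
  ((hq.contDiffOn.differentiableOn (by simp) r hr.le).hasDerivWithinAt).hasDerivAt
    (Ici_mem_nhds hr)

theorem IsSpeedProfile.strictMonoOn (hn : 1 ≤ n) (hq : IsSpeedProfile b c σ q) :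
    StrictMonoOn q (Ici 0) := by
  refine strictMonoOn_of_deriv_pos (convex_Ici 0) hq.contDiffOn.continuousOn fun r hr => ?_
  rw [interior_Ici] at hr
  -- The sign of `q'` is assumed only at values of the norm; in dimension at least one these are all
  -- radii.
  obtain ⟨x, hx⟩ := exists_norm_eq_of_pos_dim hn (le_of_lt hr)
  rw [(hq.differentiableAt hr).deriv, ← hx]
  exact hq.deriv_pos x

theorem IsSpeedProfile.nonneg (hq : IsSpeedProfile b c σ q) {r : ℝ} (hr : 0 ≤ r) : 0 ≤ q r := by
  obtain ⟨q₀, hq₀, h⟩ := hq.growth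
  exact le_trans (by positivity) (h r hr)

theorem IsSpeedProfile.tendsto_atTop (hq : IsSpeedProfile b c σ q) (hσ : σ < 2) :
    Tendsto q atTop atTop := by
  obtain ⟨q₀, hq₀, h⟩ := hq.growth
  refine tendsto_atTop_mono' _ ?_
    ((tendsto_rpow_atTop (by linarith : 0 < 1 - σ / 2)).const_mul_atTop hq₀)
  filter_upwards [eventually_ge_atTop 0] with r hr using h r hr

theorem IsSpeedProfile.continuous_comp_norm (hq : IsSpeedProfile b c σ q) :
    Continuous fun x : Rn n => q ‖x‖ :=
  hq.contDiffOn.continuousOn.comp_continuous continuous_norm fun x => norm_nonneg x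

end Profile

/-! ### Phase, cutoff and exponential weight -/

section Weight

open scoped Gradient

variable {n : ℕ} {b c : Rn n → ℝ} {σ : ℝ} {q : ℝ → ℝ}

/-- The bounded phase `ρ sin ((q(|x|) - q(R)) / ρ)`, a truncation of `q(|x|) - q(R)`. -/
def phase (q : ℝ → ℝ) (R ρ : ℝ) (x : Rn n) : ℝ := ρ * Real.sin ((q ‖x‖ - q R) / ρ)

theorem continuous_phase (hq : IsSpeedProfile b c σ q) (R ρ : ℝ) :
    Continuous (phase (n := n) q R ρ) := by
  have := hq.continuous_comp_norm
  exact continuous_const.mul (Real.continuous_sin.comp ((this.sub continuous_const).div_const ρ))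

/-- Outside `q(|x|) < q(R)` this is `sin y ≤ y`. Inside, `q ≥ 0` and `q(R) ≤ πρ` keep the argument
in `[-π, 0]`, where the sine is nonpositive. -/
theorem phase_le (hq : IsSpeedProfile b c σ q) {R ρ : ℝ} (hρ : 0 < ρ)
    (hR : q R ≤ Real.pi * ρ) {t : ℝ} (ht : 0 ≤ t) {x : Rn n} (hx : q ‖x‖ ≤ t + q R) :
    phase q R ρ x ≤ t := by
  unfold phase
  rcases le_total 0 (q ‖x‖ - q R) with h | h
  · calc ρ * Real.sin ((q ‖x‖ - q R) / ρ) ≤ ρ * ((q ‖x‖ - q R) / ρ) := by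
          gcongr
          exact Real.sin_le (by positivity)
      _ = q ‖x‖ - q R := by field_simp
      _ ≤ t := by linarith
  · refine le_trans (mul_nonpos_of_nonneg_of_nonpos hρ.le ?_) ht
    refine Real.sin_nonpos_of_nonpos_of_neg_pi_le (div_nonpos_of_nonpos_of_nonneg h hρ.le) ?_
    rw [le_div_iff₀ hρ]
    linarith [hq.nonneg (norm_nonneg x)]

/-- The eikonal inequality `b |∇ψ|² ≤ c`. It survives the truncation since the sine contributes only
a factor `cos` and the norm is 1-Lipschitz. -/
theorem hasFDerivAt_phase (hq : IsSpeedProfile b c σ q) {R ρ : ℝ} (hρ : 0 < ρ) {x : Rn n}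
    (hx : x ≠ 0) : ∃ L : Rn n →L[ℝ] ℝ, HasFDerivAt (phase q R ρ) L x ∧ ‖L‖ ≤ √(c x / b x) := by
  have h1 := (hq.differentiableAt (norm_pos_iff.2 hx))
  have h2 : HasDerivAt (fun r => ρ * Real.sin ((q r - q R) / ρ))
      (ρ * (Real.cos ((q ‖x‖ - q R) / ρ) * (derivWithin q (Ici 0) ‖x‖ / ρ))) ‖x‖ :=
    (((h1.sub_const (q R)).div_const ρ).sin).const_mul ρ
  have h3 : DifferentiableAt ℝ (fun y : Rn n => ‖y‖) x :=
    (contDiffAt_norm ℝ hx (n := 1)).differentiableAt (by simp)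
  refine ⟨_, h2.comp_hasFDerivAt x h3.hasFDerivAt, ?_⟩
  rw [norm_smul]
  have h4 : ‖fderiv ℝ (fun y : Rn n => ‖y‖) x‖ ≤ 1 := by
    simpa using norm_fderiv_le_of_lipschitz ℝ (lipschitzWith_one_norm (E := Rn n)) (x₀ := x)
  calc _ ≤ ‖ρ * (Real.cos ((q ‖x‖ - q R) / ρ) * (derivWithin q (Ici 0) ‖x‖ / ρ))‖ * 1 := by gcongr
    _ = |Real.cos ((q ‖x‖ - q R) / ρ)| * derivWithin q (Ici 0) ‖x‖ := by
        rw [mul_one, Real.norm_eq_abs, abs_mul, abs_mul, abs_div, abs_of_pos hρ,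
          abs_of_pos (hq.deriv_pos x)]
        field_simp
    _ ≤ 1 * derivWithin q (Ici 0) ‖x‖ := by
        gcongr
        · exact (hq.deriv_pos x).le
        · exact Real.abs_cos_le_one _
    _ ≤ _ := by rw [one_mul]; exact hq.deriv_le x

theorem contDiffAt_phase (hq : IsSpeedProfile b c σ q) {R ρ : ℝ} {x : Rn n}
    (hx : x ≠ 0) : ContDiffAt ℝ 1 (phase q R ρ) x := by
  have h1 : ContDiffAt ℝ 1 (fun y : Rn n => q ‖y‖) x :=
    (hq.contDiffOn.contDiffAt (Ici_mem_nhds (norm_pos_iff.2 hx))).comp x (contDiffAt_norm ℝ hx)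
  unfold phase
  exact contDiffAt_const.mul (((h1.sub contDiffAt_const).div_const ρ).sin)

/-- The exponential weight `χ e^{λ ψ}`. -/
def expWeight (χ : Rn n → ℝ) (ψ : Rn n → ℝ) (l : ℝ) (x : Rn n) : ℝ := χ x * Real.exp (l * ψ x)

/-- A cutoff function adapted to the phase: it vanishes near the origin, equals one on the annulus
`R ≤ |x| ≤ R₁`, and the phase is nonpositive where it is not locally constant. -/
structure IsPhaseCutoff (q : ℝ → ℝ) (R ρ R₁ : ℝ) (χ : Rn n → ℝ) : Prop where
  contDiff : ContDiff ℝ 1 χ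
  hasCompactSupport : HasCompactSupport χ
  nonneg : ∀ x, 0 ≤ χ x
  le_one : ∀ x, χ x ≤ 1
  eventually_zero : χ =ᶠ[𝓝 0] fun _ => 0
  eq_one : ∀ x, R ≤ ‖x‖ → ‖x‖ ≤ R₁ → χ x = 1
  phase_nonpos : ∀ x, ∇ χ x ≠ 0 → phase q R ρ x ≤ 0

/-- The cutoff rises inside `|x| ≤ R` and falls inside `R₁ ≤ |x| ≤ R₂`. On the first region the
argument of the sine is in `[-π, 0]`; since `πρ = q(R₁) - q(R)`, on the second it starts at `π`, and
`R₂` is taken close enough to `R₁` that it stays below `2π`. The phase is nonpositive on both.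
Vanishing near the origin avoids the singularity of `|x|`. -/
theorem exists_phaseCutoff (hn : 1 ≤ n) (hq : IsSpeedProfile b c σ q) {R R₁ ρ : ℝ} (hR : 0 < R)
    (hR₁ : R < R₁) (hρ : Real.pi * ρ = q R₁ - q R) (hqR : 2 * q R ≤ q R₁) :
    ∃ χ : Rn n → ℝ, IsPhaseCutoff q R ρ R₁ χ := by
  have hmono := hq.strictMonoOn hn
  have hlt : q R < q R₁ := hmono hR.le (hR.trans hR₁).le hR₁
  have hρ0 : 0 < ρ := by
    have : 0 < Real.pi * ρ := by linarith
    exact pos_of_mul_pos_right this Real.pi_pos.le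
  obtain ⟨R₂, hR₂, hqR₂⟩ : ∃ R₂, R₁ < R₂ ∧ q R₂ ≤ 2 * q R₁ - q R := by
    have hc : ContinuousAt q R₁ := (hq.differentiableAt (hR.trans hR₁)).continuousAt
    have h1 : ∀ᶠ r in 𝓝 R₁, q r < 2 * q R₁ - q R :=
      hc.eventually_lt continuousAt_const (by linarith)
    have h2 : ∀ᶠ r in 𝓝[>] R₁, q r < 2 * q R₁ - q R := h1.filter_mono nhdsWithin_le_nhds
    obtain ⟨r, hr1, hr2⟩ := (h2.and self_mem_nhdsWithin).exists
    exact ⟨r, hr2, hr1.le⟩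
  let B₁ : ContDiffBump (0 : Rn n) := ⟨R / 2, R, by positivity, by linarith⟩
  let B₂ : ContDiffBump (0 : Rn n) := ⟨R₁, R₂, hR.trans hR₁, hR₂⟩
  have hone : ∀ x : Rn n, R ≤ ‖x‖ → ‖x‖ ≤ R₁ → (1 - B₁ x) * B₂ x = 1 := fun x h1 h2 => by
    rw [B₁.zero_of_le_dist (by simpa using h1),
      B₂.one_of_mem_closedBall (by simpa [B₂] using h2)]
    norm_num
  refine ⟨fun x => (1 - B₁ x) * B₂ x, ?_, ?_, ?_, ?_, ?_, hone, ?_⟩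
  · exact (contDiff_const.sub B₁.contDiff).mul B₂.contDiff
  · exact B₂.hasCompactSupport.mul_left
  · exact fun x => mul_nonneg (by linarith [B₁.le_one (x := x)]) B₂.nonneg
  · intro x
    have h1 := B₁.nonneg (x := x)
    have h2 := B₁.le_one (x := x)
    have h3 := B₂.nonneg (x := x)
    have h4 := B₂.le_one (x := x)
    nlinarith
  · filter_upwards [Metric.closedBall_mem_nhds (0 : Rn n) (by positivity : 0 < R / 2)] with x hx
    rw [B₁.one_of_mem_closedBall hx, sub_self, zero_mul]
  · intro x hx
    rcases le_or_gt ‖x‖ R with h1 | h1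
    · refine phase_le hq hρ0 (by linarith) le_rfl ?_
      rw [zero_add]
      exact hmono.monotoneOn (norm_nonneg x) hR.le h1
    rcases lt_or_ge ‖x‖ R₁ with h2 | h2
    · exfalso
      apply hx
      have h3 : (fun y => (1 - B₁ y) * B₂ y) =ᶠ[𝓝 x] fun _ => 1 := by
        filter_upwards [(isOpen_lt continuous_const continuous_norm).mem_nhds h1,
          (isOpen_lt continuous_norm continuous_const).mem_nhds h2] with y hy1 hy2
        exact hone y (le_of_lt hy1) (le_of_lt hy2)
      rw [gradient, h3.fderiv_eq]
      simp
    rcases le_or_gt ‖x‖ R₂ with h3 | h3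
    · have h4 : q R₁ ≤ q ‖x‖ := hmono.monotoneOn (hR.trans hR₁).le (norm_nonneg x) h2
      have h5 : q ‖x‖ ≤ q R₂ :=
        hmono.monotoneOn (norm_nonneg x) ((hR.trans hR₁).trans hR₂).le h3
      unfold phase
      refine mul_nonpos_of_nonneg_of_nonpos hρ0.le ?_
      have h6 : Real.sin ((q ‖x‖ - q R) / ρ) = Real.sin ((q ‖x‖ - q R) / ρ - 2 * Real.pi) :=
        (Real.sin_sub_two_pi _).symm
      rw [h6]
      refine Real.sin_nonpos_of_nonpos_of_neg_pi_le ?_ ?_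
      · rw [sub_nonpos, div_le_iff₀ hρ0]
        linarith
      · rw [le_sub_iff_add_le, le_div_iff₀ hρ0]
        linarith
    · exfalso
      apply hx
      have h4 : (fun y => (1 - B₁ y) * B₂ y) =ᶠ[𝓝 x] fun _ => 0 := by
        filter_upwards [(isOpen_lt continuous_const continuous_norm).mem_nhds h3] with y hy
        rw [B₂.zero_of_le_dist (by simpa using le_of_lt hy), mul_zero]
      rw [gradient, h4.fderiv_eq]
      simp

variable {R ρ R₁ : ℝ} {χ : Rn n → ℝ}

theorem IsPhaseCutoff.contDiff_expWeight (hχ : IsPhaseCutoff q R ρ R₁ χ)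
    (hq : IsSpeedProfile b c σ q) (l : ℝ) : ContDiff ℝ 1 (expWeight χ (phase q R ρ) l) := by
  rw [contDiff_iff_contDiffAt]
  intro x
  by_cases hx : x = 0
  · have h1 : expWeight χ (phase q R ρ) l =ᶠ[𝓝 x] fun _ => 0 := by
      rw [hx]
      filter_upwards [hχ.eventually_zero] with y hy
      rw [expWeight, hy, zero_mul]
    exact contDiffAt_const.congr_of_eventuallyEq h1
  · exact hχ.contDiff.contDiffAt.mul (contDiffAt_const.mul (contDiffAt_phase hq hx)).exp

theorem IsPhaseCutoff.hasCompactSupport_expWeight (hχ : IsPhaseCutoff q R ρ R₁ χ) (l : ℝ) :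
    HasCompactSupport (expWeight χ (phase q R ρ) l) :=
  hχ.hasCompactSupport.mul_right

theorem IsPhaseCutoff.expWeight_nonneg (hχ : IsPhaseCutoff q R ρ R₁ χ) (l : ℝ) (x : Rn n) :
    0 ≤ expWeight χ (phase q R ρ) l x := mul_nonneg (hχ.nonneg x) (Real.exp_pos _).le

/-- Where `∇χ ≠ 0` the phase is nonpositive and the exponential is at most one, so the cutoff term
does not grow with `l`. -/
theorem IsPhaseCutoff.norm_gradient_expWeight_le (hχ : IsPhaseCutoff q R ρ R₁ χ)
    (hq : IsSpeedProfile b c σ q) (hρ : 0 < ρ) {l : ℝ} (hl : 0 ≤ l) (x : Rn n) :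
    ‖∇ (expWeight χ (phase q R ρ) l) x‖
      ≤ ‖∇ χ x‖ + l * expWeight χ (phase q R ρ) l x * √(c x / b x) := by
  have hnn : 0 ≤ l * expWeight χ (phase q R ρ) l x * √(c x / b x) := by
    have := hχ.expWeight_nonneg l x
    positivity
  by_cases hx : x = 0
  · have h1 : expWeight χ (phase q R ρ) l =ᶠ[𝓝 x] fun _ => 0 := by
      rw [hx]
      filter_upwards [hχ.eventually_zero] with y hy
      rw [expWeight, hy, zero_mul]
    rw [gradient, h1.fderiv_eq]
    simp only [fderiv_fun_const, Pi.zero_apply, map_zero, norm_zero]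
    positivity
  obtain ⟨L, hL, hLn⟩ := hasFDerivAt_phase hq (R := R) hρ hx
  have h1 : HasFDerivAt χ (fderiv ℝ χ x) x :=
    (hχ.contDiff.differentiable (by simp) x).hasFDerivAt
  have h2 := h1.mul ((hL.const_mul l).exp)
  have h3 : ∀ f : Rn n → ℝ, ‖∇ f x‖ = ‖fderiv ℝ f x‖ := fun f =>
    (InnerProductSpace.toDual ℝ (Rn n)).symm.norm_map _
  have h4 : fderiv ℝ (expWeight χ (phase q R ρ) l) x = _ := h2.fderiv
  rw [h3, h4]
  refine (norm_add_le _ _).trans ?_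
  rw [add_comm]
  refine add_le_add ?_ ?_
  · rw [norm_smul, Real.norm_of_nonneg (Real.exp_pos _).le, h3]
    by_cases hg : ∇ χ x = 0
    · have : ‖fderiv ℝ χ x‖ = 0 := by rw [← h3, hg, norm_zero]
      rw [this, mul_zero]
    · have : Real.exp (l * phase q R ρ x) ≤ 1 := by
        rw [Real.exp_le_one_iff]
        exact mul_nonpos_of_nonneg_of_nonpos hl (hχ.phase_nonpos x hg)
      exact mul_le_of_le_one_left (norm_nonneg _) this
  · rw [norm_smul, norm_smul, norm_smul, Real.norm_of_nonneg (hχ.nonneg x),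
      Real.norm_of_nonneg (Real.exp_pos _).le, Real.norm_of_nonneg hl]
    calc _ = l * expWeight χ (phase q R ρ) l x * ‖L‖ := by rw [expWeight]; ring
      _ ≤ _ := by
        have := hχ.expWeight_nonneg l x
        gcongr

end Weight

/-! ### Vanishing almost everywhere on a set -/

section Vanishing

variable {n : ℕ} {E : Type*} [NormedAddCommGroup E] [NormedSpace ℝ E]

/-- `f` vanishes almost everywhere on `S`. -/
def VanishesOn (S : Set (Rn n)) (f : Lp E 2 (volume : Measure (Rn n))) : Prop :=
  ∀ᵐ x, x ∈ S → f x = 0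

/-- Expressed as the kernel of a bounded operator, vanishing passes to Bochner integrals and to
derivatives of curves. -/
theorem vanishesOn_iff {S : Set (Rn n)} (hS : MeasurableSet S)
    (f : Lp E 2 (volume : Measure (Rn n))) :
    VanishesOn S f ↔ LpToLpRestrictCLM (Rn n) E ℝ volume 2 S f = 0 := by
  rw [VanishesOn, ← ae_restrict_iff' hS, Lp.eq_zero_iff_ae_eq_zero]
  have h := LpToLpRestrictCLM_coeFn (μ := (volume : Measure (Rn n))) (p := 2) ℝ S f
  constructor
  · intro h1
    filter_upwards [h, h1] with x h2 h3
    rw [h2, h3, Pi.zero_apply]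
  · intro h1
    filter_upwards [h, h1] with x h2 h3
    rw [← h2, h3, Pi.zero_apply]

omit [NormedSpace ℝ E] in
theorem VanishesOn.add {S : Set (Rn n)} {f g : Lp E 2 (volume : Measure (Rn n))}
    (hf : VanishesOn S f) (hg : VanishesOn S g) : VanishesOn S (f + g) := by
  filter_upwards [hf, hg, Lp.coeFn_add f g] with x h1 h2 h3 hx
  rw [h3, Pi.add_apply, h1 hx, h2 hx, add_zero]

theorem VanishesOn.intervalIntegral [CompleteSpace E] {S : Set (Rn n)} (hS : MeasurableSet S)
    {f : ℝ → Lp E 2 (volume : Measure (Rn n))} (hf : Continuous f) {s t : ℝ} (hst : s ≤ t)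
    (h : ∀ τ ∈ Icc s t, VanishesOn S (f τ)) : VanishesOn S (∫ τ in s..t, f τ) := by
  rw [vanishesOn_iff hS, ← ContinuousLinearMap.intervalIntegral_comp_comm _
    (hf.intervalIntegrable s t)]
  rw [intervalIntegral.integral_congr (g := fun _ => 0), intervalIntegral.integral_zero]
  intro τ hτ
  rw [uIcc_of_le hst] at hτ
  exact (vanishesOn_iff hS _).1 (h τ hτ)

theorem IsWeakGradient.vanishesOn {f : L2 n} {g : L2Vec n} (hfg : IsWeakGradient f g)
    {S : Set (Rn n)} (hS : IsOpen S) (hf : VanishesOn S f) : VanishesOn S g := by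
  refine hS.ae_eq_zero_of_integral_contDiff_smul_eq_zero
    ((locallyIntegrable_coeFn g).locallyIntegrableOn S) fun φ hφ hφc hφS => ?_
  have hi : Integrable fun x => φ x • g x :=
    (locallyIntegrable_coeFn g).integrable_smul_left_of_hasCompactSupport hφ.continuous hφc
  refine integral_eq_zero_of_forall_integral_inner_eq_zero (𝕜 := ℝ) _ hi fun v => ?_
  have h1 := hfg φ hφ hφc v
  have h2 : ∫ x, f x * fderiv ℝ φ x v = 0 := by
    refine integral_eq_zero_of_ae ?_
    filter_upwards [hf] with x hx
    by_cases hxS : x ∈ S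
    · rw [hx hxS, zero_mul, Pi.zero_apply]
    · have : fderiv ℝ φ x = 0 := by
        by_contra h
        exact hxS (hφS (support_fderiv_subset ℝ h))
      rw [this]
      simp
  rw [h2] at h1
  have h3 : ∫ x, inner ℝ v (φ x • g x) = ∫ x, inner ℝ (g x) v * φ x := by
    refine integral_congr_ae (Eventually.of_forall fun x => ?_)
    dsimp only
    rw [real_inner_smul_right, real_inner_comm, mul_comm]
  rw [h3]
  linarith

end Vanishing

/-! ### Finite speed of propagation -/

section EnergyEstimate

open scoped Gradient

variable {n : ℕ} {a b c : Rn n → ℝ}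

theorem localEnergy_eq (hb : Continuous b) (hc : Continuous c) {m : Rn n → ℝ} (hm : IsCc m)
    (p : L2 n) (g : L2Vec n) :
    localEnergy b c m p g = ∫ x, m x * ((1 / 2) * (c x * p x ^ 2 + b x * ‖g x‖ ^ 2)) := by
  rw [localEnergy, wForm_apply_real (hm.mul_left hc), wForm_apply (hm.mul_left hb),
    ← integral_const_mul, ← integral_const_mul, ← integral_add
      ((integrable_wForm_real (hm.mul_left hc) p p).const_mul _)
      ((integrable_wForm (hm.mul_left hb) g g).const_mul _)]
  refine integral_congr_ae (Eventually.of_forall fun x => ?_)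
  dsimp only
  rw [real_inner_self_eq_norm_sq]
  ring

theorem integrable_localEnergy (hb : Continuous b) (hc : Continuous c) {m : Rn n → ℝ}
    (hm : IsCc m) (p : L2 n) (g : L2Vec n) :
    Integrable fun x => m x * ((1 / 2) * (c x * p x ^ 2 + b x * ‖g x‖ ^ 2)) := by
  refine (((integrable_wForm_real (hm.mul_left hc) p p).const_mul (1 / 2)).add
      ((integrable_wForm (hm.mul_left hb) g g).const_mul (1 / 2))).congr
        (Eventually.of_forall fun x => ?_)
  dsimp only [Pi.add_apply]
  rw [real_inner_self_eq_norm_sq]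
  ring

theorem sqrt_mul_le_energyDensity {β γ p g : ℝ} (hβ : 0 < β) (hγ : 0 < γ) : β * √(γ / β) * (p * g) ≤ (1 / 2) * (γ * p ^ 2 + β * g ^ 2) := by
  have h1 : √(γ / β) ^ 2 * β = γ := by
    rw [Real.sq_sqrt (by positivity)]
    field_simp
  have h2 : γ * p ^ 2 = β * (√(γ / β) * p) ^ 2 := by linear_combination (-p ^ 2) * h1
  rw [h2]
  nlinarith [sq_nonneg (√(γ / β) * p - g)]

variable {σ : ℝ} {q : ℝ → ℝ} {R ρ R₁ : ℝ} {χ : Rn n → ℝ}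

/-- The gradient of the exponential contributes at most `l` times the energy density, by the eikonal
inequality and `√(b c) |p| |g| ≤ ½ (c p² + b |g|²)`. The constant is exactly `l`, which the factor
`exp (-l t)` will cancel; the rest does not depend on `l`. -/
theorem IsPhaseCutoff.neg_flux_le (hχ : IsPhaseCutoff q R ρ R₁ χ)
    (hq : IsSpeedProfile b c σ q) (hρ : 0 < ρ) (hb : Continuous b) (hc : Continuous c)
    (hb0 : ∀ x, 0 < b x) (hc0 : ∀ x, 0 < c x) {C : ℝ} (hC : ∀ x, ‖b x • ∇ χ x‖ ≤ C)
    {l : ℝ} (hl : 0 ≤ l) (p : L2 n) (g : L2Vec n) :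
    -vForm (fun x => b x • ∇ (expWeight χ (phase q R ρ) l) x) p g
      ≤ C * (‖p‖ * ‖g‖) + l * localEnergy b c (expWeight χ (phase q R ρ) l) p g := by
  set m := expWeight χ (phase q R ρ) l with hm
  have hm1 : ContDiff ℝ 1 m := hχ.contDiff_expWeight hq l
  have hmc : HasCompactSupport m := hχ.hasCompactSupport_expWeight l
  have im := isCc_of_contDiff hm1 hmc
  have iV : IsCc fun x => b x • ∇ m x := (isCc_gradient hm1 hmc).smul_left hb
  have hC0 : 0 ≤ C := (norm_nonneg _).trans (hC 0)
  rw [vForm_apply iV, localEnergy_eq hb hc im, ← integral_neg, ← integral_const_mul]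
  have i1 := (integrable_norm_mul_norm p g).const_mul C
  have i2 := (integrable_localEnergy hb hc im p g).const_mul l
  calc ∫ x, -(p x * inner ℝ (b x • ∇ m x) (g x))
      ≤ ∫ x, (C * (‖p x‖ * ‖g x‖)
        + l * (m x * ((1 / 2) * (c x * p x ^ 2 + b x * ‖g x‖ ^ 2)))) := by
        refine integral_mono (integrable_vForm iV p g).neg (i1.add i2) fun x => ?_
        have h1 : |(inner ℝ (b x • ∇ m x) (g x) : ℝ)| ≤ b x * ‖∇ m x‖ * ‖g x‖ := by
          refine (abs_real_inner_le_norm _ _).trans (le_of_eq ?_)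
          rw [norm_smul, Real.norm_of_nonneg (hb0 x).le]
        have h2 := hχ.norm_gradient_expWeight_le hq hρ hl x
        have h3 : b x * ‖∇ χ x‖ ≤ C := by
          have := hC x
          rwa [norm_smul, Real.norm_of_nonneg (hb0 x).le] at this
        have h4 := sqrt_mul_le_energyDensity (hb0 x) (hc0 x) (p := ‖p x‖) (g := ‖g x‖)
        have h5 : ‖p x‖ ^ 2 = p x ^ 2 := by rw [Real.norm_eq_abs, sq_abs]
        rw [h5] at h4
        have hm0 : 0 ≤ m x := hχ.expWeight_nonneg l x
        dsimp only
        calc -(p x * inner ℝ (b x • ∇ m x) (g x))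
            ≤ |p x * inner ℝ (b x • ∇ m x) (g x)| := neg_le_abs _
          _ = ‖p x‖ * |inner ℝ (b x • ∇ m x) (g x)| := by rw [abs_mul, Real.norm_eq_abs]
          _ ≤ ‖p x‖ * (b x * (‖∇ χ x‖ + l * m x * √(c x / b x)) * ‖g x‖) := by
              have hb' := (hb0 x).le
              refine mul_le_mul_of_nonneg_left (h1.trans ?_) (norm_nonneg _)
              gcongr
          _ = b x * ‖∇ χ x‖ * (‖p x‖ * ‖g x‖)
              + l * (m x * (b x * √(c x / b x) * (‖p x‖ * ‖g x‖))) := by ring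
          _ ≤ _ := by gcongr
    _ = C * (∫ x, ‖p x‖ * ‖g x‖)
        + ∫ x, l * (m x * ((1 / 2) * (c x * p x ^ 2 + b x * ‖g x‖ ^ 2))) := by
        rw [integral_add i1 i2, integral_const_mul]
    _ ≤ _ := by
        gcongr
        exact integral_norm_mul_norm_le p g

theorem IsPhaseCutoff.source_le (hχ : IsPhaseCutoff q R ρ R₁ χ)
    (hq : IsSpeedProfile b c σ q) (hρ : 0 < ρ) (hqR : q R ≤ Real.pi * ρ) {l t : ℝ} (hl : 0 ≤ l)
    (ht : 0 ≤ t) {H : L2 n} (hH : VanishesOn {x | t + q R < q ‖x‖} H) (p : L2 n) :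
    wForm (expWeight χ (phase q R ρ) l) H p ≤ Real.exp (l * t) * (‖H‖ * ‖p‖) := by
  set m := expWeight χ (phase q R ρ) l with hm
  have im : IsCc m := isCc_of_contDiff (hχ.contDiff_expWeight hq l)
    (hχ.hasCompactSupport_expWeight l)
  rw [wForm_apply_real im]
  calc ∫ x, m x * (H x * p x) ≤ ∫ x, Real.exp (l * t) * (‖H x‖ * ‖p x‖) := by
        refine integral_mono_ae (integrable_wForm_real im H p)
          ((integrable_norm_mul_norm H p).const_mul _) ?_
        filter_upwards [hH] with x hx
        by_cases h : x ∈ {x : Rn n | t + q R < q ‖x‖}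
        · rw [hx h]
          simp
        · have h1 : phase q R ρ x ≤ t := phase_le hq hρ hqR ht (not_lt.1 h)
          have h2 : m x ≤ Real.exp (l * t) := by
            rw [hm, expWeight]
            refine mul_le_of_le_one_left (Real.exp_pos _).le (hχ.le_one x) |>.trans ?_
            exact Real.exp_le_exp.2 (mul_le_mul_of_nonneg_left h1 hl)
          have h3 : H x * p x ≤ ‖H x‖ * ‖p x‖ := by
            rw [← norm_mul]
            exact Real.le_norm_self _
          exact (mul_le_mul_of_nonneg_left h3 (hχ.expWeight_nonneg l x)).trans
            (mul_le_mul_of_nonneg_right h2 (by positivity))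
    _ ≤ _ := by
        rw [integral_const_mul]
        gcongr
        exact integral_norm_mul_norm_le H p

variable {u : ℝ → H1 n} {p H : ℝ → L2 n}

/-- Differentiating `exp (-l τ)` cancels the part of the flux proportional to `l`; on the support of
the source the weight is at most `exp (l τ)`; and on the support of the data it is at most `χ`. All
remaining terms, hence `K`, are independent of `l`. -/
theorem IsPhaseCutoff.exp_mul_localEnergy_le (hχ : IsPhaseCutoff q R ρ R₁ χ) (hn : 1 ≤ n)
    (hq : IsSpeedProfile b c σ q) (hρ : 0 < ρ) (hR : 0 < R) (hqR : q R ≤ Real.pi * ρ)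
    (hu : IsEnergySol a b c u p H) (ha : Continuous a) (hb : Continuous b) (hc : Continuous c)
    (ha0 : ∀ x, 0 < a x) (hb0 : ∀ x, 0 < b x) (hc0 : ∀ x, 0 < c x)
    (hH : ∀ t, 0 ≤ t → VanishesOn {x | t + q R < q ‖x‖} (H t))
    (hp0 : VanishesOn {x | R < ‖x‖} (p 0)) (hu0 : VanishesOn {x | R < ‖x‖} (H1.toL2 (u 0)))
    {t : ℝ} (ht : 0 ≤ t) : ∃ K : ℝ, ∀ l : ℝ, 0 ≤ l →
      Real.exp (-(l * t)) * localEnergy b c (expWeight χ (phase q R ρ) l) (p t) (H1.grad (u t))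
        ≤ K := by
  obtain ⟨C, hC⟩ := ((isCc_gradient hχ.contDiff hχ.hasCompactSupport).smul_left hb).exists_bound
  have hC0 : 0 ≤ C := (norm_nonneg _).trans (hC 0)
  set k : ℝ → ℝ := fun τ => C * (‖p τ‖ * ‖H1.grad (u τ)‖) + ‖H τ‖ * ‖p τ‖ with hk
  have ck : Continuous k := by
    have := hu.cont_p
    have := hu.cont_H
    have := hu.cont_grad
    fun_prop
  have iχ := isCc_of_contDiff hχ.contDiff hχ.hasCompactSupport
  refine ⟨localEnergy b c χ (p 0) (H1.grad (u 0)) + ∫ τ in (0 : ℝ)..t, k τ, fun l hl => ?_⟩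
  set m := expWeight χ (phase q R ρ) l with hm
  have hm1 : ContDiff ℝ 1 m := hχ.contDiff_expWeight hq l
  have hmc : HasCompactSupport m := hχ.hasCompactSupport_expWeight l
  have im := isCc_of_contDiff hm1 hmc
  set e : ℝ → ℝ := fun τ => localEnergy b c m (p τ) (H1.grad (u τ)) with he
  have ce : Continuous e := continuous_localEnergy hu.cont_p hu.cont_grad
  set F : ℝ → ℝ := fun τ => Real.exp (-(l * τ)) * e τ - ∫ r in (0 : ℝ)..τ, k r with hF
  have dF : ∀ τ, 0 < τ → ∃ d ≤ 0, HasDerivAt F d τ := fun τ hτ => by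
    have d1 : HasDerivAt (fun τ => Real.exp (-(l * τ))) (Real.exp (-(l * τ)) * (-(l * 1))) τ :=
      (((hasDerivAt_id τ).const_mul l).neg).exp
    have d2 := hu.hasDerivAt_localEnergy ha hb hc hm1 hmc hτ
    have d3 : HasDerivAt (fun s => ∫ r in (0 : ℝ)..s, k r) (k τ) τ :=
      intervalIntegral.integral_hasDerivAt_right (ck.intervalIntegrable _ _)
        (ck.stronglyMeasurableAtFilter _ _) ck.continuousAt
    refine ⟨_, ?_, (d1.mul d2).sub d3⟩
    have h1 := hχ.neg_flux_le hq hρ hb hc hb0 hc0 hC hl (p τ) (H1.grad (u τ))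
    have h2 := hχ.source_le hq hρ hqR hl hτ.le (hH τ hτ.le) (p τ)
    have h3 : 0 ≤ wForm (fun x => a x * m x) (p τ) (p τ) := by
      rw [wForm_apply_real (im.mul_left ha)]
      refine integral_nonneg fun x => ?_
      exact mul_nonneg (mul_nonneg (ha0 x).le (hχ.expWeight_nonneg l x)) (mul_self_nonneg _)
    have h4 : Real.exp (-(l * τ)) * Real.exp (l * τ) = 1 := by rw [← Real.exp_add]; simp
    have h5 : Real.exp (-(l * τ)) ≤ 1 := Real.exp_le_one_iff.2 (by
      have := mul_nonneg hl hτ.le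
      linarith)
    have h6 := Real.exp_pos (-(l * τ))
    have h7 : 0 ≤ C * (‖p τ‖ * ‖H1.grad (u τ)‖) := by positivity
    calc Real.exp (-(l * τ)) * (-(l * 1)) * e τ + Real.exp (-(l * τ)) * (wForm m (H τ) (p τ)
          - wForm (fun x => a x * m x) (p τ) (p τ)
          - vForm (fun x => b x • ∇ m x) (p τ) (H1.grad (u τ))) - k τ
        ≤ Real.exp (-(l * τ)) * (-(l * 1)) * e τ + Real.exp (-(l * τ))
          * (Real.exp (l * τ) * (‖H τ‖ * ‖p τ‖)
            + (C * (‖p τ‖ * ‖H1.grad (u τ)‖) + l * e τ)) - k τ := by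
          gcongr
          simp only [he]
          linarith
      _ = (Real.exp (-(l * τ)) * Real.exp (l * τ)) * (‖H τ‖ * ‖p τ‖)
          + Real.exp (-(l * τ)) * (C * (‖p τ‖ * ‖H1.grad (u τ)‖)) - k τ := by ring
      _ ≤ 1 * (‖H τ‖ * ‖p τ‖) + 1 * (C * (‖p τ‖ * ‖H1.grad (u τ)‖)) - k τ := by
          rw [h4]
          gcongr
      _ = 0 := by simp only [hk]; ring
  have cF : Continuous F := by
    refine ((by fun_prop : Continuous fun τ => Real.exp (-(l * τ))).mul ce).sub ?_
    exact intervalIntegral.continuous_primitive (fun _ _ => ck.intervalIntegrable _ _) 0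
  have hanti : AntitoneOn F (Ici 0) := by
    refine antitoneOn_of_deriv_nonpos (convex_Ici 0) cF.continuousOn ?_ ?_
    · rw [interior_Ici]
      intro τ hτ
      obtain ⟨d, -, hd⟩ := dF τ hτ
      exact hd.differentiableAt.differentiableWithinAt
    · rw [interior_Ici]
      intro τ hτ
      obtain ⟨d, hd0, hd⟩ := dF τ hτ
      rw [hd.deriv]
      exact hd0
  have h0 : e 0 ≤ localEnergy b c χ (p 0) (H1.grad (u 0)) := by
    have hg0 : VanishesOn {x : Rn n | R < ‖x‖} (H1.grad (u 0)) :=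
      IsWeakGradient.vanishesOn (u 0).2 (isOpen_lt continuous_const continuous_norm) hu0
    simp only [he]
    rw [localEnergy_eq hb hc im, localEnergy_eq hb hc iχ]
    refine integral_mono_ae (integrable_localEnergy hb hc im _ _)
      (integrable_localEnergy hb hc iχ _ _) ?_
    filter_upwards [hp0, hg0] with x h1 h2
    by_cases hx : x ∈ {x : Rn n | R < ‖x‖}
    · rw [h1 hx, h2 hx]
      simp
    · have h3 : phase q R ρ x ≤ 0 := phase_le hq hρ hqR le_rfl (by
        rw [zero_add]
        exact (hq.strictMonoOn hn).monotoneOn (norm_nonneg x) hR.le (not_lt.1 hx))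
      have h4 : m x ≤ χ x := by
        rw [hm, expWeight]
        exact mul_le_of_le_one_right (hχ.nonneg x)
          (Real.exp_le_one_iff.2 (mul_nonpos_of_nonneg_of_nonpos hl h3))
      have := (hb0 x).le
      have := (hc0 x).le
      gcongr
  have h1 := hanti self_mem_Ici ht ht
  simp only [hF, mul_zero, neg_zero, Real.exp_zero, one_mul,
    intervalIntegral.integral_same, sub_zero] at h1
  linarith

/-- From `l w⁺ ≤ exp (l w)` one gets `l ∫ w⁺ f ≤ K` for every `l ≥ 0`, so `∫ w⁺ f = 0`. -/
theorem ae_eq_zero_of_exp_integral_le {f w : Rn n → ℝ} (hf : ∀ x, 0 ≤ f x) (hw : Continuous w)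
    (hfm : AEStronglyMeasurable f (volume : Measure (Rn n)))
    (hint : ∀ l : ℝ, 0 ≤ l → Integrable fun x => Real.exp (l * w x) * f x) {K : ℝ}
    (hK : ∀ l : ℝ, 0 ≤ l → ∫ x, Real.exp (l * w x) * f x ≤ K) :
    ∀ᵐ x, 0 < w x → f x = 0 := by
  have hb : ∀ l : ℝ, 0 ≤ l → ∀ x, l * (max (w x) 0 * f x) ≤ Real.exp (l * w x) * f x :=
    fun l hl x => by
      rw [← mul_assoc]
      refine mul_le_mul_of_nonneg_right ?_ (hf x)
      rcases le_total (w x) 0 with h | h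
      · rw [max_eq_right h, mul_zero]
        exact (Real.exp_pos _).le
      · rw [max_eq_left h]
        linarith [Real.add_one_le_exp (l * w x)]
  have hnn : ∀ x, 0 ≤ max (w x) 0 * f x := fun x => mul_nonneg (le_max_right _ _) (hf x)
  have hi : Integrable fun x => max (w x) 0 * f x := by
    refine (hint 1 zero_le_one).mono'
      ((hw.max continuous_const).aestronglyMeasurable.mul hfm) (Eventually.of_forall fun x => ?_)
    rw [Real.norm_of_nonneg (hnn x)]
    simpa using hb 1 zero_le_one x
  have h0 : ∫ x, max (w x) 0 * f x ≤ 0 := by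
    by_contra h
    push Not at h
    set I := ∫ x, max (w x) 0 * f x
    have h1 : (|K| + 1) / I * I ≤ K := by
      refine le_trans ?_ (hK ((|K| + 1) / I) (by positivity))
      rw [← integral_const_mul]
      exact integral_mono (hi.const_mul _) (hint _ (by positivity))
        (hb _ (by positivity))
    rw [div_mul_cancel₀ _ h.ne'] at h1
    linarith [le_abs_self K]
  have h1 := (integral_eq_zero_iff_of_nonneg hnn hi).1 (le_antisymm h0 (integral_nonneg hnn))
  filter_upwards [h1] with x hx hwx
  rcases mul_eq_zero.1 hx with h | h
  · rw [max_eq_left hwx.le] at h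
    exact absurd h hwx.ne'
  · exact h

theorem IsEnergySol.ae_eq_zero_of_phase (hn : 1 ≤ n)
    (hq : IsSpeedProfile b c σ q) (hρ : 0 < ρ) (hR : 0 < R) (hR₁ : R < R₁)
    (hqρ : Real.pi * ρ = q R₁ - q R) (hqR : 2 * q R ≤ q R₁)
    (hu : IsEnergySol a b c u p H) (ha : Continuous a) (hb : Continuous b) (hc : Continuous c)
    (ha0 : ∀ x, 0 < a x) (hb0 : ∀ x, 0 < b x) (hc0 : ∀ x, 0 < c x)
    (hH : ∀ t, 0 ≤ t → VanishesOn {x | t + q R < q ‖x‖} (H t))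
    (hp0 : VanishesOn {x | R < ‖x‖} (p 0)) (hu0 : VanishesOn {x | R < ‖x‖} (H1.toL2 (u 0)))
    {t : ℝ} (ht : 0 ≤ t) :
    ∀ᵐ x, R ≤ ‖x‖ → ‖x‖ ≤ R₁ → t < phase q R ρ x → p t x = 0 := by
  obtain ⟨χ, hχ⟩ := exists_phaseCutoff hn hq hR hR₁ hqρ hqR
  obtain ⟨K, hK⟩ := hχ.exp_mul_localEnergy_le hn hq hρ hR (by linarith) hu ha hb hc ha0 hb0 hc0
    hH hp0 hu0 ht
  have iχ := isCc_of_contDiff hχ.contDiff hχ.hasCompactSupport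
  set f : Rn n → ℝ := fun x =>
    χ x * ((1 / 2) * (c x * p t x ^ 2 + b x * ‖H1.grad (u t) x‖ ^ 2)) with hf
  have him : ∀ l, IsCc (expWeight χ (phase q R ρ) l) := fun l =>
    isCc_of_contDiff (hχ.contDiff_expWeight hq l) (hχ.hasCompactSupport_expWeight l)
  have hfe : ∀ l x, Real.exp (l * (phase q R ρ x - t)) * f x = Real.exp (-(l * t))
      * (expWeight χ (phase q R ρ) l x
        * ((1 / 2) * (c x * p t x ^ 2 + b x * ‖H1.grad (u t) x‖ ^ 2))) := fun l x => by
    rw [mul_sub, sub_eq_add_neg, Real.exp_add, hf, expWeight]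
    ring
  have h := ae_eq_zero_of_exp_integral_le (f := f) (w := fun x => phase q R ρ x - t) (K := K)
    (fun x => mul_nonneg (hχ.nonneg x) (by
      have := (hb0 x).le
      have := (hc0 x).le
      positivity))
    ((continuous_phase hq R ρ).sub continuous_const)
    (integrable_localEnergy hb hc iχ _ _).1
    (fun l _ => by
      simp only [hfe]
      exact (integrable_localEnergy hb hc (him l) _ _).const_mul _)
    (fun l hl => by
      simp only [hfe]
      rw [integral_const_mul, ← localEnergy_eq hb hc (him l)]
      exact hK l hl)
  filter_upwards [h] with x hx h1 h2 h3
  have h4 := hx (by linarith)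
  simp only [hf, hχ.eq_one x h1 h2, one_mul] at h4
  have h5 : 0 ≤ b x * ‖H1.grad (u t) x‖ ^ 2 := mul_nonneg (hb0 x).le (by positivity)
  have h6 : 0 ≤ c x * p t x ^ 2 := mul_nonneg (hc0 x).le (by positivity)
  have h7 : c x * p t x ^ 2 = 0 := by linarith
  rcases mul_eq_zero.1 h7 with h8 | h8
  · exact absurd h8 (hc0 x).ne'
  · exact pow_eq_zero_iff (two_ne_zero) |>.1 h8

theorem tendsto_mul_sin_div {ρ : ℕ → ℝ} (hρ : Tendsto ρ atTop atTop) (y : ℝ) :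
    Tendsto (fun N => ρ N * Real.sin (y / ρ N)) atTop (𝓝 y) := by
  have h1 : Tendsto (fun N => y / ρ N) atTop (𝓝 0) := hρ.const_div_atTop y
  have h2 := (Real.continuous_sinc.tendsto 0).comp h1
  rw [Real.sinc_zero] at h2
  have h3 := h2.const_mul y
  rw [mul_one] at h3
  refine h3.congr' ?_
  filter_upwards [hρ.eventually_gt_atTop 0] with N hN
  rcases eq_or_ne y 0 with rfl | hy
  · simp
  · rw [Function.comp_apply, Real.sinc_of_ne_zero (by positivity)]
    field_simp

/-- Take `R₁ = N → ∞`. Then `ρ → ∞` and the truncated phase converges pointwise to `q(|x|) - q(R)`,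
so each point with `q(|x|) > t + q(R)` is reached by some `N`; the exceptional null sets are
countably many. -/
theorem IsEnergySol.velocity_vanishesOn (hn : 1 ≤ n)
    (hq : IsSpeedProfile b c σ q) (hσ : σ < 2) (hR : 0 < R)
    (hu : IsEnergySol a b c u p H) (ha : Continuous a) (hb : Continuous b) (hc : Continuous c)
    (ha0 : ∀ x, 0 < a x) (hb0 : ∀ x, 0 < b x) (hc0 : ∀ x, 0 < c x)
    (hH : ∀ t, 0 ≤ t → VanishesOn {x | t + q R < q ‖x‖} (H t))
    (hp0 : VanishesOn {x | R < ‖x‖} (p 0)) (hu0 : VanishesOn {x | R < ‖x‖} (H1.toL2 (u 0)))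
    {t : ℝ} (ht : 0 ≤ t) : VanishesOn {x | t + q R < q ‖x‖} (p t) := by
  have hmono := hq.strictMonoOn hn
  have hqt : Tendsto (fun N : ℕ => q N) atTop atTop :=
    (hq.tendsto_atTop hσ).comp tendsto_natCast_atTop_atTop
  set ρ : ℕ → ℝ := fun N => (q N - q R) / Real.pi with hρ
  have hρt : Tendsto ρ atTop atTop :=
    (tendsto_atTop_add_const_right _ _ hqt).atTop_div_const Real.pi_pos
  have hall : ∀ N : ℕ, ∀ᵐ x : Rn n, R < N → 2 * q R ≤ q N → R ≤ ‖x‖ → ‖x‖ ≤ N →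
      t < phase q R (ρ N) x → p t x = 0 := fun N => by
    by_cases h1 : R < N
    · by_cases h2 : 2 * q R ≤ q N
      · have hρ0 : 0 < ρ N :=
          div_pos (sub_pos.2 (hmono hR.le (hR.trans h1).le h1)) Real.pi_pos
        filter_upwards [hu.ae_eq_zero_of_phase hn hq hρ0 hR h1
          (by simp only [hρ]; field_simp) h2 ha hb hc ha0 hb0 hc0 hH hp0 hu0 ht] with x hx _ _
        exact hx
      · exact Eventually.of_forall fun x _ h => absurd h h2
    · exact Eventually.of_forall fun x h => absurd h h1
  filter_upwards [ae_all_iff.2 hall] with x hx hxt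
  have hxt' : t + q R < q ‖x‖ := hxt
  have hRx : R ≤ ‖x‖ := by
    by_contra h
    have := hmono.monotoneOn (norm_nonneg x) hR.le (not_le.1 h).le
    linarith
  have h1 : ∀ᶠ N : ℕ in atTop, t < phase q R (ρ N) x :=
    (tendsto_mul_sin_div hρt (q ‖x‖ - q R)).eventually_const_lt (by linarith)
  obtain ⟨N, h2, h3, h4, h5⟩ := (h1.and ((hqt.eventually_ge_atTop (2 * q R)).and
    ((tendsto_natCast_atTop_atTop.eventually_gt_atTop R).and
      (tendsto_natCast_atTop_atTop.eventually_ge_atTop ‖x‖)))).exists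
  exact hx N h4 h3 hRx h5 h2

/-- Integrate the velocity from time zero: the sets on which it vanishes shrink as time grows. -/
theorem IsEnergySol.vanishesOn (hn : 1 ≤ n)
    (hq : IsSpeedProfile b c σ q) (hσ : σ < 2) (hR : 0 < R)
    (hu : IsEnergySol a b c u p H) (ha : Continuous a) (hb : Continuous b) (hc : Continuous c)
    (ha0 : ∀ x, 0 < a x) (hb0 : ∀ x, 0 < b x) (hc0 : ∀ x, 0 < c x)
    (hH : ∀ t, 0 ≤ t → VanishesOn {x | t + q R < q ‖x‖} (H t))
    (hp0 : VanishesOn {x | R < ‖x‖} (p 0)) (hu0 : VanishesOn {x | R < ‖x‖} (H1.toL2 (u 0)))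
    {t : ℝ} (ht : 0 ≤ t) : VanishesOn {x | t + q R < q ‖x‖} (H1.toL2 (u t)) := by
  have hS : IsOpen {x : Rn n | t + q R < q ‖x‖} :=
    isOpen_lt continuous_const hq.continuous_comp_norm
  have h1 : VanishesOn {x : Rn n | t + q R < q ‖x‖} (∫ τ in (0 : ℝ)..t, p τ) := by
    refine VanishesOn.intervalIntegral hS.measurableSet hu.cont_p ht fun τ hτ => ?_
    filter_upwards [hu.velocity_vanishesOn hn hq hσ hR ha hb hc ha0 hb0 hc0 hH hp0 hu0 hτ.1]
      with x hx hxt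
    refine hx ?_
    have : t + q R < q ‖x‖ := hxt
    change τ + q R < q ‖x‖
    linarith [hτ.2]
  have h2 : VanishesOn {x : Rn n | t + q R < q ‖x‖} (H1.toL2 (u 0)) := by
    filter_upwards [hu0] with x hx hxt
    refine hx ?_
    by_contra h
    have h3 := (hq.strictMonoOn hn).monotoneOn (norm_nonneg x) hR.le (not_lt.1 h)
    have : t + q R < q ‖x‖ := hxt
    linarith
  have h3 : H1.toL2 (u t) = H1.toL2 (u 0) + ∫ τ in (0 : ℝ)..t, p τ := by
    rw [hu.toL2_sub le_rfl ht]
    abel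
  rw [h3]
  exact h2.add h1

end EnergyEstimate

/-! ### The source as a continuous curve in `L²` -/

section Source

variable {n : ℕ} {q : ℝ → ℝ} {R : ℝ} {h : ℝ → Rn n → ℝ}

theorem sourceDeriv_zero (h : ℝ → Rn n → ℝ) : sourceDeriv 0 h = h := by
  funext t x
  simp [sourceDeriv]

theorem sourceDeriv_one (h : ℝ → Rn n → ℝ) (t : ℝ) (x : Rn n) :
    sourceDeriv 1 h t x = derivWithin (fun s => h s x) (Ici 0) t := by
  rw [sourceDeriv, iteratedDerivWithin_one]

theorem sourceDeriv_succ (i : ℕ) (h : ℝ → Rn n → ℝ) :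
    sourceDeriv (i + 1) h = sourceDeriv 1 (sourceDeriv i h) := by
  funext t x
  rw [sourceDeriv_one, sourceDeriv, iteratedDerivWithin_succ]
  rfl

theorem IsSource.hasDerivWithinAt_fderivWithin (hh : IsSource q R h) {t : ℝ} (ht : 0 ≤ t)
    (x : Rn n) : HasDerivWithinAt (fun s => h s x)
      (fderivWithin ℝ (fun p : ℝ × Rn n => h p.1 p.2) (Ici 0 ×ˢ univ) (t, x) (1, 0)) (Ici 0) t := by
  have h1 := (hh.smooth.differentiableOn (by simp) (t, x) ⟨ht, mem_univ x⟩).hasFDerivWithinAt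
  have h2 : HasDerivWithinAt (fun s : ℝ => (s, x)) ((1 : ℝ), (0 : Rn n)) (Ici 0) t :=
    ((hasDerivAt_id t).prodMk (hasDerivAt_const t x)).hasDerivWithinAt
  have h3 : MapsTo (fun s : ℝ => (s, x)) (Ici 0) (Ici 0 ×ˢ univ) := fun s hs => ⟨hs, mem_univ x⟩
  exact h1.comp_hasDerivWithinAt t h2 h3

theorem IsSource.sourceDeriv_one_eq (hh : IsSource q R h) {t : ℝ} (ht : 0 ≤ t) (x : Rn n) :
    sourceDeriv 1 h t x
      = fderivWithin ℝ (fun p : ℝ × Rn n => h p.1 p.2) (Ici 0 ×ˢ univ) (t, x) (1, 0) := by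
  rw [sourceDeriv_one]
  exact (hh.hasDerivWithinAt_fderivWithin ht x).derivWithin (uniqueDiffOn_Ici 0 t ht)

theorem IsSource.hasDerivAt (hh : IsSource q R h) {t : ℝ} (ht : 0 < t) (x : Rn n) :
    HasDerivAt (fun s => h s x) (sourceDeriv 1 h t x) t := by
  rw [hh.sourceDeriv_one_eq ht.le]
  exact (hh.hasDerivWithinAt_fderivWithin ht.le x).hasDerivAt (Ici_mem_nhds ht)

theorem IsSource.deriv (hh : IsSource q R h) : IsSource q R (sourceDeriv 1 h) where
  smooth := by
    have h1 : ContDiffOn ℝ ∞ (fderivWithin ℝ (fun p : ℝ × Rn n => h p.1 p.2) (Ici 0 ×ˢ univ))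
        (Ici 0 ×ˢ univ) :=
      hh.smooth.fderivWithin ((uniqueDiffOn_Ici 0).prod uniqueDiffOn_univ) (by simp)
    refine (h1.clm_apply (contDiffOn_const (c := ((1 : ℝ), (0 : Rn n))))).congr fun p hp => ?_
    exact hh.sourceDeriv_one_eq hp.1 p.2
  support t ht x hx := by
    rw [sourceDeriv_one]
    have h1 : (fun s => h s x) =ᶠ[𝓝[Ici 0] t] fun _ => 0 := by
      have h2 : ∀ᶠ s in 𝓝 t, s + q R < q ‖x‖ :=
        (continuous_id.add continuous_const).continuousAt.eventually_lt continuousAt_const hx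
      filter_upwards [h2.filter_mono nhdsWithin_le_nhds, self_mem_nhdsWithin] with s hs hs0
      exact hh.support s hs0 x hs
    rw [h1.derivWithin_eq (hh.support t ht x hx)]
    simp

theorem IsSource.iterate (hh : IsSource q R h) (i : ℕ) : IsSource q R (sourceDeriv i h) := by
  induction i with
  | zero => rwa [sourceDeriv_zero]
  | succ i ih =>
    rw [sourceDeriv_succ]
    exact ih.deriv

theorem IsSource.continuousOn (hh : IsSource q R h) :
    ContinuousOn (fun p : ℝ × Rn n => h p.1 p.2) (Ici 0 ×ˢ univ) := hh.smooth.continuousOn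

variable {b c : Rn n → ℝ} {σ : ℝ}

theorem IsSpeedProfile.exists_radius (hn : 1 ≤ n) (hq : IsSpeedProfile b c σ q) (hσ : σ < 2)
    (R T : ℝ) : ∃ r : ℝ, 0 ≤ r ∧ ∀ t ≤ T, ∀ x : Rn n, r < ‖x‖ → t + q R < q ‖x‖ := by
  obtain ⟨r, hr0, hr⟩ := ((eventually_ge_atTop 0).and
    ((hq.tendsto_atTop hσ).eventually_gt_atTop (T + q R))).exists
  refine ⟨r, hr0, fun t ht x hx => ?_⟩
  have := (hq.strictMonoOn hn).monotoneOn hr0 (norm_nonneg x) hx.le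
  linarith

theorem IsSource.isCc (hn : 1 ≤ n) (hq : IsSpeedProfile b c σ q) (hσ : σ < 2)
    (hh : IsSource q R h) {t : ℝ} (ht : 0 ≤ t) : IsCc (h t) := by
  refine ⟨?_, ?_⟩
  · exact hh.continuousOn.comp_continuous (continuous_const.prodMk continuous_id)
      fun x => ⟨ht, mem_univ x⟩
  · obtain ⟨r, -, hr⟩ := hq.exists_radius hn hσ R t
    refine HasCompactSupport.intro (isCompact_closedBall (0 : Rn n) r) fun x hx => ?_
    refine hh.support t ht x (hr t le_rfl x ?_)
    simpa using hx

open Classical in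
/-- The source as a curve in `L²`, extended by its initial value to negative times. -/
def sourceLp (h : ℝ → Rn n → ℝ) (t : ℝ) : L2 n :=
  if hm : MemLp (h (max t 0)) 2 volume then hm.toLp else 0

theorem IsSource.coeFn_sourceLp (hn : 1 ≤ n) (hq : IsSpeedProfile b c σ q) (hσ : σ < 2)
    (hh : IsSource q R h) (t : ℝ) : sourceLp h t =ᵐ[volume] h (max t 0) := by
  have hm : MemLp (h (max t 0)) 2 volume := (hh.isCc hn hq hσ (le_max_right t 0)).memLp
  rw [sourceLp, dif_pos hm]
  exact hm.coeFn_toLp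

theorem norm_sq_le_of_bound {χ : Rn n → ℝ} (hχ : IsCc χ) {f : L2 n} {C : ℝ}
    (hf : ∀ᵐ x, f x ^ 2 ≤ C * χ x) : ‖f‖ ^ 2 ≤ C * ∫ x, χ x := by
  rw [← real_inner_self_eq_norm_sq, L2.inner_def, ← integral_const_mul]
  refine integral_mono_ae (L2.integrable_inner f f)
    ((hχ.1.integrable_of_hasCompactSupport hχ.2).const_mul C) ?_
  filter_upwards [hf] with x hx
  rw [real_inner_self_eq_norm_sq, Real.norm_eq_abs, sq_abs]
  exact hx

/-- Up to a given time all supports lie in one ball, and `h` is uniformly continuous on the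
resulting compact cylinder. -/
theorem IsSource.continuous_sourceLp (hn : 1 ≤ n) (hq : IsSpeedProfile b c σ q) (hσ : σ < 2)
    (hh : IsSource q R h) : Continuous (sourceLp h) := by
  rw [continuous_iff_continuousAt]
  intro t₀
  set T := max t₀ 0 + 1 with hT
  obtain ⟨r, hr0, hr⟩ := hq.exists_radius hn hσ R T
  obtain ⟨χ, hχ, hχc, hχ0, -, hχ1, -⟩ := exists_cutoff (n := n) r
  have iχ : IsCc χ := ⟨hχ.continuous, hχc⟩
  have huc : UniformContinuousOn (fun p : ℝ × Rn n => h p.1 p.2)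
      (Icc 0 T ×ˢ Metric.closedBall 0 r) :=
    (isCompact_Icc.prod (isCompact_closedBall (0 : Rn n) r)).uniformContinuousOn_of_continuous
      (hh.continuousOn.mono (prod_mono Icc_subset_Ici_self (subset_univ _)))
  set I := ∫ x, χ x with hI
  have hI0 : 0 ≤ I := integral_nonneg hχ0
  rw [Metric.continuousAt_iff]
  intro ε hε
  -- Then `δ² I < ε²`, where `I` bounds the volume of the ball.
  set δ := ε / (2 * (I + 1)) with hδ
  have hδ0 : 0 < δ := by positivity
  obtain ⟨η, hη, hcl⟩ := Metric.uniformContinuousOn_iff.1 huc δ hδ0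
  refine ⟨min η 1, by positivity, fun {s} hs => ?_⟩
  have hs1 : |s - t₀| < η := (hs.trans_le (min_le_left _ _))
  have hs2 : |s - t₀| < 1 := (hs.trans_le (min_le_right _ _))
  have hms : |max s 0 - max t₀ 0| ≤ |s - t₀| := abs_max_sub_max_le_abs s t₀ 0
  have hsT : max s 0 ≤ T := by linarith [(abs_le.1 (hms.trans hs2.le)).2]
  have hbd : ‖sourceLp h s - sourceLp h t₀‖ ^ 2 ≤ δ ^ 2 * I := by
    refine norm_sq_le_of_bound iχ ?_
    filter_upwards [Lp.coeFn_sub (sourceLp h s) (sourceLp h t₀),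
      hh.coeFn_sourceLp hn hq hσ s, hh.coeFn_sourceLp hn hq hσ t₀] with x h1 h2 h3
    rw [h1, Pi.sub_apply, h2, h3]
    rcases le_or_gt ‖x‖ r with hx | hx
    · rw [hχ1 x hx, mul_one]
      have h4 := hcl (max s 0, x) ⟨⟨le_max_right _ _, hsT⟩, by simpa using hx⟩
        (max t₀ 0, x) ⟨⟨le_max_right _ _, by linarith⟩, by simpa using hx⟩
        (by
          rw [Prod.dist_eq, dist_self, max_eq_left dist_nonneg, Real.dist_eq]
          exact hms.trans_lt hs1)
      rw [Real.dist_eq] at h4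
      exact sq_le_sq' (by linarith [(abs_lt.1 h4).1]) (abs_lt.1 h4).2.le
    · rw [hh.support _ (le_max_right _ _) x (hr _ hsT x hx),
        hh.support _ (le_max_right _ _) x (hr _ (by linarith) x hx)]
      have := hχ0 x
      simp only [sub_self, ne_eq, OfNat.ofNat_ne_zero, not_false_eq_true, zero_pow]
      positivity
  rw [dist_eq_norm]
  refine lt_of_pow_lt_pow_left₀ 2 hε.le (hbd.trans_lt ?_)
  have h5 : δ * (2 * (I + 1)) = ε := by rw [hδ]; field_simp
  rw [← h5]
  have h6 : 0 < δ ^ 2 := by positivity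
  nlinarith

theorem IsSource.vanishesOn_sourceLp (hn : 1 ≤ n) (hq : IsSpeedProfile b c σ q) (hσ : σ < 2)
    (hh : IsSource q R h) {t : ℝ} (ht : 0 ≤ t) :
    VanishesOn {x | t + q R < q ‖x‖} (sourceLp h t) := by
  filter_upwards [hh.coeFn_sourceLp hn hq hσ t] with x hx hxt
  rw [hx, max_eq_left ht]
  exact hh.support t ht x hxt

theorem IsSource.hasDerivAt_integral (hh : IsSource q R h) {φ : Rn n → ℝ} (hφ : IsCc φ) {t : ℝ}
    (ht : 0 < t) :
    HasDerivAt (fun s => ∫ x, h s x * φ x) (∫ x, sourceDeriv 1 h t x * φ x) t := by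
  have hcs : ∀ {h' : ℝ → Rn n → ℝ}, IsSource q R h' → ∀ s, 0 ≤ s → Continuous (h' s) :=
    fun hh' s hs => hh'.continuousOn.comp_continuous (continuous_const.prodMk continuous_id)
      fun x => ⟨hs, mem_univ x⟩
  obtain ⟨C, hC⟩ := (isCompact_Icc (a := (0 : ℝ)) (b := 2 * t)).prod hφ.2.isCompact
    |>.exists_bound_of_continuousOn (f := fun p : ℝ × Rn n => sourceDeriv 1 h p.1 p.2)
      (hh.deriv.continuousOn.mono (prod_mono Icc_subset_Ici_self (subset_univ _)))
  have hball : ∀ s ∈ Metric.ball t t, 0 < s ∧ s < 2 * t := fun s hs => by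
    rw [Real.ball_eq_Ioo] at hs
    exact ⟨by linarith [hs.1], by linarith [hs.2]⟩
  refine (hasDerivAt_integral_of_dominated_loc_of_deriv_le (𝕜 := ℝ)
    (F := fun s x => h s x * φ x) (F' := fun s x => sourceDeriv 1 h s x * φ x) (bound := fun x => C * ‖φ x‖)
    (Metric.ball_mem_nhds t ht) ?_ ?_ ?_ ?_ ?_ ?_).2
  · filter_upwards [Ioi_mem_nhds ht] with s hs
    exact ((hcs hh s (le_of_lt hs)).mul hφ.1).aestronglyMeasurable
  · exact ((hcs hh t ht.le).mul hφ.1).integrable_of_hasCompactSupport hφ.2.mul_left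
  · exact ((hcs hh.deriv t ht.le).mul hφ.1).aestronglyMeasurable
  · refine Eventually.of_forall fun x s hs => ?_
    rw [norm_mul]
    by_cases hx : x ∈ tsupport φ
    · gcongr
      exact hC (s, x) ⟨⟨(hball s hs).1.le, (hball s hs).2.le⟩, hx⟩
    · rw [image_eq_zero_of_notMem_tsupport hx]
      simp
  · exact ((hφ.1.norm).integrable_of_hasCompactSupport hφ.2.norm).const_mul C
  · exact Eventually.of_forall fun x s hs => (hh.hasDerivAt (hball s hs).1 x).mul_const _

end Source

/-! ### Time derivatives of solutions and their supports -/

section Solution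

open scoped Gradient

variable {n : ℕ} {a b c : Rn n → ℝ} {h : ℝ → Rn n → ℝ} {k : ℕ} {u₀ : H1 n} {u₁ : L2 n}
  {u : ℝ → H1 n} {q : ℝ → ℝ} {R σ : ℝ}

theorem IsSolution.hasDerivWithinAt_toL2 (hu : IsSolution a b c h k u₀ u₁ u) {t : ℝ}
    (ht : 0 ≤ t) : HasDerivWithinAt (fun s => H1.toL2 (u s)) (velocity u t) (Ici 0) t :=
  (hu.contDiffOn_L2.differentiableOn (by simp) t ht).hasDerivWithinAt

theorem IsSolution.continuousOn_velocity (hu : IsSolution a b c h k u₀ u₁ u) :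
    ContinuousOn (velocity u) (Ici 0) :=
  hu.contDiffOn_L2.continuousOn_derivWithin (uniqueDiffOn_Ici 0) (by simp)

theorem continuous_comp_max {E : Type*} [TopologicalSpace E] {f : ℝ → E}
    (hf : ContinuousOn f (Ici 0)) : Continuous fun t => f (max t 0) :=
  hf.comp_continuous (by fun_prop) fun t => le_max_right t 0

theorem eventually_max_eq {t : ℝ} (ht : 0 < t) : ∀ᶠ s in 𝓝 t, max s 0 = s := by
  filter_upwards [Ioi_mem_nhds ht] with s hs
  exact max_eq_left (le_of_lt hs)

theorem IsSolution.isEnergySol (hn : 1 ≤ n) (hq : IsSpeedProfile b c σ q) (hσ : σ < 2)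
    (hh : IsSource q R h) (hu : IsSolution a b c h k u₀ u₁ u) :
    IsEnergySol a b c (fun t => u (max t 0)) (fun t => velocity u (max t 0)) (sourceLp h) where
  cont_u := continuous_comp_max hu.contDiffOn_H1.continuousOn
  cont_p := continuous_comp_max hu.continuousOn_velocity
  cont_H := hh.continuous_sourceLp hn hq hσ
  hasDerivAt t ht := by
    have h1 := (hu.hasDerivWithinAt_toL2 ht.le).hasDerivAt (Ici_mem_nhds ht)
    rw [max_eq_left ht.le]
    refine h1.congr_of_eventuallyEq ?_
    filter_upwards [eventually_max_eq ht] with s hs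
    rw [hs]
  equation φ hφ hφc t ht := by
    have h1 := hu.equation φ hφ hφc t ht
    rw [max_eq_left ht.le]
    have h2 : ∫ x, sourceLp h t x * φ x = ∫ x, h t x * φ x := by
      refine integral_congr_ae ?_
      filter_upwards [hh.coeFn_sourceLp hn hq hσ t] with x hx
      rw [hx, max_eq_left ht.le]
    rw [h2]
    refine h1.congr_of_eventuallyEq ?_
    filter_upwards [eventually_max_eq ht] with s hs
    rw [hs]

theorem timeDeriv_zero (u : ℝ → H1 n) : timeDeriv 0 u = u := by
  funext t
  simp [timeDeriv]

theorem timeDeriv_one (u : ℝ → H1 n) (t : ℝ) : timeDeriv 1 u t = derivWithin u (Ici 0) t := by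
  rw [timeDeriv, iteratedDerivWithin_one]

theorem timeDeriv_succ (i : ℕ) (u : ℝ → H1 n) :
    timeDeriv (i + 1) u = timeDeriv 1 (timeDeriv i u) := by
  funext t
  rw [timeDeriv_one, timeDeriv, iteratedDerivWithin_succ]
  rfl

theorem IsSolution.hasDerivWithinAt (hu : IsSolution a b c h (k + 1) u₀ u₁ u) {t : ℝ}
    (ht : 0 ≤ t) : HasDerivWithinAt u (timeDeriv 1 u t) (Ici 0) t := by
  rw [timeDeriv_one]
  exact (hu.contDiffOn_H1.differentiableOn (by simp) t ht).hasDerivWithinAt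

theorem IsSolution.toL2_timeDeriv (hu : IsSolution a b c h (k + 1) u₀ u₁ u) {t : ℝ}
    (ht : 0 ≤ t) : H1.toL2 (timeDeriv 1 u t) = velocity u t :=
  ((H1.toL2.hasFDerivAt.comp_hasDerivWithinAt t (hu.hasDerivWithinAt ht)).derivWithin
    (uniqueDiffOn_Ici 0 t ht)).symm

/-- With one more derivative available the velocity is `C¹` in `L²`, so for each test function the
equation is a pointwise identity in `t > 0`, every term of whose right-hand side is differentiable.
-/
theorem IsSolution.deriv (hb : Continuous b) (hc : Continuous c)
    (ha : Continuous a) (hh : IsSource q R h)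
    (hu : IsSolution a b c h (k + 1) u₀ u₁ u) :
    IsSolution a b c (sourceDeriv 1 h) k (timeDeriv 1 u 0) (velocity (timeDeriv 1 u) 0)
      (timeDeriv 1 u) := by
  have hL2 : ContDiffOn ℝ (k + 1) (fun t => H1.toL2 (timeDeriv 1 u t)) (Ici 0) := by
    have h1 : ContDiffOn ℝ (k + 1) (velocity u) (Ici 0) :=
      hu.contDiffOn_L2.derivWithin (uniqueDiffOn_Ici 0) (by push_cast; rfl)
    exact h1.congr fun t ht => hu.toL2_timeDeriv ht
  have hvel : ∀ t, 0 < t → HasDerivAt (velocity u) (velocity (timeDeriv 1 u) t) t := by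
    intro t ht
    have h1 : HasDerivAt (fun s => H1.toL2 (timeDeriv 1 u s)) (velocity (timeDeriv 1 u) t) t :=
      ((hL2.differentiableOn (by simp) t ht.le).hasDerivWithinAt).hasDerivAt (Ici_mem_nhds ht)
    refine h1.congr_of_eventuallyEq ?_
    filter_upwards [Ioi_mem_nhds ht] with s hs
    exact (hu.toL2_timeDeriv (le_of_lt hs)).symm
  refine ⟨?_, hL2, rfl, rfl, ?_⟩
  · have h1 : ContDiffOn ℝ k (derivWithin u (Ici 0)) (Ici 0) :=
      hu.contDiffOn_H1.derivWithin (uniqueDiffOn_Ici 0) (by push_cast; rfl)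
    exact h1.congr fun t _ => timeDeriv_one u t
  · intro φ hφ hφc t ht
    have hφ1 : ContDiff ℝ 1 φ := hφ.of_le (by simp)
    have iφ := isCc_of_contDiff hφ1 hφc
    have igφ : IsCc fun x => b x • ∇ φ x := (isCc_gradient hφ1 hφc).smul_left hb
    have icφ := iφ.mul_left hc
    have iaφ := iφ.mul_left ha
    have heq := hu.equation φ hφ hφc
    simp only [integral_mul_mul_eq_inner icφ, integral_mul_mul_eq_inner iaφ,
      integral_mul_fderiv_eq_inner igφ] at heq ⊢
    have h1 : ∀ s, 0 < s → (inner ℝ icφ.toLp (velocity (timeDeriv 1 u) s) : ℝ)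
        = (∫ x, h s x * φ x) - inner ℝ igφ.toLp (H1.grad (u s))
          - inner ℝ iaφ.toLp (velocity u s) := fun s hs =>
      (((innerSL ℝ icφ.toLp).hasFDerivAt.comp_hasDerivAt s (hvel s hs))).unique (heq s hs)
    have d1 := hh.hasDerivAt_integral iφ ht
    have d2 : HasDerivAt (fun s => inner ℝ igφ.toLp (H1.grad (u s)))
        (inner ℝ igφ.toLp (H1.grad (timeDeriv 1 u t)) : ℝ) t :=
      ((innerSL ℝ igφ.toLp).comp H1.grad).hasFDerivAt.comp_hasDerivAt t
        ((hu.hasDerivWithinAt ht.le).hasDerivAt (Ici_mem_nhds ht))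
    have d3 : HasDerivAt (fun s => inner ℝ iaφ.toLp (velocity u s))
        (inner ℝ iaφ.toLp (velocity (timeDeriv 1 u) t) : ℝ) t :=
      (innerSL ℝ iaφ.toLp).hasFDerivAt.comp_hasDerivAt t (hvel t ht)
    refine ((d1.sub d2).sub d3).congr_of_eventuallyEq ?_
    filter_upwards [Ioi_mem_nhds ht] with s hs
    exact h1 s hs

theorem IsSolution.iterate (hb : Continuous b) (hc : Continuous c)
    (ha : Continuous a) (hh : IsSource q R h) (i : ℕ)
    (hu : IsSolution a b c h (k + i) u₀ u₁ u) :
    ∃ v₀ v₁, IsSolution a b c (sourceDeriv i h) k v₀ v₁ (timeDeriv i u) := by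
  induction i generalizing k with
  | zero =>
    rw [sourceDeriv_zero, timeDeriv_zero]
    exact ⟨u₀, u₁, hu⟩
  | succ i ih =>
    obtain ⟨v₀, v₁, hv⟩ := ih (k := k + 1) (by rwa [add_right_comm, add_assoc])
    rw [sourceDeriv_succ, timeDeriv_succ]
    exact ⟨_, _, hv.deriv hb hc ha (hh.iterate i)⟩

/-- For `δ > 0` the curve vanishes on `{t + δ + q(R) < q}` at all times before `t + δ`, hence so
does its derivative at `t`; the sets with `δ = 1 / (m + 1)` exhaust `{t + q(R) < q}`. -/
theorem vanishesOn_derivWithin (hq : IsSpeedProfile b c σ q) {f : ℝ → L2 n} {f' : L2 n}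
    (hf : ∀ s, 0 ≤ s → VanishesOn {x | s + q R < q ‖x‖} (f s)) {t : ℝ} (ht : 0 ≤ t)
    (hd : HasDerivWithinAt f f' (Ici 0) t) : VanishesOn {x | t + q R < q ‖x‖} f' := by
  have hS : ∀ s, MeasurableSet {x : Rn n | s + q R < q ‖x‖} := fun s =>
    (isOpen_lt continuous_const hq.continuous_comp_norm).measurableSet
  have h1 : ∀ m : ℕ, VanishesOn {x | t + 1 / ((m : ℝ) + 1) + q R < q ‖x‖} f' := fun m => by
    set δ := 1 / ((m : ℝ) + 1) with hδ
    have hδ0 : 0 < δ := by positivity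
    rw [vanishesOn_iff (hS _)]
    set P := LpToLpRestrictCLM (Rn n) ℝ ℝ volume 2 {x | t + δ + q R < q ‖x‖} with hP
    have h2 : HasDerivWithinAt (fun s => P (f s)) (P f') (Ici 0) t :=
      P.hasFDerivAt.comp_hasDerivWithinAt t hd
    have h3 : (fun s => P (f s)) =ᶠ[𝓝[Ici 0] t] fun _ => 0 := by
      filter_upwards [mem_nhdsWithin_of_mem_nhds (Iio_mem_nhds (by linarith : t < t + δ)),
        self_mem_nhdsWithin] with s hs hs0
      refine (vanishesOn_iff (hS _) _).1 ?_
      filter_upwards [hf s hs0] with x hx hxt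
      refine hx ?_
      have h4 : t + δ + q R < q ‖x‖ := hxt
      have h5 : s < t + δ := hs
      change s + q R < q ‖x‖
      linarith
    have h4 : HasDerivWithinAt (fun s => P (f s)) 0 (Ici 0) t :=
      (hasDerivWithinAt_const t (Ici 0) (0 : Lp ℝ 2 _)).congr_of_eventuallyEq h3
        (h3.eq_of_nhdsWithin ht)
    exact (uniqueDiffOn_Ici (0 : ℝ) t ht).eq_deriv _ h2 h4
  filter_upwards [ae_all_iff.2 h1] with x hx hxt
  have h2 : t + q R < q ‖x‖ := hxt
  obtain ⟨m, hm⟩ := exists_nat_one_div_lt (by linarith : 0 < q ‖x‖ - t - q R)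
  refine hx m ?_
  linarith

theorem IsSolution.vanishesOn_velocity (hq : IsSpeedProfile b c σ q)
    (hu : IsSolution a b c h k u₀ u₁ u)
    (hv : ∀ s, 0 ≤ s → VanishesOn {x | s + q R < q ‖x‖} (H1.toL2 (u s))) {t : ℝ} (ht : 0 ≤ t) :
    VanishesOn {x | t + q R < q ‖x‖} (velocity u t) :=
  vanishesOn_derivWithin hq hv ht (hu.hasDerivWithinAt_toL2 ht)

theorem IsSolution.vanishesOn_iterate (hb : Continuous b) (hc : Continuous c)
    (ha : Continuous a) (hh : IsSource q R h) (hq : IsSpeedProfile b c σ q) (i : ℕ)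
    (hu : IsSolution a b c h (k + i) u₀ u₁ u)
    (hv : ∀ s, 0 ≤ s → VanishesOn {x | s + q R < q ‖x‖} (H1.toL2 (u s))) :
    ∀ s, 0 ≤ s → VanishesOn {x | s + q R < q ‖x‖} (H1.toL2 (timeDeriv i u s)) := by
  induction i generalizing k with
  | zero => rwa [timeDeriv_zero]
  | succ i ih =>
    intro s hs
    have hu' : IsSolution a b c h ((k + 1) + i) u₀ u₁ u := by rwa [add_right_comm, add_assoc]
    obtain ⟨v₀, v₁, hv'⟩ := hu'.iterate hb hc ha hh i
    rw [timeDeriv_succ, hv'.toL2_timeDeriv hs]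
    exact hv'.vanishesOn_velocity hq (ih hu') hs

theorem vanishesOn_grad (hq : IsSpeedProfile b c σ q) {t : ℝ} {w : H1 n}
    (hw : VanishesOn {x | t + q R < q ‖x‖} (H1.toL2 w)) :
    VanishesOn {x | t + q R < q ‖x‖} (H1.grad w) :=
  IsWeakGradient.vanishesOn w.2 (isOpen_lt continuous_const hq.continuous_comp_norm) hw

theorem IsSolution.vanishesOn (hn : 1 ≤ n) (hq : IsSpeedProfile b c σ q) (hσ : σ < 2) (hR : 0 < R)
    (hh : IsSource q R h) (hu : IsSolution a b c h k u₀ u₁ u) (ha : Continuous a)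
    (hb : Continuous b) (hc : Continuous c)
    (ha0 : ∀ x, 0 < a x) (hb0 : ∀ x, 0 < b x) (hc0 : ∀ x, 0 < c x)
    (hu₀ : ∀ᵐ x, R < ‖x‖ → H1.toL2 u₀ x = 0) (hu₁ : ∀ᵐ x, R < ‖x‖ → u₁ x = 0) {t : ℝ}
    (ht : 0 ≤ t) : VanishesOn {x | t + q R < q ‖x‖} (H1.toL2 (u t)) := by
  have h1 := (hu.isEnergySol hn hq hσ hh).vanishesOn hn hq hσ hR ha hb hc ha0 hb0 hc0
    (fun s hs => hh.vanishesOn_sourceLp hn hq hσ hs)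
    (by rw [max_self, hu.initial_velocity]; exact hu₁)
    (by rw [max_self, hu.initial]; exact hu₀) ht
  rwa [max_eq_left ht] at h1

end Solution

/-! ### Time weights -/

section Weights

/-- The weight `(1 + t) ^ s (κ + t) ^ i`. -/
def weight (κ s : ℝ) (i : ℕ) (t : ℝ) : ℝ := (1 + t) ^ s * (κ + t) ^ i

variable {κ s K A δ T₀ T : ℝ}

theorem weight_succ (κ s : ℝ) (i : ℕ) (t : ℝ) :
    weight κ s (i + 1) t = weight κ s i t * (κ + t) := by
  rw [weight, weight, pow_succ]
  ring

theorem weight_pos (i : ℕ) {t : ℝ} (ht : 0 ≤ t) (hκ : 0 < κ + t) : 0 < weight κ s i t := by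
  unfold weight
  positivity

theorem continuousOn_weight (i : ℕ) (h₀ : 0 ≤ T₀) :
    ContinuousOn (weight κ s i) (Icc T₀ T) := by
  refine ContinuousOn.mul ?_ (by fun_prop)
  refine ContinuousOn.rpow_const (by fun_prop) fun t ht => Or.inl ?_
  linarith [ht.1]

theorem continuousOn_weight_mul (i : ℕ) (h₀ : 0 ≤ T₀) {f : ℝ → ℝ} (hf : ContinuousOn f (Icc T₀ T)) :
    ContinuousOn (fun t => weight κ s i t * f t) (Icc T₀ T) :=
  (continuousOn_weight i h₀).mul hf

theorem hasDerivAt_weight (i : ℕ) {t : ℝ} (ht : 0 ≤ t) :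
    HasDerivAt (weight κ s (i + 1))
      (s * (weight κ s (i + 1) t / (1 + t)) + (i + 1) * weight κ s i t) t := by
  have h0 : (0 : ℝ) < 1 + t := by linarith
  have d1 : HasDerivAt (fun t : ℝ => (1 + t) ^ s) (1 * s * (1 + t) ^ (s - 1)) t :=
    ((hasDerivAt_id t).const_add 1).rpow_const (Or.inl h0.ne')
  have d2 : HasDerivAt (fun t : ℝ => (κ + t) ^ (i + 1))
      (((i + 1 : ℕ) : ℝ) * (κ + t) ^ i * 1) t := by
    simpa using ((hasDerivAt_id t).const_add κ).fun_pow (i + 1)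
  refine (d1.mul d2).congr_deriv ?_
  rw [weight, weight, Real.rpow_sub_one h0.ne']
  push_cast
  field_simp

end Weights

section IntegralSplit

theorem integral_combination {T₀ T : ℝ} (hT : T₀ ≤ T) {f₁ f₂ f₃ f₄ : ℝ → ℝ}
    (h₁ : ContinuousOn f₁ (Icc T₀ T)) (h₂ : ContinuousOn f₂ (Icc T₀ T))
    (h₃ : ContinuousOn f₃ (Icc T₀ T)) (h₄ : ContinuousOn f₄ (Icc T₀ T)) (x₁ x₂ x₃ x₄ : ℝ) :
    ∫ t in T₀..T, (x₁ * f₁ t + x₂ * f₂ t + x₃ * f₃ t + x₄ * f₄ t)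
      = x₁ * (∫ t in T₀..T, f₁ t) + x₂ * (∫ t in T₀..T, f₂ t) + x₃ * (∫ t in T₀..T, f₃ t)
        + x₄ * ∫ t in T₀..T, f₄ t := by
  have i₁ := (h₁.intervalIntegrable_of_Icc (μ := volume) hT).const_mul x₁
  have i₂ := (h₂.intervalIntegrable_of_Icc (μ := volume) hT).const_mul x₂
  have i₃ := (h₃.intervalIntegrable_of_Icc (μ := volume) hT).const_mul x₃
  have i₄ := (h₄.intervalIntegrable_of_Icc (μ := volume) hT).const_mul x₄
  rw [intervalIntegral.integral_add ((i₁.add i₂).add i₃) i₄,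
    intervalIntegral.integral_add (i₁.add i₂) i₃, intervalIntegral.integral_add i₁ i₂]
  simp only [intervalIntegral.integral_const_mul]

end IntegralSplit

/-! ### Weighted energy and virial inequalities at one level -/

section EnergyLevel

/-- The differential inequalities satisfied by the energy `E`, the dissipation `D = ∫ a v_t²`, the
kinetic part `P = ∫ c v_t²`, the moments `V = ∫ a v²`, `X = ∫ c v_t v` and the source term
`G = ∫ g² / a` of a solution `v`. -/
structure EnergyLevel (T₀ T δ C₀ : ℝ) (E D P V X G : ℝ → ℝ) : Prop where
  cont_E : ContinuousOn E (Icc T₀ T)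
  cont_D : ContinuousOn D (Icc T₀ T)
  cont_V : ContinuousOn V (Icc T₀ T)
  cont_X : ContinuousOn X (Icc T₀ T)
  cont_G : ContinuousOn G (Icc T₀ T)
  D_nonneg : ∀ t ∈ Icc T₀ T, 0 ≤ D t
  P_nonneg : ∀ t ∈ Icc T₀ T, 0 ≤ P t
  V_nonneg : ∀ t ∈ Icc T₀ T, 0 ≤ V t
  G_nonneg : ∀ t ∈ Icc T₀ T, 0 ≤ G t
  P_le : ∀ t ∈ Icc T₀ T, P t ≤ 2 * E t
  deriv_E : ∀ t ∈ Ioo T₀ T, ∃ d, HasDerivAt E d t ∧ d ≤ -(1 / 2) * D t + (1 / 2) * G t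
  deriv_Z : ∀ t ∈ Ioo T₀ T, ∃ d, HasDerivAt (fun r => X r + (1 / 2) * V r) d t ∧
    ∀ l : ℝ, 0 < l → d ≤ 2 * P t - 2 * E t + (1 / 2) * (l⁻¹ * V t) + (1 / 2) * (l * G t)
  P_le_D : ∀ t ∈ Icc T₀ T, P t ≤ C₀ * (1 + t) ^ δ * D t
  X_le : ∀ t ∈ Icc T₀ T, |X t| ≤ (1 / 2) * V t + (1 / 2) * (C₀ * (1 + t) ^ δ * P t)

variable {T₀ T δ C₀ κ s K A : ℝ} {E D P V X G : ℝ → ℝ}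

theorem EnergyLevel.E_nonneg (h : EnergyLevel T₀ T δ C₀ E D P V X G) {t : ℝ}
    (ht : t ∈ Icc T₀ T) : 0 ≤ E t := by
  linarith [h.P_nonneg t ht, h.P_le t ht]

/-- Because `s ≤ 0`, the derivative of `(1 + t) ^ s` has a favourable sign and is dropped; only the
power of `κ + t` produces an error. -/
theorem EnergyLevel.weighted_energy (h : EnergyLevel T₀ T δ C₀ E D P V X G) (h₀ : 0 ≤ T₀)
    (hT : T₀ ≤ T) (hs : s ≤ 0) (hκ : 0 < κ + T₀) (i : ℕ) :
    weight κ s (i + 1) T * E T + (1 / 2) * ∫ t in T₀..T, weight κ s (i + 1) t * D t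
      ≤ weight κ s (i + 1) T₀ * E T₀ + (i + 1) * (∫ t in T₀..T, weight κ s i t * E t)
        + (1 / 2) * ∫ t in T₀..T, weight κ s (i + 1) t * G t := by
  have cw := fun i : ℕ => continuousOn_weight (κ := κ) (s := s) (T := T) i h₀
  have c1 := continuousOn_weight_mul (κ := κ) (s := s) i h₀ h.cont_E
  have c2 := continuousOn_weight_mul (κ := κ) (s := s) (i + 1) h₀ h.cont_D
  have c3 := continuousOn_weight_mul (κ := κ) (s := s) (i + 1) h₀ h.cont_G
  choose! d hd hd' using h.deriv_E
  have key := intervalIntegral.sub_le_integral_of_hasDeriv_right_of_le hT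
    (g := fun t => weight κ s (i + 1) t * E t)
    -- The summand with coefficient zero is padding, to fit the four-term `integral_combination`.
    (φ := fun t => (i + 1) * (weight κ s i t * E t) + (-(1 / 2)) * (weight κ s (i + 1) t * D t)
      + (1 / 2) * (weight κ s (i + 1) t * G t) + 0 * (weight κ s (i + 1) t * G t))
    ((cw (i + 1)).mul h.cont_E)
    (fun t ht => ((hasDerivAt_weight i (h₀.trans ht.1.le)).mul (hd t ht)).hasDerivWithinAt)
    (ContinuousOn.integrableOn_Icc ((((continuousOn_const.mul c1).add
      (continuousOn_const.mul c2)).add (continuousOn_const.mul c3)).add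
        (continuousOn_const.mul c3)))
    (fun t ht => by
      have ht' := Ioo_subset_Icc_self ht
      have ht0 : 0 ≤ t := h₀.trans ht.1.le
      have hκt : 0 < κ + t := by linarith [ht.1]
      have hw := weight_pos (κ := κ) (s := s) (i + 1) ht0 hκt
      have h1 : s * (weight κ s (i + 1) t / (1 + t)) * E t ≤ 0 :=
        mul_nonpos_of_nonpos_of_nonneg
          (mul_nonpos_of_nonpos_of_nonneg hs (div_nonneg hw.le (by linarith))) (h.E_nonneg ht')
      have h2 := mul_le_mul_of_nonneg_left (hd' t ht) hw.le
      linarith)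
  rw [integral_combination hT c1 c2 c3 c3] at key
  linarith

/-- Differentiating the weight costs one power. The moment `V` is kept at power `i`, using `κ + t ≤
K (1 + t)`. The factor `(1 + t) ^ δ` accompanying `P` restores the power `i + 1`, since it is at
most `1 + t` and at most `κ + t`. -/
theorem EnergyLevel.abs_deriv_weight_mul_le (h : EnergyLevel T₀ T δ C₀ E D P V X G)
    (h₀ : 0 ≤ T₀) (hC₀ : 0 ≤ C₀) (hδ : δ ≤ 1) (hK : 1 ≤ K) (hκ : 0 < κ + T₀)
    (hσ : ∀ t ∈ Icc T₀ T, (1 + t) ^ δ ≤ κ + t) (hσK : ∀ t ∈ Icc T₀ T, κ + t ≤ K * (1 + t))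
    (i : ℕ) {t : ℝ} (ht : t ∈ Icc T₀ T) :
    (s * (weight κ s (i + 1) t / (1 + t)) + (i + 1) * weight κ s i t) * (X t + (1 / 2) * V t)
      ≤ K * (|s| + i + 1) * (weight κ s i t * V t)
        + (1 / 2) * C₀ * (|s| + i + 1) * (weight κ s (i + 1) t * P t) := by
  have ht0 : 0 ≤ t := h₀.trans ht.1
  have h1t : 0 < 1 + t := by linarith
  have hκt : 0 < κ + t := by linarith [ht.1]
  have hw := (weight_pos (κ := κ) (s := s) i ht0 hκt).le
  have hw1 := (weight_pos (κ := κ) (s := s) (i + 1) ht0 hκt).le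
  have hV := h.V_nonneg t ht
  have hP := h.P_nonneg t ht
  have e1 : weight κ s (i + 1) t / (1 + t) ≤ K * weight κ s i t := by
    rw [div_le_iff₀ h1t, weight_succ]
    calc weight κ s i t * (κ + t) ≤ weight κ s i t * (K * (1 + t)) := by
          gcongr; exact hσK t ht
      _ = _ := by ring
  have e2 : (weight κ s (i + 1) t / (1 + t)) * (1 + t) ^ δ ≤ weight κ s (i + 1) t := by
    calc (weight κ s (i + 1) t / (1 + t)) * (1 + t) ^ δ
        ≤ (weight κ s (i + 1) t / (1 + t)) * (1 + t) ^ (1 : ℝ) := by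
          gcongr
          · linarith
      _ = _ := by rw [Real.rpow_one]; field_simp
  have e3 : weight κ s i t * (1 + t) ^ δ ≤ weight κ s (i + 1) t := by
    rw [weight_succ]
    gcongr
    exact hσ t ht
  have hd0 : 0 ≤ weight κ s (i + 1) t / (1 + t) := by positivity
  set w := weight κ s i t
  set w1 := weight κ s (i + 1) t
  set z := w1 / (1 + t)
  set r := (1 + t) ^ δ
  have hr : 0 ≤ r := by positivity
  have hZ : |X t + (1 / 2) * V t| ≤ V t + (1 / 2) * (C₀ * r * P t) := by
    refine (abs_add_le _ _).trans ?_
    rw [abs_of_nonneg (by positivity : 0 ≤ (1 / 2) * V t)]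
    linarith [h.X_le t ht]
  have hd : |s * z + (i + 1) * w| ≤ |s| * z + (i + 1) * w := by
    refine (abs_add_le _ _).trans (le_of_eq ?_)
    rw [abs_mul, abs_of_nonneg hd0, abs_of_nonneg (by positivity : 0 ≤ ((i : ℝ) + 1) * w)]
  have hs0 := abs_nonneg s
  calc (s * z + (i + 1) * w) * (X t + (1 / 2) * V t)
      ≤ |s * z + (i + 1) * w| * |X t + (1 / 2) * V t| := by rw [← abs_mul]; exact le_abs_self _
    _ ≤ (|s| * z + (i + 1) * w) * (V t + (1 / 2) * (C₀ * r * P t)) := by gcongr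
    _ = (|s| * z + (i + 1) * w) * V t
        + (1 / 2) * C₀ * (|s| * (z * r) + (i + 1) * (w * r)) * P t := by ring
    _ ≤ (|s| * (K * w) + (i + 1) * (K * w)) * V t
        + (1 / 2) * C₀ * (|s| * w1 + (i + 1) * w1) * P t := by
        gcongr
        exact le_mul_of_one_le_left hw hK
    _ = _ := by ring

/-- Integrate the derivative of the weighted `X + V/2`. Every `P` is traded for `D`, or for `E` at
the end points, at the price `C₀ (1 + t) ^ δ`, and `A (1 + t) ^ δ ≤ κ + t` turns this price into one
more power of `κ + t` and a factor `1 / A`, which makes these terms absorbable. At `T` the moment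
`V` has a favourable sign and drops out. -/
theorem EnergyLevel.weighted_virial (h : EnergyLevel T₀ T δ C₀ E D P V X G)
    (h₀ : 0 ≤ T₀) (hT : T₀ ≤ T) (hC₀ : 0 ≤ C₀) (hδ : δ ≤ 1) (hK : 1 ≤ K) (hA : 1 ≤ A)
    (hκ : 0 < κ + T₀) (hσ : ∀ t ∈ Icc T₀ T, A * (1 + t) ^ δ ≤ κ + t)
    (hσK : ∀ t ∈ Icc T₀ T, κ + t ≤ K * (1 + t)) (i : ℕ) :
    2 * (∫ t in T₀..T, weight κ s (i + 1) t * E t)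
      ≤ (2 + (1 / 2) * C₀ * (|s| + i + 1)) * C₀ / A * ((∫ t in T₀..T, weight κ s (i + 2) t * D t)
          + weight κ s (i + 2) T * E T)
        + weight κ s (i + 1) T₀ * V T₀ + C₀ * (weight κ s (i + 2) T₀ * E T₀)
        + (K * (|s| + i + 1) + 1 / 2) * (∫ t in T₀..T, weight κ s i t * V t)
        + (1 / 2) * ∫ t in T₀..T, weight κ s (i + 2) t * G t := by
  have cw := fun i : ℕ => continuousOn_weight (κ := κ) (s := s) (T := T) i h₀
  have hA0 : 0 < A := by linarith
  set M : ℝ := |s| + i + 1 with hM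
  have hM0 : 0 ≤ M := by positivity
  set L := (2 + (1 / 2) * C₀ * M) * C₀ / A with hL
  have hL0 : 0 ≤ L := by positivity
  have hσ1 : ∀ t ∈ Icc T₀ T, (1 + t) ^ δ ≤ κ + t := fun t ht => by
    refine le_trans ?_ (hσ t ht)
    have : 0 ≤ (1 + t) ^ δ := Real.rpow_nonneg (by linarith [ht.1]) _
    nlinarith
  have c1 := continuousOn_weight_mul (κ := κ) (s := s) (i + 1) h₀ h.cont_E
  have c2 := continuousOn_weight_mul (κ := κ) (s := s) (i + 2) h₀ h.cont_D
  have c3 := continuousOn_weight_mul (κ := κ) (s := s) i h₀ h.cont_V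
  have c4 := continuousOn_weight_mul (κ := κ) (s := s) (i + 2) h₀ h.cont_G
  have hwA : ∀ t ∈ Icc T₀ T, weight κ s (i + 1) t * (1 + t) ^ δ ≤ weight κ s (i + 2) t / A := by
    intro t ht
    rw [le_div_iff₀ hA0, weight_succ κ s (i + 1), mul_assoc, mul_comm ((1 + t) ^ δ)]
    have := weight_pos (κ := κ) (s := s) (i + 1) (h₀.trans ht.1) (by linarith [ht.1])
    gcongr
    exact hσ t ht
  choose! d hd hd' using h.deriv_Z
  have key := intervalIntegral.sub_le_integral_of_hasDeriv_right_of_le hT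
    (g := fun t => weight κ s (i + 1) t * (X t + (1 / 2) * V t))
    (φ := fun t => (-2) * (weight κ s (i + 1) t * E t) + L * (weight κ s (i + 2) t * D t)
      + (K * M + 1 / 2) * (weight κ s i t * V t) + (1 / 2) * (weight κ s (i + 2) t * G t))
    ((cw (i + 1)).mul (h.cont_X.add (continuousOn_const.mul h.cont_V)))
    (fun t ht => ((hasDerivAt_weight i (h₀.trans ht.1.le)).mul (hd t ht)).hasDerivWithinAt)
    (ContinuousOn.integrableOn_Icc ((((continuousOn_const.mul c1).add
      (continuousOn_const.mul c2)).add (continuousOn_const.mul c3)).add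
        (continuousOn_const.mul c4)))
    (fun t ht => by
      have ht' := Ioo_subset_Icc_self ht
      have ht0 : 0 ≤ t := h₀.trans ht.1.le
      have hκt : 0 < κ + t := by linarith [ht.1]
      have hw := weight_pos (κ := κ) (s := s) (i + 1) ht0 hκt
      have h1 := h.abs_deriv_weight_mul_le (s := s) h₀ hC₀ hδ hK hκ hσ1 hσK i ht'
      -- Young's inequality for the source with parameter `κ + t` lowers the weight of `V` by one
      -- power and raises that of `G` by one.
      have h2 := mul_le_mul_of_nonneg_left (hd' t ht (κ + t) hκt) hw.le
      have e1 : weight κ s (i + 1) t * ((κ + t)⁻¹ * V t) = weight κ s i t * V t := by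
        rw [weight_succ]
        field_simp
      have e2 : weight κ s (i + 1) t * ((κ + t) * G t) = weight κ s (i + 2) t * G t := by
        rw [weight_succ κ s (i + 1)]
        ring
      have e3 : weight κ s (i + 1) t * P t ≤ C₀ / A * (weight κ s (i + 2) t * D t) := by
        have hD := h.D_nonneg t ht'
        calc weight κ s (i + 1) t * P t
            ≤ weight κ s (i + 1) t * (C₀ * (1 + t) ^ δ * D t) := by
              gcongr
              exact h.P_le_D t ht'
          _ = C₀ * (weight κ s (i + 1) t * (1 + t) ^ δ) * D t := by ring
          _ ≤ C₀ * (weight κ s (i + 2) t / A) * D t := by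
              gcongr
              exact hwA t ht'
          _ = _ := by ring
      have e4 : (2 + (1 / 2) * C₀ * M) * (weight κ s (i + 1) t * P t)
          ≤ L * (weight κ s (i + 2) t * D t) := by
        calc _ ≤ (2 + (1 / 2) * C₀ * M) * (C₀ / A * (weight κ s (i + 2) t * D t)) := by gcongr
          _ = _ := by rw [hL]; ring
      linarith)
  rw [integral_combination hT c1 c2 c3 c4] at key
  have hT₀m : T₀ ∈ Icc T₀ T := ⟨le_rfl, hT⟩
  have hTm : T ∈ Icc T₀ T := ⟨hT, le_rfl⟩
  have hend : ∀ t ∈ Icc T₀ T, weight κ s (i + 1) t * ((1 / 2) * (C₀ * (1 + t) ^ δ * P t))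
      ≤ C₀ / A * (weight κ s (i + 2) t * E t) := by
    intro t ht
    have hE := h.E_nonneg ht
    have hw := (weight_pos (κ := κ) (s := s) (i + 1) (h₀.trans ht.1)
      (by linarith [ht.1])).le
    have hr : 0 ≤ (1 + t) ^ δ := Real.rpow_nonneg (by linarith [ht.1]) _
    calc _ ≤ weight κ s (i + 1) t * ((1 / 2) * (C₀ * (1 + t) ^ δ * (2 * E t))) := by
          gcongr
          exact h.P_le t ht
      _ = C₀ * (weight κ s (i + 1) t * (1 + t) ^ δ) * E t := by ring
      _ ≤ C₀ * (weight κ s (i + 2) t / A) * E t := by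
          gcongr
          exact hwA t ht
      _ = _ := by ring
  have hCL : C₀ / A ≤ L := by
    rw [hL, mul_div_assoc]
    refine le_mul_of_one_le_left (by positivity) ?_
    have : 0 ≤ (1 / 2) * C₀ * M := by positivity
    linarith
  have b1 : -(weight κ s (i + 1) T * (X T + (1 / 2) * V T)) ≤ L * (weight κ s (i + 2) T * E T) := by
    have hw := (weight_pos (κ := κ) (s := s) (i + 1) (h₀.trans hT) (by linarith)).le
    have hw2 := (weight_pos (κ := κ) (s := s) (i + 2) (h₀.trans hT) (by linarith)).le
    have hE := h.E_nonneg hTm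
    calc _ = weight κ s (i + 1) T * (-(X T) - (1 / 2) * V T) := by ring
      _ ≤ weight κ s (i + 1) T * ((1 / 2) * (C₀ * (1 + T) ^ δ * P T)) := by
          gcongr
          linarith [h.X_le T hTm, neg_abs_le (X T)]
      _ ≤ C₀ / A * (weight κ s (i + 2) T * E T) := hend T hTm
      _ ≤ _ := by gcongr
  have b2 : weight κ s (i + 1) T₀ * (X T₀ + (1 / 2) * V T₀)
      ≤ weight κ s (i + 1) T₀ * V T₀ + C₀ * (weight κ s (i + 2) T₀ * E T₀) := by
    have hw := (weight_pos (κ := κ) (s := s) (i + 1) h₀ hκ).le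
    have hw2 := (weight_pos (κ := κ) (s := s) (i + 2) h₀ hκ).le
    have hE := h.E_nonneg hT₀m
    calc _ ≤ weight κ s (i + 1) T₀ * (V T₀ + (1 / 2) * (C₀ * (1 + T₀) ^ δ * P T₀)) :=
          mul_le_mul_of_nonneg_left (by linarith [h.X_le T₀ hT₀m, le_abs_self (X T₀)]) hw
      _ = weight κ s (i + 1) T₀ * V T₀
          + weight κ s (i + 1) T₀ * ((1 / 2) * (C₀ * (1 + T₀) ^ δ * P T₀)) := by ring
      _ ≤ weight κ s (i + 1) T₀ * V T₀ + C₀ / A * (weight κ s (i + 2) T₀ * E T₀) :=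
          add_le_add le_rfl (hend T₀ hT₀m)
      _ ≤ _ := by
          gcongr
          exact div_le_self hC₀ hA
  linarith

end EnergyLevel

/-! ### Induction over the time derivatives -/

section EnergyTower

/-- The exponent-`δ` growth is dominated by linear growth with slope one. -/
theorem exists_mul_rpow_le_add {δ : ℝ} (hδ0 : 0 < δ) (hδ1 : δ < 1) {A : ℝ} (hA : 0 < A) :
    ∃ K : ℝ, 0 ≤ K ∧ ∀ y : ℝ, 0 ≤ y → A * y ^ δ ≤ y + K := by
  -- The positive solution of `A y ^ δ = y`, beyond which the linear term dominates.
  set B : ℝ := A ^ (1 / (1 - δ)) with hB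
  have hB0 : 0 < B := Real.rpow_pos_of_pos hA _
  refine ⟨A * B ^ δ, by positivity, fun y hy => ?_⟩
  rcases le_total y B with h | h
  · have : A * y ^ δ ≤ A * B ^ δ := by gcongr
    linarith
  · have hy0 : 0 < y := hB0.trans_le h
    have h1 : A ≤ y ^ (1 - δ) := by
      calc A = B ^ (1 - δ) := by
            rw [hB, ← Real.rpow_mul hA.le, one_div_mul_cancel (by linarith), Real.rpow_one]
        _ ≤ y ^ (1 - δ) := Real.rpow_le_rpow hB0.le h (by linarith)
    have h2 : A * y ^ δ ≤ y := by
      calc A * y ^ δ ≤ y ^ (1 - δ) * y ^ δ := by gcongr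
        _ = y := by rw [← Real.rpow_add hy0, sub_add_cancel, Real.rpow_one]
    have : 0 ≤ A * B ^ δ := by positivity
    linarith

/-- A sequence of energy levels in which the moment `V (j + 1)` is the dissipation `D j`, with data
controlled by `B`. -/
structure EnergyTower (k : ℕ) (T₀ T δ C₀ θ μ B : ℝ) (E D P V X G : ℕ → ℝ → ℝ) : Prop where
  level : ∀ j ≤ k, EnergyLevel T₀ T δ C₀ (E j) (D j) (P j) (V j) (X j) (G j)
  V_succ : ∀ j < k, ∀ t ∈ Icc T₀ T, V (j + 1) t = D j t
  D_le : ∀ j ≤ k, D j T₀ ≤ C₀ * (1 + T₀) ^ μ * P j T₀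
  initial_le : ∀ j ≤ k, (1 + T₀) ^ (θ + δ) * E j T₀ ≤ B
  energy_le : ∫ t in T₀..T, (1 + t) ^ θ * E 0 t ≤ B
  source_le : ∀ j ≤ k, ∫ t in T₀..T, (1 + t) ^ (θ + 1 + 2 * j) * G j t ≤ B

variable {k : ℕ} {T₀ T δ C₀ θ μ B κ s K A : ℝ} {E D P V X G : ℕ → ℝ → ℝ}

theorem EnergyTower.nonneg (h : EnergyTower k T₀ T δ C₀ θ μ B E D P V X G) (h₀ : 0 ≤ T₀)
    (hT : T₀ ≤ T) : 0 ≤ B := by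
  refine le_trans (mul_nonneg (Real.rpow_nonneg (by linarith) _) ?_) (h.initial_le 0 (Nat.zero_le _))
  exact (h.level 0 (Nat.zero_le _)).E_nonneg ⟨le_rfl, hT⟩

theorem weight_le (hκ : 0 < κ + T₀)
    (hσK : ∀ t ∈ Icc T₀ T, κ + t ≤ K * (1 + t)) (h₀ : 0 ≤ T₀) (N m : ℕ) {t : ℝ}
    (ht : t ∈ Icc T₀ T) :
    weight κ (θ - N) (N + m) t ≤ K ^ (N + m) * (1 + t) ^ (θ + m) := by
  have h1 : 0 < 1 + t := by linarith [ht.1]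
  have h2 : 0 < κ + t := by linarith [ht.1]
  calc weight κ (θ - N) (N + m) t ≤ (1 + t) ^ (θ - N) * (K * (1 + t)) ^ (N + m) := by
        unfold weight
        gcongr
        exact hσK t ht
    _ = K ^ (N + m) * ((1 + t) ^ (θ - N) * (1 + t) ^ ((N + m : ℕ) : ℝ)) := by
        rw [mul_pow, Real.rpow_natCast]
        ring
    _ = _ := by
        rw [← Real.rpow_add h1]
        congr 2
        push_cast
        ring

/-- At `T₀` each factor `κ + t` has size `(1 + T₀) ^ δ` only, so the `N` factors that compensate `(1
+ t) ^ (-N)` leave a gain `(1 + T₀) ^ (-N (1 - δ))`. A large `N` thus pays for any fixed power of `1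
+ T₀`. -/
theorem weight_initial_le (hK : 0 ≤ K) (h₀ : 0 ≤ T₀) (hκ : κ + T₀ = K * (1 + T₀) ^ δ) (N m : ℕ)
    {ρ : ℝ} (hρ : θ - N + δ * (N + m) ≤ ρ) :
    weight κ (θ - N) (N + m) T₀ ≤ K ^ (N + m) * (1 + T₀) ^ ρ := by
  have h1 : 0 < 1 + T₀ := by linarith
  calc weight κ (θ - N) (N + m) T₀
      = K ^ (N + m) * ((1 + T₀) ^ (θ - N) * (1 + T₀) ^ (δ * ((N + m : ℕ) : ℝ))) := by
        rw [weight, hκ, mul_pow, Real.rpow_mul h1.le, Real.rpow_natCast]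
        ring
    _ = K ^ (N + m) * (1 + T₀) ^ (θ - N + δ * (N + m)) := by
        rw [← Real.rpow_add h1]
        push_cast
        rfl
    _ ≤ _ := by
        gcongr
        linarith

theorem EnergyTower.integral_weight_source_le (h : EnergyTower k T₀ T δ C₀ θ μ B E D P V X G)
    (h₀ : 0 ≤ T₀) (hT : T₀ ≤ T) (hK : 1 ≤ K) (hκ : 0 < κ + T₀)
    (hσK : ∀ t ∈ Icc T₀ T, κ + t ≤ K * (1 + t)) (N : ℕ) {j : ℕ} (hj : j ≤ k) :
    ∫ t in T₀..T, weight κ (θ - N) (N + 2 * j + 1) t * G j t ≤ K ^ (N + 2 * j + 1) * B := by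
  have hG := (h.level j hj).cont_G
  calc ∫ t in T₀..T, weight κ (θ - N) (N + 2 * j + 1) t * G j t
      ≤ ∫ t in T₀..T, K ^ (N + 2 * j + 1) * ((1 + t) ^ (θ + 1 + 2 * j) * G j t) := by
        refine intervalIntegral.integral_mono_on hT ?_ ?_ fun t ht => ?_
        · exact (continuousOn_weight_mul _ h₀ hG).intervalIntegrable_of_Icc hT
        · refine ContinuousOn.intervalIntegrable_of_Icc hT (continuousOn_const.mul (.mul ?_ hG))
          exact ContinuousOn.rpow_const (by fun_prop) fun t ht => Or.inl (by linarith [ht.1])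
        · rw [← mul_assoc]
          refine mul_le_mul_of_nonneg_right ?_ ((h.level j hj).G_nonneg t ht)
          have := weight_le (θ := θ) hκ hσK h₀ N (2 * j + 1) ht
          rw [show θ + 1 + 2 * (j : ℝ) = θ + ((2 * j + 1 : ℕ) : ℝ) by push_cast; ring]
          exact this
    _ ≤ _ := by
        rw [intervalIntegral.integral_const_mul]
        gcongr
        exact h.source_le j hj

theorem EnergyTower.integral_weight_energy_le (h : EnergyTower k T₀ T δ C₀ θ μ B E D P V X G)
    (h₀ : 0 ≤ T₀) (hT : T₀ ≤ T) (hK : 1 ≤ K) (hκ : 0 < κ + T₀)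
    (hσK : ∀ t ∈ Icc T₀ T, κ + t ≤ K * (1 + t)) (N : ℕ) :
    ∫ t in T₀..T, weight κ (θ - N) N t * E 0 t ≤ K ^ N * B := by
  have hE := (h.level 0 (Nat.zero_le _)).cont_E
  calc ∫ t in T₀..T, weight κ (θ - N) N t * E 0 t
      ≤ ∫ t in T₀..T, K ^ N * ((1 + t) ^ θ * E 0 t) := by
        refine intervalIntegral.integral_mono_on hT ?_ ?_ fun t ht => ?_
        · exact (continuousOn_weight_mul _ h₀ hE).intervalIntegrable_of_Icc hT
        · refine ContinuousOn.intervalIntegrable_of_Icc hT (continuousOn_const.mul (.mul ?_ hE))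
          exact ContinuousOn.rpow_const (by fun_prop) fun t ht => Or.inl (by linarith [ht.1])
        · rw [← mul_assoc]
          refine mul_le_mul_of_nonneg_right ?_ ((h.level 0 (Nat.zero_le _)).E_nonneg ht)
          simpa using weight_le (θ := θ) hκ hσK h₀ N 0 ht
    _ ≤ _ := by
        rw [intervalIntegral.integral_const_mul]
        gcongr
        exact h.energy_le

/-- The weighted energy estimate for all levels of the tower. -/
theorem EnergyTower.exists_weighted_bound (hδ : 0 ≤ δ) (hδ1 : δ ≤ 1) (hC₀ : 0 ≤ C₀) (hμ : 0 ≤ μ)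
    (hK : 1 ≤ K) (hA : 1 ≤ A) {N : ℕ} (hs : θ ≤ N) (hN : 2 * k * δ + μ ≤ N * (1 - δ))
    (hA' : 2 * (N + 2 * k + 1) * ((2 + (1 / 2) * C₀ * (|θ - N| + N + 2 * k + 1)) * C₀) ≤ A)
    {j : ℕ} (hj : j ≤ k) :
    ∃ C : ℝ, 0 ≤ C ∧ ∀ (T₀ T κ B : ℝ) (E D P V X G : ℕ → ℝ → ℝ), 0 ≤ T₀ → T₀ ≤ T →
      κ + T₀ = K * (1 + T₀) ^ δ → (∀ t ∈ Icc T₀ T, A * (1 + t) ^ δ ≤ κ + t) →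
      (∀ t ∈ Icc T₀ T, κ + t ≤ K * (1 + t)) →
      EnergyTower k T₀ T δ C₀ θ μ B E D P V X G →
      weight κ (θ - N) (N + 2 * j + 1) T * E j T
        + ∫ t in T₀..T, weight κ (θ - N) (N + 2 * j + 1) t * D j t ≤ C * B := by
  have hNδ : ∀ j ≤ k, θ - N + δ * (N + 2 * j) + μ ≤ θ := fun j hj => by
    have : (j : ℝ) ≤ k := by exact_mod_cast hj
    nlinarith
  have hK0 : 0 ≤ K := by linarith
  -- The common part of the estimate at each level.
  have common : ∀ j ≤ k, ∀ (T₀ T κ B : ℝ) (E D P V X G : ℕ → ℝ → ℝ), 0 ≤ T₀ → T₀ ≤ T →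
      κ + T₀ = K * (1 + T₀) ^ δ → (∀ t ∈ Icc T₀ T, κ + t ≤ K * (1 + t)) →
      EnergyTower k T₀ T δ C₀ θ μ B E D P V X G →
      0 < κ + T₀ ∧
      weight κ (θ - N) (N + 2 * j + 1) T₀ * E j T₀ ≤ K ^ (N + 2 * j + 1) * B ∧
      weight κ (θ - N) (N + 2 * j + 1) T * E j T
        + (1 / 2) * ∫ t in T₀..T, weight κ (θ - N) (N + 2 * j + 1) t * D j t
      ≤ (3 / 2) * K ^ (N + 2 * j + 1) * B
        + (N + 2 * j + 1) * ∫ t in T₀..T, weight κ (θ - N) (N + 2 * j) t * E j t := by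
    intro j hj T₀ T κ B E D P V X G h₀ hT hκ hσK h
    have hκ0 : 0 < κ + T₀ := by
      rw [hκ]
      have : 0 < (1 + T₀) ^ δ := Real.rpow_pos_of_pos (by linarith) _
      positivity
    have e1 := (h.level j hj).weighted_energy h₀ hT (s := θ - N) (by linarith) hκ0 (N + 2 * j)
    have e2 := h.integral_weight_source_le h₀ hT hK hκ0 hσK N hj
    have e3 : weight κ (θ - N) (N + 2 * j + 1) T₀ * E j T₀ ≤ K ^ (N + 2 * j + 1) * B := by
      have hE := (h.level j hj).E_nonneg ⟨le_rfl, hT⟩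
      have hw := weight_initial_le (θ := θ) (ρ := θ + δ) hK0 h₀ hκ N (2 * j + 1) (by
        push_cast
        linarith [hNδ j hj])
      calc _ ≤ K ^ (N + 2 * j + 1) * (1 + T₀) ^ (θ + δ) * E j T₀ :=
            mul_le_mul_of_nonneg_right hw hE
        _ ≤ _ := by
            rw [mul_assoc]
            gcongr
            exact h.initial_le j hj
    refine ⟨hκ0, e3, ?_⟩
    push_cast at e1
    linarith
  induction j with
  | zero =>
    refine ⟨2 * ((3 / 2) * K ^ (N + 1) + (N + 1) * K ^ N), by positivity, ?_⟩
    intro T₀ T κ B E D P V X G h₀ hT hκ hσ hσK h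
    obtain ⟨hκ0, -, e1⟩ := common 0 hj T₀ T κ B E D P V X G h₀ hT hκ hσK h
    have e2 := h.integral_weight_energy_le h₀ hT hK hκ0 hσK N
    have hw := (weight_pos (κ := κ) (s := θ - N) (N + 1) (h₀.trans hT) (by linarith)).le
    have hE := mul_nonneg hw ((h.level 0 hj).E_nonneg ⟨hT, le_rfl⟩)
    have e3 := mul_le_mul_of_nonneg_left e2 (by positivity : (0 : ℝ) ≤ N + 1)
    simp only [Nat.cast_zero, mul_zero, add_zero] at e1 ⊢
    linarith
  | succ j ih =>
    obtain ⟨C, hC, ih⟩ := ih (by omega)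
    set M : ℝ := N + 2 * (j + 1) + 1 with hM
    have hM0 : 0 ≤ M := by positivity
    set m : ℕ := N + 2 * j + 1 with hm
    set F : ℝ := K * (|θ - N| + m + 1) + 1 / 2 with hF
    have hF0 : 0 ≤ F := by positivity
    refine ⟨4 * ((3 / 2) * K ^ (m + 2) + M / 2 * (2 * C₀ * K ^ (m + 1) + C₀ * K ^ (m + 2) + F * C
      + (1 / 2) * K ^ (m + 2))), by positivity, ?_⟩
    intro T₀ T κ B E D P V X G h₀ hT hκ hσ hσK h
    obtain ⟨hκ0, e0, e1⟩ := common (j + 1) hj T₀ T κ B E D P V X G h₀ hT hκ hσK h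
    have hj' : j ≤ k := by omega
    have hlev := h.level (j + 1) hj
    have e2 := hlev.weighted_virial (s := θ - N) h₀ hT hC₀ hδ1 hK hA hκ0 hσ hσK m
    have e3 := ih T₀ T κ B E D P V X G h₀ hT hκ hσ hσK h
    have e4 := h.integral_weight_source_le h₀ hT hK hκ0 hσK N hj
    have hT₀m : T₀ ∈ Icc T₀ T := ⟨le_rfl, hT⟩
    -- The initial moment is `D j T₀`, which exceeds the energy by at most a multiple of `(1 + T₀) ^
    -- μ`; the choice of `N` compensates this loss.
    have e5 : weight κ (θ - N) (m + 1) T₀ * V (j + 1) T₀ ≤ 2 * C₀ * K ^ (m + 1) * B := by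
      have hE := (h.level j hj').E_nonneg hT₀m
      have hw := weight_initial_le (θ := θ) (ρ := θ - μ) hK0 h₀ hκ N (2 * (j + 1)) (by
        have := hNδ (j + 1) hj
        push_cast at this ⊢
        linarith)
      have hVn := hlev.V_nonneg T₀ hT₀m
      have h1 : 0 < 1 + T₀ := by linarith
      calc weight κ (θ - N) (m + 1) T₀ * V (j + 1) T₀
          ≤ K ^ (m + 1) * (1 + T₀) ^ (θ - μ) * V (j + 1) T₀ := by
            gcongr
            exact hw
        _ ≤ K ^ (m + 1) * (1 + T₀) ^ (θ - μ) * (C₀ * (1 + T₀) ^ μ * (2 * E j T₀)) := by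
            gcongr
            rw [h.V_succ j (by omega) T₀ hT₀m]
            refine (h.D_le j hj').trans ?_
            gcongr
            exact (h.level j hj').P_le T₀ hT₀m
        _ = 2 * C₀ * K ^ (m + 1) * ((1 + T₀) ^ (θ - μ) * (1 + T₀) ^ μ * E j T₀) := by ring
        _ = 2 * C₀ * K ^ (m + 1) * ((1 + T₀) ^ θ * E j T₀) := by
            rw [← Real.rpow_add h1, sub_add_cancel]
        _ ≤ 2 * C₀ * K ^ (m + 1) * ((1 + T₀) ^ (θ + δ) * E j T₀) := by
            gcongr <;> linarith
        _ ≤ _ := by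
            gcongr
            exact h.initial_le j hj'
    -- The moment at level `j + 1` is the dissipation at level `j`, and `m = N + 2j + 1` is exactly
    -- the power at which the induction hypothesis controls it.
    have e6 : ∫ t in T₀..T, weight κ (θ - N) m t * V (j + 1) t ≤ C * B := by
      have hw := (weight_pos (κ := κ) (s := θ - N) m (h₀.trans hT) (by linarith)).le
      have hE := mul_nonneg hw ((h.level j hj').E_nonneg ⟨hT, le_rfl⟩)
      have : ∫ t in T₀..T, weight κ (θ - N) m t * V (j + 1) t
          = ∫ t in T₀..T, weight κ (θ - N) m t * D j t := by
        refine intervalIntegral.integral_congr fun t ht => ?_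
        rw [uIcc_of_le hT] at ht
        simp only [h.V_succ j (by omega) t ht]
      rw [this]
      linarith
    have hnn : 0 ≤ (∫ t in T₀..T, weight κ (θ - N) (m + 2) t * D (j + 1) t)
        + weight κ (θ - N) (m + 2) T * E (j + 1) T := by
      refine add_nonneg (intervalIntegral.integral_nonneg hT fun t ht => ?_) ?_
      · exact mul_nonneg (weight_pos _ (h₀.trans ht.1) (by linarith [ht.1])).le
          (hlev.D_nonneg t ht)
      · exact mul_nonneg (weight_pos _ (h₀.trans hT) (by linarith)).le
          (hlev.E_nonneg ⟨hT, le_rfl⟩)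
    -- The size of `A` enters here: one quarter can be absorbed by the coefficients `1/2` of `∫ D`
    -- and `1` of `E` on the left, leaving at least a quarter of each and hence the factor `4` in
    -- the constant.
    have e7 : M / 2 * ((2 + (1 / 2) * C₀ * (|θ - N| + m + 1)) * C₀ / A) ≤ 1 / 4 := by
      have hA0 : 0 < A := by linarith
      have hjk : (j : ℝ) + 1 ≤ k := by exact_mod_cast hj
      rw [← mul_div_assoc, div_le_iff₀ hA0]
      have hm' : (m : ℝ) = N + 2 * j + 1 := by rw [hm]; push_cast; ring
      have hM' : M ≤ N + 2 * k + 1 := by linarith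
      have mono : ∀ y z : ℝ, 0 ≤ y → y ≤ z → M * ((2 + (1 / 2) * C₀ * y) * C₀)
          ≤ (N + 2 * k + 1) * ((2 + (1 / 2) * C₀ * z) * C₀) := fun y z hy hyz => by gcongr
      have := mono (|θ - N| + m + 1) (|θ - N| + N + 2 * k + 1) (by positivity) (by linarith)
      linarith
    have e8 := mul_le_mul_of_nonneg_right e7 hnn
    have e9 := mul_le_mul_of_nonneg_left e6 hF0
    have e10 := mul_le_mul_of_nonneg_left e0 hC₀
    have e11 : (∫ t in T₀..T, weight κ (θ - N) (m + 1) t * E (j + 1) t) ≤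
        (1 / 2) * ((2 + (1 / 2) * C₀ * (|θ - N| + m + 1)) * C₀ / A *
          ((∫ t in T₀..T, weight κ (θ - N) (m + 2) t * D (j + 1) t)
            + weight κ (θ - N) (m + 2) T * E (j + 1) T))
        + (1 / 2) * ((2 * C₀ * K ^ (m + 1) + C₀ * K ^ (m + 2) + F * C
          + (1 / 2) * K ^ (m + 2)) * B) := by
      have hidx : N + 2 * (j + 1) + 1 = m + 2 := by omega
      rw [hidx] at e10 e4
      rw [← hF] at e2
      linarith
    have e12 := mul_le_mul_of_nonneg_left e11 hM0
    have hidx : N + 2 * (j + 1) + 1 = m + 2 := by omega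
    have hidx' : N + 2 * (j + 1) = m + 1 := by omega
    rw [hidx'] at e1 ⊢
    push_cast at e1
    rw [← hM] at e1
    have hw := (weight_pos (κ := κ) (s := θ - N) (m + 2) (h₀.trans hT) (by linarith)).le
    have hE := mul_nonneg hw (hlev.E_nonneg ⟨hT, le_rfl⟩)
    show weight κ (θ - N) (m + 2) T * E (j + 1) T
      + ∫ t in T₀..T, weight κ (θ - N) (m + 2) t * D (j + 1) t ≤ _
    linarith

/-- Decay of the top energy of an energy tower. -/
theorem EnergyTower.exists_decay (k : ℕ) (hδ : 0 < δ) (hδ1 : δ < 1) (hC₀ : 0 ≤ C₀) (hμ : 0 ≤ μ)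
    (θ : ℝ) :
    ∃ (p : ℕ) (C : ℝ), 0 < C ∧ ∀ (T₀ T B Λ : ℝ) (E D P V X G : ℕ → ℝ → ℝ), 0 ≤ T₀ → T₀ ≤ T →
      0 < Λ → 1 + T ≤ Λ * (1 + T - T₀) → EnergyTower k T₀ T δ C₀ θ μ B E D P V X G →
      E k T ≤ C * Λ ^ p * ((1 + T) ^ (-θ - 2 * k - 1) * B) := by
  -- The first bound makes the exponent `θ - N` nonpositive; the second controls the initial weights
  -- at all levels up to `k`, including the loss `μ`.
  obtain ⟨N, hN⟩ := exists_nat_ge (max θ ((2 * k * δ + μ) / (1 - δ)))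
  have hs : θ ≤ N := (le_max_left _ _).trans hN
  have hN' : 2 * k * δ + μ ≤ N * (1 - δ) := by
    rw [← div_le_iff₀ (by linarith)]
    exact (le_max_right _ _).trans hN
  set A : ℝ := max 1 (2 * (N + 2 * k + 1) *
    ((2 + (1 / 2) * C₀ * (|θ - N| + N + 2 * k + 1)) * C₀)) with hAdef
  have hA : 1 ≤ A := le_max_left _ _
  obtain ⟨K', hK', hAK⟩ := exists_mul_rpow_le_add hδ hδ1 (by linarith : 0 < A)
  set K : ℝ := A + K' with hKdef
  have hK : 1 ≤ K := by linarith
  obtain ⟨C, hC, hmain⟩ := EnergyTower.exists_weighted_bound (θ := θ) (k := k) hδ.le hδ1.le hC₀ hμ hK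
    hA hs hN' (le_max_right _ _) (le_refl k)
  refine ⟨N + 2 * k + 1, C + 1, by linarith, ?_⟩
  intro T₀ T B Λ E D P V X G h₀ hT hΛ hTΛ h
  have hB := h.nonneg h₀ hT
  have hp : ∀ t ∈ Icc T₀ T, (1 + t) ^ δ ≤ (1 + T₀) ^ δ + (t - T₀) ^ δ := fun t ht => by
    have := Real.rpow_add_le_add_rpow (by linarith : (0 : ℝ) ≤ 1 + T₀)
      (by linarith [ht.1] : 0 ≤ t - T₀) hδ.le hδ1.le
    rwa [show 1 + T₀ + (t - T₀) = 1 + t by ring] at this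
  have h1 : 1 ≤ (1 + T₀) ^ δ := Real.one_le_rpow (by linarith) hδ.le
  have h2 : (1 + T₀) ^ δ ≤ 1 + T₀ := by
    calc (1 + T₀) ^ δ ≤ (1 + T₀) ^ (1 : ℝ) :=
          Real.rpow_le_rpow_of_exponent_le (by linarith) hδ1.le
      _ = _ := Real.rpow_one _
  -- By subadditivity of `y ↦ y ^ δ`, `A (1 + t) ^ δ ≤ A (1 + T₀) ^ δ + (t - T₀) + K'`, and this is
  -- at most `κ + t` because `K = A + K'`.
  set κ : ℝ := K * (1 + T₀) ^ δ - T₀ with hκ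
  have e := hmain T₀ T κ B E D P V X G h₀ hT (by rw [hκ]; ring)
    (fun t ht => by
      have a1 := mul_le_mul_of_nonneg_left (hp t ht) (by linarith : 0 ≤ A)
      have a2 := hAK (t - T₀) (by linarith [ht.1])
      have a3 := mul_le_mul_of_nonneg_left h1 hK'
      rw [hκ, hKdef]
      linarith)
    (fun t ht => by
      have a1 := mul_le_mul_of_nonneg_left h2 (by linarith : 0 ≤ K)
      have a2 : t - T₀ ≤ K * (t - T₀) := le_mul_of_one_le_left (by linarith [ht.1]) hK
      rw [hκ]
      linarith) h
  have hT0 : 0 < 1 + T := by linarith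
  have hκT : 1 + T - T₀ ≤ κ + T := by
    have := one_le_mul_of_one_le_of_one_le hK h1
    rw [hκ]
    linarith
  have hTT : 0 < 1 + T - T₀ := by linarith
  have hEk := (h.level k le_rfl).E_nonneg ⟨hT, le_rfl⟩
  have hint : 0 ≤ ∫ t in T₀..T, weight κ (θ - N) (N + 2 * k + 1) t * D k t :=
    intervalIntegral.integral_nonneg hT fun t ht =>
      mul_nonneg (weight_pos _ (h₀.trans ht.1) (by
        have := one_le_mul_of_one_le_of_one_le hK h1
        rw [hκ]
        linarith [ht.1])).le ((h.level k le_rfl).D_nonneg t ht)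
  -- Here `1 + T ≤ Λ (1 + T - T₀) ≤ Λ (κ + T)`, so every factor `κ + T` is comparable to `1 + T`.
  have hw : (1 + T) ^ (θ + 2 * k + 1) ≤ Λ ^ (N + 2 * k + 1) * weight κ (θ - N) (N + 2 * k + 1) T := by
    calc (1 + T) ^ (θ + 2 * k + 1)
        = (1 + T) ^ (θ - N) * (1 + T) ^ (N + 2 * k + 1) := by
          rw [← Real.rpow_natCast, ← Real.rpow_add hT0]
          congr 1
          push_cast
          ring
      _ ≤ (1 + T) ^ (θ - N) * (Λ * (κ + T)) ^ (N + 2 * k + 1) := by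
          gcongr
          exact hTΛ.trans (by gcongr)
      _ = _ := by
          rw [weight, mul_pow]
          ring
  have hfin : (1 + T) ^ (θ + 2 * k + 1) * E k T ≤ Λ ^ (N + 2 * k + 1) * ((C + 1) * B) := by
    calc _ ≤ Λ ^ (N + 2 * k + 1) * weight κ (θ - N) (N + 2 * k + 1) T * E k T := by gcongr
      _ = Λ ^ (N + 2 * k + 1) * (weight κ (θ - N) (N + 2 * k + 1) T * E k T) := by ring
      _ ≤ _ := mul_le_mul_of_nonneg_left (by linarith) (by positivity)
  rw [show -θ - 2 * (k : ℝ) - 1 = -(θ + 2 * k + 1) by ring, Real.rpow_neg hT0.le]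
  have hpos : 0 < (1 + T) ^ (θ + 2 * k + 1) := Real.rpow_pos_of_pos hT0 _
  calc E k T = ((1 + T) ^ (θ + 2 * k + 1))⁻¹ * ((1 + T) ^ (θ + 2 * k + 1) * E k T) := by
        field_simp
    _ ≤ ((1 + T) ^ (θ + 2 * k + 1))⁻¹ * (Λ ^ (N + 2 * k + 1) * ((C + 1) * B)) := by gcongr
    _ = _ := by ring

end EnergyTower

open scoped Gradient

/-! ### Removing the cutoff for compactly supported functions -/

section CutoffForms

variable {n : ℕ} {r : ℝ} {χ m : Rn n → ℝ}

theorem wForm_mul_cutoff (hχ : IsCc χ) (h1 : ∀ x, ‖x‖ ≤ r → χ x = 1) (hm : Continuous m)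
    {f : L2 n} (hf : VanishesOn {x | r < ‖x‖} f) (g : L2 n) :
    wForm (fun x => m x * χ x) f g = ∫ x, m x * (f x * g x) := by
  rw [wForm_apply_real (hχ.mul_left hm)]
  refine integral_congr_ae ?_
  filter_upwards [hf] with x hx
  rcases le_or_gt ‖x‖ r with h | h
  · rw [h1 x h, mul_one]
  · rw [hx h]
    ring

theorem integrable_mul_of_vanishesOn (hm : Continuous m) {f : L2 n}
    (hf : VanishesOn {x | r < ‖x‖} f) (g : L2 n) : Integrable fun x => m x * (f x * g x) := by
  obtain ⟨χ, hχ, hχc, -, -, h1, -⟩ := exists_cutoff (n := n) r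
  have i : IsCc fun x => m x * χ x := (IsCc.mk hχ.continuous hχc).mul_left hm
  refine (integrable_wForm_real i f g).congr ?_
  filter_upwards [hf] with x hx
  rcases le_or_gt ‖x‖ r with h | h
  · rw [h1 x h, mul_one]
  · rw [hx h]
    ring

theorem integral_mul_self_le {m' : Rn n → ℝ} (hm : Continuous m) (hm' : Continuous m')
    {f : L2 n} (hf : VanishesOn {x | r < ‖x‖} f) {S : Set (Rn n)} (hS : VanishesOn S f) {C : ℝ}
    (h : ∀ x ∉ S, m x ≤ C * m' x) :
    ∫ x, m x * (f x * f x) ≤ C * ∫ x, m' x * (f x * f x) := by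
  rw [← integral_const_mul]
  refine integral_mono_ae (integrable_mul_of_vanishesOn hm hf _)
    ((integrable_mul_of_vanishesOn hm' hf _).const_mul _) ?_
  filter_upwards [hS] with x hx
  by_cases hxS : x ∈ S
  · rw [hx hxS]
    simp
  · have := mul_le_mul_of_nonneg_right (h x hxS) (mul_self_nonneg (f x))
    linarith

theorem wForm_cutoff (hχ : IsCc χ) (h1 : ∀ x, ‖x‖ ≤ r → χ x = 1)
    {f : L2 n} (hf : VanishesOn {x | r < ‖x‖} f) (g : L2 n) :
    wForm χ f g = ∫ x, f x * g x := by
  have := wForm_mul_cutoff hχ h1 (m := fun _ => 1) continuous_const hf g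
  simpa using this

theorem localEnergy_cutoff {b c : Rn n → ℝ} (hb : Continuous b) (hc : Continuous c) (hχ : IsCc χ)
    (h1 : ∀ x, ‖x‖ ≤ r → χ x = 1) {p : L2 n} {g : L2Vec n} (hp : VanishesOn {x | r < ‖x‖} p)
    (hg : VanishesOn {x | r < ‖x‖} g) :
    localEnergy b c χ p g = (1 / 2) * ∫ x, (c x * p x ^ 2 + b x * ‖g x‖ ^ 2) := by
  rw [localEnergy_eq hb hc hχ, ← integral_const_mul]
  refine integral_congr_ae ?_
  filter_upwards [hp, hg] with x hx hx'
  rcases le_or_gt ‖x‖ r with h | h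
  · rw [h1 x h, one_mul]
  · rw [hx h, hx' h]
    simp

theorem localEnergy_cutoff_eq_add {b c : Rn n → ℝ} (hc : Continuous c) (hχ : IsCc χ)
    (h1 : ∀ x, ‖x‖ ≤ r → χ x = 1) {p : L2 n} (hp : VanishesOn {x | r < ‖x‖} p) (g : L2Vec n) :
    2 * localEnergy b c χ p g
      = (∫ x, c x * (p x * p x)) + wForm (fun x => b x * χ x) g g := by
  rw [localEnergy, wForm_mul_cutoff hχ h1 hc hp]
  ring

theorem vForm_gradient_cutoff {b : Rn n → ℝ} (hb : Continuous b) (hχ : ContDiff ℝ 1 χ)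
    (hχc : HasCompactSupport χ) (h0 : ∀ x, ‖x‖ ≤ r → ∇ χ x = 0) {f : L2 n}
    (hf : VanishesOn {x | r < ‖x‖} f) (g : L2Vec n) : vForm (fun x => b x • ∇ χ x) f g = 0 := by
  rw [vForm_apply ((isCc_gradient hχ hχc).smul_left hb)]
  refine integral_eq_zero_of_ae ?_
  filter_upwards [hf] with x hx
  rcases le_or_gt ‖x‖ r with h | h
  · simp [h0 x h]
  · simp [hx h]

theorem integral_mul_le_young {a : Rn n → ℝ} (ha : Continuous a) (ha0 : ∀ x, 0 < a x)
    {f g : L2 n} (hf : VanishesOn {x | r < ‖x‖} f) (hg : VanishesOn {x | r < ‖x‖} g) {l : ℝ}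
    (hl : 0 < l) :
    ∫ x, f x * g x ≤ (1 / 2) * (l⁻¹ * ∫ x, a x * (g x * g x))
      + (1 / 2) * (l * ∫ x, (a x)⁻¹ * (f x * f x)) := by
  have i1 := integrable_mul_of_vanishesOn ha hg g
  have i2 := integrable_mul_of_vanishesOn (m := fun x => (a x)⁻¹)
    (ha.inv₀ fun x => (ha0 x).ne') hf f
  have i3 : Integrable fun x => f x * g x := by
    simpa using integrable_mul_of_vanishesOn (m := fun _ => 1) continuous_const hf g
  rw [← mul_assoc, ← mul_assoc, ← integral_const_mul, ← integral_const_mul,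
    ← integral_add (i1.const_mul _) (i2.const_mul _)]
  refine integral_mono i3 ((i1.const_mul _).add (i2.const_mul _)) fun x => ?_
  have hx := ha0 x
  have h2 : 0 ≤ (g x * a x - l * f x) ^ 2 / (2 * l * a x) := by positivity
  have h3 : 1 / 2 * l⁻¹ * (a x * (g x * g x)) + 1 / 2 * l * ((a x)⁻¹ * (f x * f x)) - f x * g x
      = (g x * a x - l * f x) ^ 2 / (2 * l * a x) := by
    field_simp
    ring
  beta_reduce
  linarith

end CutoffForms

/-! ### Differential inequalities for solutions with propagating support -/

section EnergyLevels

variable {n : ℕ} {a b c : Rn n → ℝ} {q : ℝ → ℝ} {σ R δ C₀ : ℝ} {u : ℝ → H1 n} {p H : ℝ → L2 n}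

/-- Up to time `T` all functions are supported in one ball. With a cutoff equal to one there, the
local energy and virial identities become global ones and the flux terms vanish. The comparison of
`c` with `a` is available only where `q(|x|) ≤ t + q(R)`, which is where the solution lives. -/
theorem IsEnergySol.energyLevel (hn : 1 ≤ n) (hq : IsSpeedProfile b c σ q) (hσ : σ < 2)
    (ha : Continuous a) (hb : Continuous b) (hc : Continuous c)
    (ha0 : ∀ x, 0 < a x) (hb0 : ∀ x, 0 < b x) (hc0 : ∀ x, 0 < c x)
    (hca : ∀ t, 0 ≤ t → ∀ x, q ‖x‖ ≤ t + q R → c x ≤ C₀ * (1 + t) ^ δ * a x)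
    (hu : IsEnergySol a b c u p H)
    (hp : ∀ t, 0 ≤ t → VanishesOn {x | t + q R < q ‖x‖} (p t))
    (hv : ∀ t, 0 ≤ t → VanishesOn {x | t + q R < q ‖x‖} (H1.toL2 (u t)))
    (hH : ∀ t, 0 ≤ t → VanishesOn {x | t + q R < q ‖x‖} (H t)) {T₀ T : ℝ} (h₀ : 0 ≤ T₀) :
    EnergyLevel T₀ T δ C₀
      (fun t => (1 / 2) * ∫ x, (c x * p t x ^ 2 + b x * ‖H1.grad (u t) x‖ ^ 2))
      (fun t => ∫ x, a x * (p t x * p t x))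
      (fun t => ∫ x, c x * (p t x * p t x))
      (fun t => ∫ x, a x * (H1.toL2 (u t) x * H1.toL2 (u t) x))
      (fun t => ∫ x, c x * (p t x * H1.toL2 (u t) x))
      (fun t => ∫ x, (a x)⁻¹ * (H t x * H t x)) := by
  obtain ⟨r, -, hr⟩ := hq.exists_radius hn hσ R T
  obtain ⟨χ, hχ, hχc, hχ0, -, h1, hg0⟩ := exists_cutoff (n := n) r
  have iχ : IsCc χ := ⟨hχ.continuous, hχc⟩
  have hχ1 : ContDiff ℝ 1 χ := hχ.of_le (by simp)
  have hai : Continuous fun x => (a x)⁻¹ := ha.inv₀ fun x => (ha0 x).ne'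
  have mono : ∀ {E : Type} [NormedAddCommGroup E] {t : ℝ} {f : Lp E 2 (volume : Measure (Rn n))},
      t ≤ T → VanishesOn {x | t + q R < q ‖x‖} f → VanishesOn {x | r < ‖x‖} f := by
    intro E _ t f ht hf
    filter_upwards [hf] with x hx h
    exact hx (hr t ht x h)
  have hp' : ∀ t, 0 ≤ t → t ≤ T → VanishesOn {x | r < ‖x‖} (p t) := fun t h0 h => mono h (hp t h0)
  have hv' : ∀ t, 0 ≤ t → t ≤ T → VanishesOn {x | r < ‖x‖} (H1.toL2 (u t)) :=
    fun t h0 h => mono h (hv t h0)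
  have hH' : ∀ t, 0 ≤ t → t ≤ T → VanishesOn {x | r < ‖x‖} (H t) := fun t h0 h => mono h (hH t h0)
  have hg' : ∀ t, 0 ≤ t → t ≤ T → VanishesOn {x | r < ‖x‖} (H1.grad (u t)) :=
    fun t h0 h => mono h (vanishesOn_grad hq (hv t h0))
  have eE : ∀ t, 0 ≤ t → t ≤ T → localEnergy b c χ (p t) (H1.grad (u t))
      = (1 / 2) * ∫ x, (c x * p t x ^ 2 + b x * ‖H1.grad (u t) x‖ ^ 2) := fun t h0 h =>
    localEnergy_cutoff hb hc iχ h1 (hp' t h0 h) (hg' t h0 h)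
  have cform : ∀ {m : Rn n → ℝ} (hm : Continuous m) {f g : ℝ → L2 n}, Continuous f →
      Continuous g → (∀ t, 0 ≤ t → t ≤ T → VanishesOn {x | r < ‖x‖} (f t)) →
      ContinuousOn (fun t => ∫ x, m x * (f t x * g t x)) (Icc T₀ T) := by
    intro m hm f g hf hg hfv
    refine (continuous_bilinear (wForm fun x => m x * χ x) hf hg).continuousOn.congr fun t ht => ?_
    exact (wForm_mul_cutoff iχ h1 hm (hfv t (h₀.trans ht.1) ht.2) (g t)).symm
  have nn : ∀ {m : Rn n → ℝ} (hm : ∀ x, 0 < m x) (f : L2 n), 0 ≤ ∫ x, m x * (f x * f x) :=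
    fun hm f => integral_nonneg fun x => mul_nonneg (hm x).le (mul_self_nonneg _)
  have hgrad : ∀ t, 0 ≤ wForm (fun x => b x * χ x) (H1.grad (u t)) (H1.grad (u t)) := by
    intro t
    rw [wForm_apply (iχ.mul_left hb)]
    refine integral_nonneg fun x => ?_
    exact mul_nonneg (mul_nonneg (hb0 x).le (hχ0 x)) real_inner_self_nonneg
  have near : ∀ t ∈ Ioo T₀ T, ∀ᶠ s in 𝓝 t, 0 ≤ s ∧ s ≤ T := fun t ht => by
    filter_upwards [Ioo_mem_nhds ht.1 ht.2] with s hs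
    exact ⟨h₀.trans hs.1.le, hs.2.le⟩
  refine
    { cont_E := ?_
      cont_D := cform ha hu.cont_p hu.cont_p hp'
      cont_V := cform ha hu.cont_toL2 hu.cont_toL2 hv'
      cont_X := cform hc hu.cont_p hu.cont_toL2 hp'
      cont_G := cform hai hu.cont_H hu.cont_H hH'
      D_nonneg := fun t _ => nn ha0 _
      P_nonneg := fun t _ => nn hc0 _
      V_nonneg := fun t _ => nn ha0 _
      G_nonneg := fun t _ => nn (fun x => inv_pos.2 (ha0 x)) _
      P_le := fun t ht => ?_
      deriv_E := fun t ht => ?_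
      deriv_Z := fun t ht => ?_
      P_le_D := fun t ht => ?_
      X_le := fun t ht => ?_ }
  · refine (continuous_localEnergy (b := b) (c := c) (m := χ) hu.cont_p
      hu.cont_grad).continuousOn.congr fun t ht => ?_
    exact (eE t (h₀.trans ht.1) ht.2).symm
  · have h0 := h₀.trans ht.1
    rw [← eE t h0 ht.2, localEnergy_cutoff_eq_add hc iχ h1 (hp' t h0 ht.2)]
    linarith [hgrad t]
  · have h0 : 0 < t := h₀.trans_lt ht.1
    refine ⟨_, (hu.hasDerivAt_localEnergy ha hb hc hχ1 hχc h0).congr_of_eventuallyEq ?_, ?_⟩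
    · filter_upwards [near t ht] with s hs
      exact (eE s hs.1 hs.2).symm
    · have hpt := hp' t h0.le ht.2.le
      have hHt := hH' t h0.le ht.2.le
      rw [wForm_cutoff iχ h1 hHt, wForm_mul_cutoff iχ h1 ha hpt,
        vForm_gradient_cutoff hb hχ1 hχc hg0 hpt]
      have := integral_mul_le_young ha ha0 hHt hpt one_pos
      rw [inv_one, one_mul, one_mul] at this
      linarith
  · have h0 : 0 < t := h₀.trans_lt ht.1
    refine ⟨_, (hu.hasDerivAt_localVirial ha hb hc hχ1 hχc h0).congr_of_eventuallyEq ?_, ?_⟩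
    · filter_upwards [near t ht] with s hs
      rw [localVirial, wForm_mul_cutoff iχ h1 hc (hp' s hs.1 hs.2),
        wForm_mul_cutoff iχ h1 ha (hv' s hs.1 hs.2)]
    · intro l hl
      have hpt := hp' t h0.le ht.2.le
      have hvt := hv' t h0.le ht.2.le
      have hHt := hH' t h0.le ht.2.le
      rw [wForm_cutoff iχ h1 hHt, wForm_mul_cutoff iχ h1 hc hpt,
        vForm_gradient_cutoff hb hχ1 hχc hg0 hvt]
      have h2 := localEnergy_cutoff_eq_add (b := b) hc iχ h1 hpt (H1.grad (u t))
      rw [eE t h0.le ht.2.le] at h2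
      have := integral_mul_le_young ha ha0 hHt hvt hl
      linarith
  · have h0 := h₀.trans ht.1
    exact integral_mul_self_le hc ha (hp' t h0 ht.2) (hp t h0) fun x hx => hca t h0 x (not_lt.1 hx)
  · have h0 := h₀.trans ht.1
    have i1 := integrable_mul_of_vanishesOn hc (hp' t h0 ht.2) (H1.toL2 (u t))
    have i2 := integrable_mul_of_vanishesOn hc (hp' t h0 ht.2) (p t)
    have i3 := integrable_mul_of_vanishesOn ha (hv' t h0 ht.2) (H1.toL2 (u t))
    rw [← mul_assoc (1 / 2 : ℝ) (C₀ * (1 + t) ^ δ), ← integral_const_mul, ← integral_const_mul,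
      ← integral_add (i3.const_mul _) (i2.const_mul _)]
    refine (abs_integral_le_integral_abs).trans ?_
    refine integral_mono_ae i1.abs ((i3.const_mul _).add (i2.const_mul _)) ?_
    filter_upwards [hp t h0] with x hx
    beta_reduce
    set v := H1.toL2 (u t) x
    rcases le_or_gt (q ‖x‖) (t + q R) with h | h
    · have hax := ha0 x
      have hcx := hc0 x
      have h4 := hca t h0 x h
      have h5 : |c x * (p t x * v)| ≤ (1 / 2) * (a x * (v * v))
          + (1 / 2) * (c x * c x / a x) * (p t x * p t x) := by
        -- One completed square, used with `ε = 1` and `ε = -1`, gives both halves of the absolute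
        -- value bound.
        have h6 : ∀ ε : ℝ, ε * ε = 1 → 0 ≤ (1 / 2) * (a x * (v * v))
            + (1 / 2) * (c x * c x / a x) * (p t x * p t x) + ε * (c x * (p t x * v)) := by
          intro ε hε
          have : (1 / 2) * (a x * (v * v)) + (1 / 2) * (c x * c x / a x) * (p t x * p t x)
              + ε * (c x * (p t x * v))
              = (a x * v + ε * (c x * p t x)) ^ 2 / (2 * a x)
                + (1 / 2) * (c x * c x / a x) * (p t x * p t x) * (1 - ε * ε) := by
            field_simp
            ring
          rw [this, hε]
          have : 0 ≤ (a x * v + ε * (c x * p t x)) ^ 2 / (2 * a x) := by positivity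
          linarith
        rw [abs_le]
        constructor
        · linarith [h6 1 (by norm_num)]
        · linarith [h6 (-1) (by norm_num)]
      have h7 : c x * c x / a x ≤ C₀ * (1 + t) ^ δ * c x := by
        rw [div_le_iff₀ hax]
        calc c x * c x ≤ c x * (C₀ * (1 + t) ^ δ * a x) := by gcongr
          _ = _ := by ring
      have h8 := mul_le_mul_of_nonneg_right h7 (mul_self_nonneg (p t x))
      linarith
    · rw [hx h]
      have : 0 ≤ a x * (v * v) := mul_nonneg (ha0 x).le (mul_self_nonneg _)
      simp
      linarith

end EnergyLevels

/-! ### Comparing the coefficients in the region of propagation -/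

section CoefficientBounds

variable {n : ℕ} {b c f g : Rn n → ℝ} {q : ℝ → ℝ} {σ : ℝ}

theorem HasPowerGrowth.pos {s : ℝ} (hf : HasPowerGrowth f s) (x : Rn n) : 0 < f x := by
  obtain ⟨m, _, hm, _, h⟩ := hf
  exact (by positivity : 0 < m * (1 + ‖x‖) ^ s).trans_le (h x).1

/-- The region `q(|x|) ≤ t + q(R)` is contained in a ball of radius `O((1 + t) ^ (2 / (2 - σ)))`. -/
theorem IsSpeedProfile.exists_one_add_norm_le (hq : IsSpeedProfile b c σ q) (hσ : σ < 2) (R : ℝ) :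
    ∃ L : ℝ, 1 ≤ L ∧ ∀ t, 0 ≤ t → ∀ x : Rn n, q ‖x‖ ≤ t + q R →
      1 + ‖x‖ ≤ L * (1 + t) ^ (2 / (2 - σ)) := by
  obtain ⟨q₀, hq₀, hgr⟩ := hq.growth
  set e := 2 / (2 - σ) with he
  have he0 : 0 < e := div_pos two_pos (by linarith)
  set M := (1 + |q R|) / q₀ with hM
  have hM0 : 0 < M := by positivity
  refine ⟨1 + M ^ e, by linarith [Real.rpow_pos_of_pos hM0 e], fun t ht x hx => ?_⟩
  have h1 : ‖x‖ ^ (1 - σ / 2) ≤ M * (1 + t) := by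
    rw [hM, div_mul_eq_mul_div, le_div_iff₀ hq₀]
    have := hgr ‖x‖ (norm_nonneg x)
    have := mul_nonneg (abs_nonneg (q R)) ht
    linarith [le_abs_self (q R)]
  have h2 : ‖x‖ ≤ M ^ e * (1 + t) ^ e := by
    have h3 : (1 - σ / 2) * e = 1 := by
      rw [he]
      field_simp
      exact div_self (by linarith)
    calc ‖x‖ = (‖x‖ ^ (1 - σ / 2)) ^ e := by
          rw [← Real.rpow_mul (norm_nonneg x), h3, Real.rpow_one]
      _ ≤ (M * (1 + t)) ^ e := Real.rpow_le_rpow (by positivity) h1 he0.le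
      _ = _ := Real.mul_rpow hM0.le (by linarith)
  have h4 : 1 ≤ (1 + t) ^ e := Real.one_le_rpow (by linarith) he0.le
  linarith

/-- The quotient `g / f` is at most a multiple of `(1 + |x|) ^ (s' - s)`, and `1 + |x|` is bounded
by a power of `1 + t` in this region. For `g = c`, `f = a` the threshold for `η` is the lower bound
`max 0 (2 (α - γ) / (2 - β - γ))` imposed on `ω₀`. -/
theorem IsSpeedProfile.exists_le_mul_rpow_mul (hq : IsSpeedProfile b c σ q) (hσ : σ < 2) (R : ℝ)
    {s s' η : ℝ} (hf : HasPowerGrowth f s) (hg : HasPowerGrowth g s')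
    (hη : 2 / (2 - σ) * max 0 (s' - s) ≤ η) :
    ∃ C : ℝ, 0 ≤ C ∧ ∀ t, 0 ≤ t → ∀ x : Rn n, q ‖x‖ ≤ t + q R → g x ≤ C * (1 + t) ^ η * f x := by
  obtain ⟨L, hL, hLx⟩ := hq.exists_one_add_norm_le hσ R
  obtain ⟨m, _, hm, _, hf'⟩ := hf
  obtain ⟨_, M, _, hM, hg'⟩ := hg
  set ρ := max 0 (s' - s)
  have hρ : 0 ≤ ρ := le_max_left _ _
  refine ⟨M / m * L ^ ρ, by positivity, fun t ht x hx => ?_⟩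
  have h1 : 1 ≤ 1 + ‖x‖ := by linarith [norm_nonneg x]
  have h0 : 0 < 1 + ‖x‖ := by linarith
  have h2 : (1 + ‖x‖) ^ (s' - s) ≤ L ^ ρ * (1 + t) ^ η := by
    calc (1 + ‖x‖) ^ (s' - s) ≤ (1 + ‖x‖) ^ ρ :=
          Real.rpow_le_rpow_of_exponent_le h1 (le_max_right _ _)
      _ ≤ (L * (1 + t) ^ (2 / (2 - σ))) ^ ρ := Real.rpow_le_rpow h0.le (hLx t ht x hx) hρ
      _ = L ^ ρ * (1 + t) ^ (2 / (2 - σ) * ρ) := by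
          rw [Real.mul_rpow (by linarith) (by positivity), ← Real.rpow_mul (by linarith)]
      _ ≤ _ := by
          gcongr
          linarith
  calc g x ≤ M * (1 + ‖x‖) ^ s' := (hg' x).2
    _ = M / m * (1 + ‖x‖) ^ (s' - s) * (m * (1 + ‖x‖) ^ s) := by
        rw [Real.rpow_sub h0]
        field_simp
    _ ≤ M / m * (L ^ ρ * (1 + t) ^ η) * f x := by
        gcongr
        exact (hf' x).1
    _ = _ := by ring

end CoefficientBounds

/-! ### Assembling the estimate -/

section Tower

variable {n : ℕ} {a b c : Rn n → ℝ} {q : ℝ → ℝ} {σ R δ C₀ μ θ : ℝ} {h : ℝ → Rn n → ℝ} {k : ℕ}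
  {u₀ : H1 n} {u₁ : L2 n} {u : ℝ → H1 n}

theorem energy_nonneg (hb0 : ∀ x, 0 < b x) (hc0 : ∀ x, 0 < c x) (v : ℝ → H1 n) (t : ℝ) :
    0 ≤ energy b c v t := by
  refine mul_nonneg (by norm_num) (integral_nonneg fun x => ?_)
  have := (hb0 x).le
  have := (hc0 x).le
  positivity

/-- The source energy `∫ (∂_t^i h)² / a`. -/
def sourceEnergy (a : Rn n → ℝ) (h : ℝ → Rn n → ℝ) (i : ℕ) (t : ℝ) : ℝ :=
  ∫ x, (a x)⁻¹ * (sourceLp (sourceDeriv i h) t x * sourceLp (sourceDeriv i h) t x)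

theorem sourceEnergy_nonneg (ha0 : ∀ x, 0 < a x) (h : ℝ → Rn n → ℝ) (i : ℕ) (t : ℝ) :
    0 ≤ sourceEnergy a h i t :=
  integral_nonneg fun x => mul_nonneg (inv_pos.2 (ha0 x)).le (mul_self_nonneg _)

theorem IsSource.integral_sum_source (hn : 1 ≤ n) (hq : IsSpeedProfile b c σ q) (hσ : σ < 2)
    (ha : Continuous a) (ha0 : ∀ x, 0 < a x) (hh : IsSource q R h) {t : ℝ} (ht : 0 ≤ t) :
    ∫ x, (1 + t) ^ (θ + 1) *
        ∑ i ∈ Finset.range (k + 1), (1 + t) ^ (2 * i) * (sourceDeriv i h t x) ^ 2 / a x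
      = ∑ i ∈ Finset.range (k + 1), (1 + t) ^ (θ + 1 + 2 * i) * sourceEnergy a h i t := by
  obtain ⟨r, -, hr⟩ := hq.exists_radius hn hσ R t
  have key : ∀ i : ℕ, ∀ᵐ x : Rn n, (1 + t) ^ (θ + 1 + 2 * i) *
      ((a x)⁻¹ * (sourceLp (sourceDeriv i h) t x * sourceLp (sourceDeriv i h) t x))
      = (1 + t) ^ (θ + 1) * ((1 + t) ^ (2 * i) * (sourceDeriv i h t x) ^ 2 / a x) := fun i => by
    filter_upwards [(hh.iterate i).coeFn_sourceLp hn hq hσ t] with x hx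
    rw [hx, max_eq_left ht, Real.rpow_add (by linarith)]
    have : (1 + t) ^ (2 * (i : ℝ)) = (1 + t) ^ (2 * i) := by
      rw [← Real.rpow_natCast]
      push_cast
      rfl
    rw [this]
    ring
  have int : ∀ i : ℕ, Integrable fun x : Rn n => (1 + t) ^ (θ + 1 + 2 * i) *
      ((a x)⁻¹ * (sourceLp (sourceDeriv i h) t x * sourceLp (sourceDeriv i h) t x)) := fun i => by
    refine (integrable_mul_of_vanishesOn (r := r) (ha.inv₀ fun x => (ha0 x).ne') ?_ _).const_mul _
    filter_upwards [(hh.iterate i).vanishesOn_sourceLp hn hq hσ ht] with x hx hxr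
    exact hx (hr t le_rfl x hxr)
  simp only [Finset.mul_sum, sourceEnergy, ← integral_const_mul]
  rw [integral_finsetSum _ fun i _ => (int i).congr (key i)]
  exact Finset.sum_congr rfl fun i _ => integral_congr_ae ((key i).mono fun x hx => hx.symm)

theorem IsSolution.energyLevel (hn : 1 ≤ n) (hq : IsSpeedProfile b c σ q) (hσ : σ < 2)
    (hR : 0 < R) (ha : Continuous a) (hb : Continuous b) (hc : Continuous c)
    (ha0 : ∀ x, 0 < a x) (hb0 : ∀ x, 0 < b x) (hc0 : ∀ x, 0 < c x)
    (hca : ∀ t, 0 ≤ t → ∀ x, q ‖x‖ ≤ t + q R → c x ≤ C₀ * (1 + t) ^ δ * a x)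
    (hh : IsSource q R h) (hu : IsSolution a b c h k u₀ u₁ u)
    (hu₀ : ∀ᵐ x, R < ‖x‖ → H1.toL2 u₀ x = 0) (hu₁ : ∀ᵐ x, R < ‖x‖ → u₁ x = 0)
    {T₀ T : ℝ} (h₀ : 0 ≤ T₀) {j : ℕ} (hj : j ≤ k) :
    (∀ t, 0 ≤ t → VanishesOn {x | t + q R < q ‖x‖} (velocity (timeDeriv j u) t)) ∧
    EnergyLevel T₀ T δ C₀
      (fun t => energy b c (timeDeriv j u) (max t 0))
      (fun t => ∫ x, a x * (velocity (timeDeriv j u) (max t 0) x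
        * velocity (timeDeriv j u) (max t 0) x))
      (fun t => ∫ x, c x * (velocity (timeDeriv j u) (max t 0) x
        * velocity (timeDeriv j u) (max t 0) x))
      (fun t => ∫ x, a x * (H1.toL2 (timeDeriv j u (max t 0)) x
        * H1.toL2 (timeDeriv j u (max t 0)) x))
      (fun t => ∫ x, c x * (velocity (timeDeriv j u) (max t 0) x
        * H1.toL2 (timeDeriv j u (max t 0)) x))
      (sourceEnergy a h j) := by
  obtain ⟨m, rfl⟩ := Nat.exists_eq_add_of_le' hj
  have hv := fun s hs => hu.vanishesOn hn hq hσ hR hh ha hb hc ha0 hb0 hc0 hu₀ hu₁ (t := s) hs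
  have hvj := hu.vanishesOn_iterate hb hc ha hh hq j hv
  obtain ⟨v₀, v₁, hw⟩ := hu.iterate hb hc ha hh j
  have hpj := fun t ht => hw.vanishesOn_velocity hq hvj (t := t) ht
  refine ⟨hpj, ?_⟩
  refine (hw.isEnergySol hn hq hσ (hh.iterate j)).energyLevel hn hq hσ ha hb hc ha0 hb0 hc0 hca
    (fun t ht => ?_) (fun t ht => ?_)
    (fun t ht => (hh.iterate j).vanishesOn_sourceLp hn hq hσ ht) h₀
  · rw [max_eq_left ht]
    exact hpj t ht
  · rw [max_eq_left ht]
    exact hvj t ht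

/-- The coupling of levels holds because `∂_t^(j+1) u`, seen in `L²`, is the velocity of `∂_t^j u`.
All terms of the bracket are nonnegative, so it bounds each of them separately. -/
theorem IsSolution.energyTower (hn : 1 ≤ n) (hq : IsSpeedProfile b c σ q) (hσ : σ < 2)
    (hR : 0 < R) (ha : Continuous a) (hb : Continuous b) (hc : Continuous c)
    (ha0 : ∀ x, 0 < a x) (hb0 : ∀ x, 0 < b x) (hc0 : ∀ x, 0 < c x)
    (hca : ∀ t, 0 ≤ t → ∀ x, q ‖x‖ ≤ t + q R → c x ≤ C₀ * (1 + t) ^ δ * a x)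
    (hac : ∀ t, 0 ≤ t → ∀ x, q ‖x‖ ≤ t + q R → a x ≤ C₀ * (1 + t) ^ μ * c x)
    (hh : IsSource q R h) (hu : IsSolution a b c h k u₀ u₁ u)
    (hu₀ : ∀ᵐ x, R < ‖x‖ → H1.toL2 u₀ x = 0) (hu₁ : ∀ᵐ x, R < ‖x‖ → u₁ x = 0)
    {T₀ T : ℝ} (h₀ : 0 ≤ T₀) (hT : T₀ ≤ T) :
    EnergyTower k T₀ T δ C₀ θ μ (energyBound a b c h k θ (θ + δ) u T₀ T)
      (fun j t => energy b c (timeDeriv j u) (max t 0))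
      (fun j t => ∫ x, a x * (velocity (timeDeriv j u) (max t 0) x
        * velocity (timeDeriv j u) (max t 0) x))
      (fun j t => ∫ x, c x * (velocity (timeDeriv j u) (max t 0) x
        * velocity (timeDeriv j u) (max t 0) x))
      (fun j t => ∫ x, a x * (H1.toL2 (timeDeriv j u (max t 0)) x
        * H1.toL2 (timeDeriv j u (max t 0)) x))
      (fun j t => ∫ x, c x * (velocity (timeDeriv j u) (max t 0) x
        * H1.toL2 (timeDeriv j u (max t 0)) x))
      (fun j => sourceEnergy a h j) := by
  have level := fun j (hj : j ≤ k) => hu.energyLevel (T := T) (C₀ := C₀) (δ := δ) hn hq hσ hR ha hb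
    hc ha0 hb0 hc0 hca hh hu₀ hu₁ h₀ hj
  have hI0 : ∀ j ≤ k, (1 + T₀) ^ (θ + δ) * energy b c (timeDeriv j u) T₀
      ≤ (1 + T₀) ^ (θ + δ) * ∑ i ∈ Finset.range (k + 1), energy b c (timeDeriv i u) T₀ :=
    fun j hj => by
      refine mul_le_mul_of_nonneg_left ?_ (Real.rpow_nonneg (by linarith) _)
      exact Finset.single_le_sum (f := fun i => energy b c (timeDeriv i u) T₀)
        (fun i _ => energy_nonneg hb0 hc0 _ _) (Finset.mem_range.2 (by omega))
  have hI1 : 0 ≤ ∫ t in T₀..T, (1 + t) ^ θ * energy b c u t :=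
    intervalIntegral.integral_nonneg hT fun t ht =>
      mul_nonneg (Real.rpow_nonneg (by linarith [ht.1]) _) (energy_nonneg hb0 hc0 _ _)
  have hI2 : (∫ t in T₀..T, ∫ x, (1 + t) ^ (θ + 1) *
        ∑ i ∈ Finset.range (k + 1), (1 + t) ^ (2 * i) * (sourceDeriv i h t x) ^ 2 / a x)
      = ∑ i ∈ Finset.range (k + 1),
        ∫ t in T₀..T, (1 + t) ^ (θ + 1 + 2 * i) * sourceEnergy a h i t := by
    rw [← intervalIntegral.integral_finsetSum]
    · refine intervalIntegral.integral_congr fun t ht => ?_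
      rw [uIcc_of_le hT] at ht
      exact hh.integral_sum_source hn hq hσ ha ha0 (h₀.trans ht.1)
    · intro i hi
      refine ContinuousOn.intervalIntegrable_of_Icc hT (.mul ?_
        (level i (by simpa [Nat.lt_succ_iff] using hi)).2.cont_G)
      exact ContinuousOn.rpow_const (by fun_prop) fun t ht => Or.inl (by linarith [ht.1])
  have hI2' : ∀ i : ℕ, 0 ≤ ∫ t in T₀..T, (1 + t) ^ (θ + 1 + 2 * i) * sourceEnergy a h i t := fun i =>
    intervalIntegral.integral_nonneg hT fun t ht =>
      mul_nonneg (Real.rpow_nonneg (by linarith [ht.1]) _) (sourceEnergy_nonneg ha0 _ _ _)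
  have hI0' : 0 ≤ (1 + T₀) ^ (θ + δ) * ∑ i ∈ Finset.range (k + 1),
      energy b c (timeDeriv i u) T₀ :=
    mul_nonneg (Real.rpow_nonneg (by linarith) _)
      (Finset.sum_nonneg fun i _ => energy_nonneg hb0 hc0 _ _)
  have hI2'' := Finset.sum_nonneg fun i (_ : i ∈ Finset.range (k + 1)) => hI2' i
  refine
    { level := fun j hj => (level j hj).2
      V_succ := fun j hj t ht => ?_
      D_le := fun j hj => ?_
      initial_le := fun j hj => ?_
      energy_le := ?_
      source_le := fun j hj => ?_ }
  · obtain ⟨m, rfl⟩ := Nat.exists_eq_add_of_le' (Nat.succ_le_of_lt hj)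
    rw [show m + j.succ = m + 1 + j by omega] at hu
    obtain ⟨v₀, v₁, hw⟩ := hu.iterate hb hc ha hh j
    simp only [timeDeriv_succ j, hw.toL2_timeDeriv (le_max_right t 0)]
  · obtain ⟨r, -, hr⟩ := hq.exists_radius hn hσ R T₀
    have hp := (level j hj).1 T₀ h₀
    rw [max_eq_left h₀]
    refine integral_mul_self_le (r := r) ha hc ?_ hp fun x hx => hac T₀ h₀ x (not_lt.1 hx)
    filter_upwards [hp] with x hx hxr
    exact hx (hr T₀ le_rfl x hxr)
  · rw [max_eq_left h₀, energyBound, hI2]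
    linarith [hI0 j hj]
  · have : ∫ t in T₀..T, (1 + t) ^ θ * energy b c (timeDeriv 0 u) (max t 0)
        = ∫ t in T₀..T, (1 + t) ^ θ * energy b c u t := by
      refine intervalIntegral.integral_congr fun t ht => ?_
      rw [uIcc_of_le hT] at ht
      simp only [timeDeriv_zero, max_eq_left (h₀.trans ht.1)]
    rw [this, energyBound, hI2]
    linarith
  · rw [energyBound, hI2]
    have := Finset.single_le_sum (fun i _ => hI2' i) (Finset.mem_range.2 (Nat.lt_succ_of_le hj))
    linarith

theorem exists_energy_decay (hn : 1 ≤ n) {α β γ : ℝ} (ha : Continuous a) (hb : Continuous b)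
    (hc : Continuous c) (hag : HasPowerGrowth a (-α)) (hbg : HasPowerGrowth b β)
    (hcg : HasPowerGrowth c (-γ)) (hβγ : β + γ < 2) (hq : IsSpeedProfile b c (β + γ) q)
    (hR : 0 < R) (k : ℕ) (θ : ℝ) (hδ : max 0 (2 * (α - γ) / (2 - β - γ)) < δ) (hδ1 : δ < 1) :
    ∃ (p : ℕ) (C : ℝ), 0 < C ∧
      ∀ (h : ℝ → Rn n → ℝ) (u₀ : H1 n) (u₁ : L2 n) (u : ℝ → H1 n), IsSource q R h →
        (∀ᵐ x, R < ‖x‖ → H1.toL2 u₀ x = 0) → (∀ᵐ x, R < ‖x‖ → u₁ x = 0) →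
        IsSolution a b c h k u₀ u₁ u → ∀ T₀ T Λ : ℝ, 0 ≤ T₀ → T₀ ≤ T → 0 < Λ →
          1 + T ≤ Λ * (1 + T - T₀) →
          energy b c (timeDeriv k u) T ≤
            C * Λ ^ p * ((1 + T) ^ (-θ - 2 * k - 1) * energyBound a b c h k θ (θ + δ) u T₀ T) := by
  have hδ0 : 0 < δ := (le_max_left _ _).trans_lt hδ
  have hden : 0 < 2 - (β + γ) := by linarith
  obtain ⟨C₁, hC₁, hca⟩ := hq.exists_le_mul_rpow_mul (η := δ) hβγ R hag hcg (by
    refine le_trans (le_of_eq ?_) hδ.le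
    rw [mul_max_of_nonneg _ _ (by positivity), mul_zero]
    congr 1
    rw [← sub_sub]
    ring)
  -- Unlike `δ`, this exponent need not be below one: it only affects the choice of `N`.
  set μ := 2 / (2 - (β + γ)) * max 0 (-α - -γ) with hμ
  obtain ⟨C₂, hC₂, hac⟩ := hq.exists_le_mul_rpow_mul (η := μ) hβγ R hcg hag le_rfl
  have hμ0 : 0 ≤ μ := mul_nonneg (by positivity) (le_max_left _ _)
  obtain ⟨p, C, hC, hdecay⟩ := EnergyTower.exists_decay (C₀ := C₁ + C₂) k hδ0 hδ1 (by linarith) hμ0 θ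
  refine ⟨p, C, hC, fun h u₀ u₁ u hh hu₀ hu₁ hu T₀ T Λ h₀ hT hΛ hTΛ => ?_⟩
  have tower := hu.energyTower (C₀ := C₁ + C₂) (θ := θ) (δ := δ) (μ := μ) hn hq hβγ hR ha hb hc
    hag.pos hbg.pos hcg.pos
    (fun t ht x hx => (hca t ht x hx).trans (by
      have := (hag.pos x).le
      gcongr
      linarith))
    (fun t ht x hx => (hac t ht x hx).trans (by
      have := (hcg.pos x).le
      gcongr
      linarith)) hh hu₀ hu₁ h₀ hT
  have := hdecay T₀ T _ Λ _ _ _ _ _ _ h₀ hT hΛ hTΛ tower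
  rwa [max_eq_left (h₀.trans hT)] at this

end Tower

end DampedWave

end

theorem proposition3p3 {n : ℕ} (hn : 1 ≤ n)
    (a b c : DampedWave.Rn n → ℝ) (α β γ : ℝ)
    (ha : ContDiff ℝ ∞ a) (hb : ContDiff ℝ ∞ b) (hc : ContDiff ℝ ∞ c)
    (ha_growth : DampedWave.HasPowerGrowth a (-α))
    (hb_growth : DampedWave.HasPowerGrowth b β)
    (hc_growth : DampedWave.HasPowerGrowth c (-γ))
    (hβγ : β + γ < 2) (hαβγ : 2 * α + β - γ < 2)
    (q : ℝ → ℝ) (hq : DampedWave.IsSpeedProfile b c (β + γ) q)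
    (R : ℝ) (hR : 0 < R)
    (k : ℕ) (θ ω₀ ν : ℝ) (hθ : 0 < θ)
    (hω : max 0 (2 * (α - γ) / (2 - β - γ)) < ω₀) (hω1 : ω₀ < 1) (hν : θ = ν - ω₀) :
    -- for every `T₀ ≥ 0` the estimate holds for all `T ≥ T₀`
    (∀ T₀ : ℝ, 0 ≤ T₀ → ∃ C : ℝ, 0 < C ∧
      ∀ (h : ℝ → DampedWave.Rn n → ℝ) (u₀ : DampedWave.H1 n) (u₁ : DampedWave.L2 n)
        (u : ℝ → DampedWave.H1 n),
        DampedWave.IsSource q R h →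
        (∀ᵐ x, R < ‖x‖ → DampedWave.H1.toL2 u₀ x = 0) →
        (∀ᵐ x, R < ‖x‖ → u₁ x = 0) →
        DampedWave.IsSolution a b c h k u₀ u₁ u →
        ∀ T : ℝ, T₀ ≤ T →
          DampedWave.energy b c (DampedWave.timeDeriv k u) T ≤
            C * ((1 + T) ^ (-θ - 2 * k - 1) *
              DampedWave.energyBound a b c h k θ ν u T₀ T)) ∧
    -- and the constant is independent of `T₀` as long as `T ≥ 2 T₀`
    (∃ C : ℝ, 0 < C ∧
      ∀ (h : ℝ → DampedWave.Rn n → ℝ) (u₀ : DampedWave.H1 n) (u₁ : DampedWave.L2 n)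
        (u : ℝ → DampedWave.H1 n),
        DampedWave.IsSource q R h →
        (∀ᵐ x, R < ‖x‖ → DampedWave.H1.toL2 u₀ x = 0) →
        (∀ᵐ x, R < ‖x‖ → u₁ x = 0) →
        DampedWave.IsSolution a b c h k u₀ u₁ u →
        ∀ T₀ T : ℝ, 0 ≤ T₀ → 2 * T₀ ≤ T →
          DampedWave.energy b c (DampedWave.timeDeriv k u) T ≤
            C * ((1 + T) ^ (-θ - 2 * k - 1) *
              DampedWave.energyBound a b c h k θ ν u T₀ T)) := by
  obtain ⟨p, C, hC, hdecay⟩ := DampedWave.exists_energy_decay hn ha.continuous hb.continuous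
    hc.continuous ha_growth hb_growth hc_growth hβγ hq hR k θ hω hω1
  rw [show θ + ω₀ = ν by linarith] at hdecay
  -- For fixed `T₀` take `Λ = 1 + T₀`, as `(1 + T₀) (1 + T - T₀) = 1 + T + T₀ (T - T₀)`; for `T ≥ 2
  -- T₀` the value `Λ = 2` suffices.
  refine ⟨fun T₀ h₀ => ⟨C * (1 + T₀) ^ p, by positivity, ?_⟩, C * 2 ^ p, by positivity, ?_⟩
  · intro h u₀ u₁ u hh hu₀ hu₁ hu T hT
    refine hdecay h u₀ u₁ u hh hu₀ hu₁ hu T₀ T (1 + T₀) h₀ hT (by linarith) ?_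
    have := mul_nonneg h₀ (sub_nonneg.2 hT)
    linarith
  · intro h u₀ u₁ u hh hu₀ hu₁ hu T₀ T h₀ hT
    exact hdecay h u₀ u₁ u hh hu₀ hu₁ hu T₀ T 2 h₀ (by linarith) two_pos (by linarith)
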